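/- Let $k,\ell\ge 1$ be coprime integers, $n\ge 1$, let $f_1,\dots,f_n\in\mathbb C^*$ be pairwise distinct, and put $f=xy\prod_{i=1}^n(y^k-f_ix^\ell)$ and $d=k\ell n+k+\ell$. Let $\sigma$ be the (minimal) desingularization map of $f$, and let $D_c$ be its principal component, i.e. the component of the exceptional divisor met by the strict transforms of the curves $y^k=f_ix^\ell$. Let $\mathcal Q(f)$ be the set of germs of holomorphic $1$-forms $\omega=a\,dx+b\,dy$ on $(\mathbb C^2,0)$ with isolated singularity which define a non-dicritical foliation with the following properties: its desingularization map is $\sigma$; no singularity of its strict transform is a saddle-node; its separatrices are topologically conjugated to $\{f=0\}$; and $\{x=0\}$ and $\{y=0\}$ are invariant. Let $\mathcal Q^d(f)$ be the set of those $\omega_d=a\,dx+b\,dy\in\mathcal Q(f)$ for which $a$ and $b$ are $(k,\ell)$-quasi-homogeneous polynomials ($x$ of weight $k$, $y$ of weight $\ell$) of degrees $d-k$ and $d-\ell$. For $\omega_d\in\mathcal Q^d(f)$ let $\mathcal Q(\omega_d)$ be the set of those $\omega\in\mathcal Q(f)$ with $\omega=\omega_d+\omega_{d+1}+\omega_{d+2}+\cdots$,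 where the coefficients of $dx$ and $dy$ in $\omega_m$ are quasi-homogeneous of degrees $m-k$ and $m-\ell$. Let $\omega_d=a\,dx+b\,dy\in\mathcal Q^d(f)$ and $q=kxa+\ell yb$. For $m\ge 1$ write $$\frac{1}{y}\left(ma+\frac{\partial q}{\partial x}\right)=\sum_{i=0}^nA_ix^{\ell(n-i)}y^{ki},\qquad \frac1x\left(mb+\frac{\partial q}{\partial y}\right)=\sum_{i=0}^nB_ix^{\ell i}y^{k(n-i)},$$ set $A_i=B_i=0$ for $i\in\mathbb Z\setminus\{0,\dots,n\}$, let $e_m$ be the number of $(i,j)\in\mathbb N^2$ with $ki+\ell j=m$, and let $$M_m=\begin{pmatrix}(A_{r-s})_{r,s} & (B_{n-r+s})_{r,s}\\ (A_{n+r-s})_{r,s} & (B_{s-r})_{r,s}\end{pmatrix},\qquad 0\le r,s\le e_m-1.$$ Call $\omega_d$ generic if the Camacho–Sad indices with respect to $D_c$ of the strict transform by $\sigma$ of the foliation $\omega_d=0$, at all its singular points on $D_c$ (the two corners, or intersections with the strict transforms of the axes, included), are not rational, and $\det M_m\neq 0$ for $m=1,\dots,k\ell n-1$. Theorem. Let $\omega_d\in\mathcal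 Q^d(f)$ be generic. Then each $\omega\in\mathcal Q(\omega_d)$ is strictly formally orbitally equivalent to a unique form $$\omega_{h,s}=\omega_d+d(xyh)+s\,(\ell y\,dx-kx\,dy),$$ $$h(x,y)=\sum_{\substack{ki+\ell j\ge k\ell n+1\\ 0\le i\le \ell n-1\\ 0\le j\le kn-1}}h_{ij}x^iy^j,\qquad s(x,y)=\sum_{j=0}^{kn-1}s_j(x)\,x^{\ell n+1+]\frac{1-\ell j}{k}]}\,y^j,$$ with $h_{ij}\in\mathbb C$ and formal series $s_j\in\mathbb C[[x]]$; moreover $h$ and the $s_j$ are unique. Here $]r]$ is the integer with $]r]<r\le\, ]r]+1$, and $\omega$ and $\omega'$ are called strictly formally orbitally equivalent if $u\cdot\phi^*\omega=\omega'$ for some formal change of coordinates $\phi$ with $\phi(0)=0$, $D\phi(0)=\mathrm{Id}$, and some formal series $u$ with $u(0)=1$. -/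

import Mathlib

noncomputable section

namespace QHFoliation

open MvPowerSeries

/-! ### Power series and `1`-forms in two variables -/

/-- Formal power series in two variables; variable `0` is `x` and variable `1` is `y`. -/
abbrev Series : Type := MvPowerSeries (Fin 2) ℂ

/-- The exponent of the monomial `x ^ i * y ^ j`. -/
def expo (i j : ℕ) : Fin 2 →₀ ℕ := Finsupp.single 0 i + Finsupp.single 1 j

/-- The (formal) partial derivative with respect to the first variable. -/
def dX (g : Series) : Series := MvPowerSeries.pderiv ℂ (0 : Fin 2) g

/-- The (formal) partial derivative with respect to the second variable. -/
def dY (g : Series) : Series := MvPowerSeries.pderiv ℂ (1 : Fin 2) g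

/-- The function `G` is represented near the origin by the power series `g`. -/
def Represents (g : Series) (G : ℂ × ℂ → ℂ) : Prop :=
  ∀ᶠ p in nhds (0 : ℂ × ℂ),
    HasSum (fun m : Fin 2 →₀ ℕ => coeff m g * p.1 ^ m 0 * p.2 ^ m 1) (G p)

/-- The power series `g` is convergent, i.e. it is the germ of a holomorphic function. -/
def IsConvergent (g : Series) : Prop := ∃ G, Represents g G

/-- The formal `1`-form `a dx + b dy`. -/
@[ext]
structure OneForm where
  /-- the coefficient of `dx` -/
  a : Series
  /-- the coefficient of `dy` -/
  b : Series

/-- The product of a function and a `1`-form. -/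
def OneForm.mul (u : Series) (ω : OneForm) : OneForm := ⟨u * ω.a, u * ω.b⟩

/-- The sum of two `1`-forms. -/
def OneForm.add (ω η : OneForm) : OneForm := ⟨ω.a + η.a, ω.b + η.b⟩

/-- The differential of a function. -/
def differential (g : Series) : OneForm := ⟨dX g, dY g⟩

/-- The pull-back of a `1`-form by the formal map `(x, y) ↦ (φ 0, φ 1)`. It is meant for maps
whose components have zero constant coefficient. -/
def OneForm.pullback (φ : Fin 2 → Series) (ω : OneForm) : OneForm :=
  ⟨subst φ ω.a * dX (φ 0) + subst φ ω.b * dX (φ 1),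
    subst φ ω.a * dY (φ 0) + subst φ ω.b * dY (φ 1)⟩

/-- A formal change of coordinates at the origin which is tangent to the identity. -/
def IsStrictDiffeo (φ : Fin 2 → Series) : Prop :=
  ∀ i, constantCoeff (φ i) = 0 ∧
    ∀ j, coeff (Finsupp.single j 1) (φ i) = if i = j then 1 else 0

/-- Strict formal orbital equivalence: `u • φ^* ω = ω'` where `φ` is a formal change of
coordinates with `Dφ(0) = Id` and `u` is a formal unit with `u(0) = 1`. -/
def StrictlyFormallyEquivalent (ω ω' : OneForm) : Prop :=
  ∃ (φ : Fin 2 → Series) (u : Series), IsStrictDiffeo φ ∧ constantCoeff u = 1 ∧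
    OneForm.mul u (ω.pullback φ) = ω'

/-! ### Singular points -/

/-- The origin is a singular point of the `1`-form. -/
def OneForm.Singular (η : OneForm) : Prop := constantCoeff η.a = 0 ∧ constantCoeff η.b = 0

/-- The linear part at the origin of the vector field `b ∂x - a ∂y`, which generates the
foliation `a dx + b dy = 0`. -/
def OneForm.linearPart (η : OneForm) : Matrix (Fin 2) (Fin 2) ℂ :=
  !![constantCoeff (dX η.b), constantCoeff (dY η.b);
    -constantCoeff (dX η.a), -constantCoeff (dY η.a)]

/-- `μ₁` and `μ₂` are the eigenvalues, with multiplicity, of the linear part. -/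
def OneForm.HasEigenvalues (η : OneForm) (μ₁ μ₂ : ℂ) : Prop :=
  η.linearPart.charpoly =
    (Polynomial.X - Polynomial.C μ₁) * (Polynomial.X - Polynomial.C μ₂)

/-- The origin is a reduced singularity of the foliation: there is a non-zero eigenvalue, and
the quotient of the other one by it is not a positive rational number. -/
def OneForm.ReducedSingularity (η : OneForm) : Prop :=
  η.Singular ∧ ∃ μ₁ μ₂ : ℂ, η.HasEigenvalues μ₁ μ₂ ∧ μ₂ ≠ 0 ∧
    ∀ r : ℚ, 0 < r → μ₁ ≠ (r : ℂ) * μ₂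

/-- The origin is a saddle-node: a reduced singularity with one zero eigenvalue. -/
def OneForm.SaddleNode (η : OneForm) : Prop :=
  η.ReducedSingularity ∧ ∃ μ : ℂ, η.HasEigenvalues 0 μ

/-! ### The desingularization map

Let `k`, `ℓ` be positive coprime integers. The desingularization `σ` of
`x y ∏ (y ^ k - c i * x ^ ℓ)` is a composition of blowing-ups of points which are the origins of
charts, and it is monomial in each chart. The chart with exponents `(v, w)` has coordinates
`(s, t)`, and in it the map is `x = s ^ w.1 * t ^ v.1`, `y = s ^ w.2 * t ^ v.2`. Blowing up its
origin, i.e. `(s, t) = (s, s * t')` or `(s, t) = (s' * t, t)`, gives the charts with exponents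
`(v, v + w)` and `(v + w, w)`. The curves `y ^ k = c * x ^ ℓ` pass through the origin of the chart
exactly when the vector `(k, ℓ)` is in the interior of the cone spanned by `v` and `w`; this is
when the origin has to be blown up. -/

/-- `(k, ℓ)` is in the interior of the cone spanned by `v` and `w` (where `v` is the vector on the
side of `(0, 1)`). -/
def InsideCone (k ℓ : ℕ) (v w : ℕ × ℕ) : Prop := v.1 * ℓ < k * v.2 ∧ k * w.2 < w.1 * ℓ

/-- The charts which occur in the course of the blowing-up process. -/
inductive Chart (k ℓ : ℕ) : ℕ × ℕ → ℕ × ℕ → Prop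
  | start : Chart k ℓ (0, 1) (1, 0)
  | first {v w : ℕ × ℕ} : Chart k ℓ v w → InsideCone k ℓ v w → Chart k ℓ v (v + w)
  | second {v w : ℕ × ℕ} : Chart k ℓ v w → InsideCone k ℓ v w → Chart k ℓ (v + w) w

/-- The charts whose origin is blown up in the process. -/
def CentreChart (k ℓ : ℕ) (v w : ℕ × ℕ) : Prop := Chart k ℓ v w ∧ InsideCone k ℓ v w

/-- The charts of the final manifold. The exceptional component with vector `(k, ℓ)`, on which
the strict transforms of the cuspidal branches appear, is the principal component. It is
`{t = 0}` in the final chart with `v = (k, ℓ)` and `{s = 0}` in the one with `w = (k, ℓ)`. -/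
def FinalChart (k ℓ : ℕ) (v w : ℕ × ℕ) : Prop := Chart k ℓ v w ∧ ¬ InsideCone k ℓ v w

/-- The point `(z₁, z₂)` of the chart with exponents `(v, w)` is mapped to the origin, i.e. it lies
on the exceptional divisor. -/
def OnDivisor (v w : ℕ × ℕ) (z₁ z₂ : ℂ) : Prop :=
  z₁ ^ w.1 * z₂ ^ v.1 = 0 ∧ z₁ ^ w.2 * z₂ ^ v.2 = 0

/-- The expression of the chart with exponents `(v, w)` in the local coordinates
`(s - z₁, t - z₂)` at its point `(z₁, z₂)`. -/
def chartMap (v w : ℕ × ℕ) (z₁ z₂ : ℂ) : Fin 2 → Series :=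
  ![(C z₁ + X 0) ^ w.1 * (C z₂ + X 1) ^ v.1, (C z₁ + X 0) ^ w.2 * (C z₂ + X 1) ^ v.2]

/-- `η` generates the strict transform of the foliation `ω = 0` at the point `(z₁, z₂)` of the
chart `(v, w)`: it is the pull-back of `ω` divided by the common factor of its coefficients. -/
def IsStrictTransform (ω : OneForm) (v w : ℕ × ℕ) (z₁ z₂ : ℂ) (η : OneForm) : Prop :=
  IsRelPrime η.a η.b ∧ ∃ g : Series, g ≠ 0 ∧ ω.pullback (chartMap v w z₁ z₂) = OneForm.mul g η

/-- `σ` is the desingularization of the foliation `ω = 0`, this foliation is non-dicritical, and no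
singularity of its strict transform is a saddle-node. In detail: only non-reduced singularities
are blown up; after the last blowing-up each component of the exceptional divisor is invariant,
and all singularities on the divisor are reduced, and none is a saddle-node. -/
def Desingularizes (k ℓ : ℕ) (ω : OneForm) : Prop :=
  (∀ v w, CentreChart k ℓ v w →
    ∃ η, IsStrictTransform ω v w 0 0 η ∧ η.Singular ∧ ¬ η.ReducedSingularity) ∧
  (∀ v w, FinalChart k ℓ v w → ∀ z₁ z₂ : ℂ, OnDivisor v w z₁ z₂ →
    ∃ η, IsStrictTransform ω v w z₁ z₂ η ∧
      (z₁ = 0 → w ≠ (1, 0) → X 0 ∣ η.b) ∧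
      (z₂ = 0 → v ≠ (0, 1) → X 1 ∣ η.a) ∧
      (η.Singular → η.ReducedSingularity ∧ ¬ η.SaddleNode))

/-! ### Separatrices -/

/-- The curve `p = 0` is invariant by the foliation `ω = 0`: `p` divides `ω ∧ dp`. -/
def Invariant (ω : OneForm) (p : Series) : Prop := p ∣ ω.a * dY p - ω.b * dX p

/-- `g` is a reduced equation of the union of all separatrices (irreducible invariant germs of
holomorphic curves) of the foliation `ω = 0`. -/
def IsSeparatrixEquation (ω : OneForm) (g : Series) : Prop :=
  IsConvergent g ∧ Squarefree g ∧
    ∀ p : Series, IsConvergent p → Irreducible p → (p ∣ g ↔ Invariant ω p)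

/-- The quasi-homogeneous function `x y ∏ (y ^ k - c i * x ^ ℓ)`. -/
def quasiHom (k ℓ : ℕ) {n : ℕ} (c : Fin n → ℂ) (p : ℂ × ℂ) : ℂ :=
  p.1 * p.2 * ∏ i, (p.2 ^ k - c i * p.1 ^ ℓ)

/-- The germs at the origin of the zero sets of `F` and `G` are topologically conjugated. -/
def TopConjugated (F G : ℂ × ℂ → ℂ) : Prop :=
  ∃ Φ : OpenPartialHomeomorph (ℂ × ℂ) (ℂ × ℂ), 0 ∈ Φ.source ∧ Φ 0 = 0 ∧
    ∀ᶠ p in nhds (0 : ℂ × ℂ), F p = 0 ↔ G (Φ p) = 0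

/-! ### The classes of topologically quasi-homogeneous `1`-forms -/

/-- The class `𝒬(f)` for `f = x y ∏ (y ^ k - c i * x ^ ℓ)`: germs of holomorphic `1`-forms with
an isolated singularity defining a topologically quasi-homogeneous foliation which has the same
desingularization map `σ` as `f`, whose separatrices are topologically conjugated to `f = 0`, and
for which the axes `x = 0` and `y = 0` are invariant. -/
structure ClassQ (k ℓ : ℕ) {n : ℕ} (c : Fin n → ℂ) (ω : OneForm) : Prop where
  convergent : IsConvergent ω.a ∧ IsConvergent ω.b
  isolated : IsRelPrime ω.a ω.b
  desingularizes : Desingularizes k ℓ ω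
  separatrices : ∃ (g : Series) (G : ℂ × ℂ → ℂ), IsSeparatrixEquation ω g ∧ Represents g G ∧
    TopConjugated G (quasiHom k ℓ c)
  axes : Invariant ω (X 0) ∧ Invariant ω (X 1)

/-- The quasi-homogeneous degree of `f`. -/
def deg (k ℓ n : ℕ) : ℕ := k * ℓ * n + k + ℓ

/-- The class `𝒬^d(f)`: the forms `a dx + b dy` of `𝒬(f)` such that `a` and `b` are
`(k, ℓ)`-quasi-homogeneous polynomials of degrees `d - k` and `d - ℓ`. -/
structure ClassQInitial (k ℓ : ℕ) {n : ℕ} (c : Fin n → ℂ) (ωd : OneForm) : Prop where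
  mem : ClassQ k ℓ c ωd
  hom_a : ∀ i j, coeff (expo i j) ωd.a ≠ 0 → k * i + ℓ * j + k = deg k ℓ n
  hom_b : ∀ i j, coeff (expo i j) ωd.b ≠ 0 → k * i + ℓ * j + ℓ = deg k ℓ n

/-- The class `𝒬(ω_d)`: the forms of `𝒬(f)` of the form `ω_d + ω_{d+1} + ω_{d+2} + ⋯`. -/
structure ClassQWithInitial (k ℓ : ℕ) {n : ℕ} (c : Fin n → ℂ) (ωd ω : OneForm) : Prop where
  mem : ClassQ k ℓ c ω
  init_a : ∀ i j, k * i + ℓ * j + k ≤ deg k ℓ n →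
    coeff (expo i j) ω.a = coeff (expo i j) ωd.a
  init_b : ∀ i j, k * i + ℓ * j + ℓ ≤ deg k ℓ n →
    coeff (expo i j) ω.b = coeff (expo i j) ωd.b

/-! ### The generic condition -/

/-- The restriction of `g` to the `i`-th coordinate axis. -/
def restrictAxis (i : Fin 2) (g : Series) : PowerSeries ℂ :=
  PowerSeries.mk fun m => coeff (Finsupp.single i m) g

/-- Let `i ≠ j`, let `A`, `B` be the coefficients of the `i`-th and `j`-th coordinate differential
in a `1`-form, and let the `i`-th axis be invariant. This is the Camacho-Sad index
`- Res ∂_j (A / B)` at the origin with respect to the `i`-th axis. -/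
def camachoSad (i j : Fin 2) (A B : Series) : ℂ :=
  -HahnSeries.coeff
    ((((restrictAxis i (MvPowerSeries.pderiv ℂ j A * B - A * MvPowerSeries.pderiv ℂ j B) :
        PowerSeries ℂ) : LaurentSeries ℂ)) /
      ((restrictAxis i B : PowerSeries ℂ) : LaurentSeries ℂ) ^ 2) (-1)

/-- All Camacho-Sad indices of the strict transform of the foliation with respect to the principal
component of the exceptional divisor, at all its singular points on it, are irrational. -/
def IrrationalIndices (k ℓ : ℕ) (ω : OneForm) : Prop :=
  (∀ w, FinalChart k ℓ (k, ℓ) w → ∀ z : ℂ, ∀ η, IsStrictTransform ω (k, ℓ) w z 0 η →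
    η.Singular → ∀ r : ℚ, camachoSad 0 1 η.a η.b ≠ (r : ℂ)) ∧
  (∀ v, FinalChart k ℓ v (k, ℓ) → ∀ z : ℂ, ∀ η, IsStrictTransform ω v (k, ℓ) 0 z η →
    η.Singular → ∀ r : ℚ, camachoSad 1 0 η.b η.a ≠ (r : ℂ))

/-- The number of monomials `x ^ i * y ^ j` with `k * i + ℓ * j = m`. -/
def numMonomials (k ℓ m : ℕ) : ℕ :=
  ((Finset.range (m + 1) ×ˢ Finset.range (m + 1)).filter
    fun p : ℕ × ℕ => k * p.1 + ℓ * p.2 = m).card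

/-- The function `q = k x a + ℓ y b`. -/
def radialPart (k ℓ : ℕ) (ω : OneForm) : Series :=
  C (k : ℂ) * X 0 * ω.a + C (ℓ : ℂ) * X 1 * ω.b

/-- `A = m a + ∂q/∂x`. -/
def seriesA (k ℓ m : ℕ) (ω : OneForm) : Series := C (m : ℂ) * ω.a + dX (radialPart k ℓ ω)

/-- `B = m b + ∂q/∂y`. -/
def seriesB (k ℓ m : ℕ) (ω : OneForm) : Series := C (m : ℂ) * ω.b + dY (radialPart k ℓ ω)

/-- The coefficient `A_i` in `A / y = ∑ A_i x ^ (ℓ (n - i)) y ^ (k i)`, `0 ≤ i ≤ n`, extended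
by `0` to the other integers. -/
def coeffA (k ℓ n m : ℕ) (ω : OneForm) (i : ℤ) : ℂ :=
  if 0 ≤ i ∧ i ≤ n then
    coeff (expo (ℓ * (n - i.toNat)) (k * i.toNat + 1)) (seriesA k ℓ m ω)
  else 0

/-- The coefficient `B_i` in `B / x = ∑ B_i x ^ (ℓ i) y ^ (k (n - i))`, `0 ≤ i ≤ n`, extended
by `0` to the other integers. -/
def coeffB (k ℓ n m : ℕ) (ω : OneForm) (i : ℤ) : ℂ :=
  if 0 ≤ i ∧ i ≤ n then
    coeff (expo (ℓ * i.toNat + 1) (k * (n - i.toNat))) (seriesB k ℓ m ω)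
  else 0

/-- The square matrix `M_m` of size `2 e_m`, made of four Toeplitz blocks. -/
def matrixM (k ℓ n m : ℕ) (ω : OneForm) :
    Matrix (Fin (numMonomials k ℓ m) ⊕ Fin (numMonomials k ℓ m))
      (Fin (numMonomials k ℓ m) ⊕ Fin (numMonomials k ℓ m)) ℂ :=
  Matrix.fromBlocks
    (Matrix.of fun r s => coeffA k ℓ n m ω ((r : ℤ) - (s : ℤ)))
    (Matrix.of fun r s => coeffB k ℓ n m ω ((n : ℤ) - (r : ℤ) + (s : ℤ)))
    (Matrix.of fun r s => coeffA k ℓ n m ω ((n : ℤ) + (r : ℤ) - (s : ℤ)))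
    (Matrix.of fun r s => coeffB k ℓ n m ω ((s : ℤ) - (r : ℤ)))

/-- The generic condition on the initial part. -/
def Generic (k ℓ n : ℕ) (ωd : OneForm) : Prop :=
  IrrationalIndices k ℓ ωd ∧
    ∀ m, 1 ≤ m → m ≤ k * ℓ * n - 1 → (matrixM k ℓ n m ωd).det ≠ 0

/-! ### The normal forms -/

/-- The strict integer part `]r]` of `r`, characterized by `]r] < r ≤ ]r] + 1`. -/
def strictIntPart (r : ℚ) : ℤ := ⌈r⌉ - 1

theorem strictIntPart_spec (r : ℚ) :
    (strictIntPart r : ℚ) < r ∧ r ≤ (strictIntPart r : ℚ) + 1 := by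
  unfold strictIntPart
  have h1 := Int.ceil_lt_add_one r
  have h2 := Int.le_ceil r
  push_cast
  constructor <;> linarith

/-- The hamiltonian part `h` is a polynomial supported on the monomials `x ^ i * y ^ j` with
`k i + ℓ j ≥ k ℓ n + 1`, `i ≤ ℓ n - 1` and `j ≤ k n - 1`. -/
def IsHamiltonianPart (k ℓ n : ℕ) (h : MvPolynomial (Fin 2) ℂ) : Prop :=
  ∀ m ∈ h.support, k * ℓ * n + 1 ≤ k * m 0 + ℓ * m 1 ∧ m 0 ≤ ℓ * n - 1 ∧ m 1 ≤ k * n - 1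

/-- The formal series `p(x)` as a series in `(x, y)`. -/
def seriesInX (p : PowerSeries ℂ) : Series :=
  fun m => if m 1 = 0 then PowerSeries.coeff (m 0) p else 0

/-- The exponent `ℓ n + 1 + ](1 - ℓ j) / k]`, which is positive for `j ≤ k n - 1`. -/
def radialExponent (k ℓ n j : ℕ) : ℕ :=
  ((ℓ * n + 1 : ℤ) + strictIntPart ((1 - (ℓ : ℚ) * (j : ℚ)) / (k : ℚ))).toNat

/-- The coefficient `s = ∑ s_j(x) x ^ (ℓ n + 1 + ](1 - ℓ j) / k]) y ^ j` of the radial part. -/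
def radialCoeff (k ℓ n : ℕ) (s : Fin (k * n) → PowerSeries ℂ) : Series :=
  ∑ j : Fin (k * n), seriesInX (s j) * X 0 ^ radialExponent k ℓ n j * X 1 ^ (j : ℕ)

/-- The `1`-form `ℓ y dx - k x dy`. -/
def quasiRadialForm (k ℓ : ℕ) : OneForm := ⟨C (ℓ : ℂ) * X 1, -(C (k : ℂ) * X 0)⟩

/-- The form `ω_{h,s} = ω_d + d(x y h) + s (ℓ y dx - k x dy)`. -/
def normalForm (k ℓ n : ℕ) (ωd : OneForm) (h : MvPolynomial (Fin 2) ℂ)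
    (s : Fin (k * n) → PowerSeries ℂ) : OneForm :=
  (ωd.add (differential (X 0 * X 1 * (h : Series)))).add
    (OneForm.mul (radialCoeff k ℓ n s) (quasiRadialForm k ℓ))

end QHFoliation

end

noncomputable section

namespace QHFoliation

open MvPowerSeries

/-! ### The filtration by the weighted order -/

/-! Everything is graded by the weights `(k, ℓ)`. If a conjugacy `(φ, u)` is changed by a field `ξ`
and a function `v` of relative weight `m`, then `u φ^* ω` changes in weight `d + m` by `L_ξ ω_d + v
ω_d`, and otherwise only in higher weight (`mul_logPullback_sub`). Existence and uniqueness
therefore rest on one linear problem per weight, the homological equation `L_ξ ω_d + v ω_d + τ =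
d(xyh) + s (ℓ y dx - k x dy)`. With invariant axes one may write `ξ = (x α, y β)` and `ω_d = y p dx
+ x r dy`. A quasi-homogeneous polynomial is `∑ P_s x ^ (I - ℓ s) y ^ (J + k s)`, that is, a
polynomial `P` in one variable. If there are `e` monomials of weight `m`, then `α`, `β`, `v` have
degree less than `e`, and the admissible `h` and `s` have coefficients only at indices in `[e, n)`
and `[0, n)`.

The equation splits in two. Contraction with the radial field `k x ∂x + ℓ y ∂y` kills `s`,
multiplies `h` by the total weight, and turns the left side into `α A + β B + v q` plus the
contraction of `τ`. The coefficients outside `[e, n)` must then vanish. For `m < k ℓ n` this is the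
linear system with matrix `M_m`. For `m ≥ k ℓ n` one has `n ≤ e`, and it is solved by Bézout,
because `A` and `B` are coprime: a common root would be a singular point of the principal component
with Camacho-Sad index `1 / m` (`isCoprime_A_B`). For the second half, multiples `-v` of the radial
field, with unit `total · v`, leave the contraction unchanged and alter `s` by `r x∂x v - p y∂y v`
(`lie0_shift`). On the coefficients of index at least `n` this operator is triangular. Its diagonal
entries are integral combinations of the top coefficients of `p` and `r`, and they do not vanish
because the index at a corner is irrational (`corner_ne_zero`). Existence follows by passing to the
limit.

Uniqueness meets two obstacles. The kernel of the homological equation consists of the fields `g (r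
x∂x - p y∂y)` tangent to `ω_d`, which do occur from weight `k ℓ n` on. They are removed by composing
the conjugacy with the flow, here a truncated exponential, of the corresponding field tangent to the
whole normal form; this flow preserves the normal form up to a unit, so `h` and `s` are unaffected
(`Setting.exists_closer`). Moreover an arbitrary conjugacy tangent to the identity has to be shown
to preserve the axes. Otherwise the image of an axis would be a curve `x_j = c x_i ^ P + ⋯`, which
the leading terms of the form exclude (`X_dvd_of_conjugacy`). -/

/-- The weight of an exponent. -/
def wt (w : Fin 2 → ℕ) (e : Fin 2 →₀ ℕ) : ℕ := w 0 * e 0 + w 1 * e 1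

theorem wt_add (w : Fin 2 → ℕ) (e f : Fin 2 →₀ ℕ) : wt w (e + f) = wt w e + wt w f := by
  simp only [wt, Finsupp.add_apply]; ring

theorem wt_single (w : Fin 2 → ℕ) (i : Fin 2) (r : ℕ) :
    wt w (Finsupp.single i r) = w i * r := by
  fin_cases i <;> simp [wt]

theorem wt_expo (w : Fin 2 → ℕ) (i j : ℕ) : wt w (expo i j) = w 0 * i + w 1 * j := by
  simp [wt, expo]

theorem expo_apply_zero (i j : ℕ) : expo i j 0 = i := by simp [expo]

theorem expo_apply_one (i j : ℕ) : expo i j 1 = j := by simp [expo]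

theorem expo_eta (e : Fin 2 →₀ ℕ) : expo (e 0) (e 1) = e := by
  ext i; fin_cases i <;> simp [expo]

/-- The ideal of the series of weighted order at least `N`. -/
def wtIdeal (w : Fin 2 → ℕ) (N : ℕ) : Ideal Series where
  carrier := {g | ∀ e, wt w e < N → coeff e g = 0}
  add_mem' {f g} hf hg e he := by rw [map_add, hf e he, hg e he, add_zero]
  zero_mem' e _ := map_zero _
  smul_mem' c f hf e he := by
    rw [smul_eq_mul, coeff_mul]
    refine Finset.sum_eq_zero fun x hx => ?_
    have h := Finset.HasAntidiagonal.mem_antidiagonal.mp hx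
    rw [hf x.2, mul_zero]
    rw [← h, wt_add] at he
    omega

theorem wtIdeal_mono {w : Fin 2 → ℕ} {N M : ℕ} (h : N ≤ M) {g : Series}
    (hg : g ∈ wtIdeal w M) : g ∈ wtIdeal w N := fun e he => hg e (by omega)

theorem mul_mem_wtIdeal {w : Fin 2 → ℕ} {N M : ℕ} {f g : Series} (hf : f ∈ wtIdeal w N)
    (hg : g ∈ wtIdeal w M) : f * g ∈ wtIdeal w (N + M) := by
  intro e he
  rw [coeff_mul]
  refine Finset.sum_eq_zero fun x hx => ?_
  have h := Finset.HasAntidiagonal.mem_antidiagonal.mp hx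
  rw [← h, wt_add] at he
  by_cases h1 : wt w x.1 < N
  · rw [hf _ h1, zero_mul]
  · rw [hg _ (by omega), mul_zero]

theorem mem_wtIdeal_zero {w : Fin 2 → ℕ} (g : Series) : g ∈ wtIdeal w 0 :=
  fun _ he => absurd he (Nat.not_lt_zero _)

theorem pow_mem_wtIdeal {w : Fin 2 → ℕ} {N : ℕ} {f : Series} (hf : f ∈ wtIdeal w N) (r : ℕ) :
    f ^ r ∈ wtIdeal w (N * r) := by
  induction r with
  | zero => exact mem_wtIdeal_zero _
  | succ r ih => rw [pow_succ, Nat.mul_succ]; exact mul_mem_wtIdeal ih hf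

theorem monomial_mem_wtIdeal (w : Fin 2 → ℕ) {N : ℕ} {e : Fin 2 →₀ ℕ} (h : N ≤ wt w e) (c : ℂ) :
    (monomial e c : Series) ∈ wtIdeal w N := by
  classical
  intro f hf
  rw [coeff_monomial, if_neg]
  rintro rfl
  omega

theorem X_mem_wtIdeal (w : Fin 2 → ℕ) (i : Fin 2) : (X i : Series) ∈ wtIdeal w (w i) := by
  rw [X]
  exact monomial_mem_wtIdeal w (by rw [wt_single]; omega) 1

theorem wt_finite {w : Fin 2 → ℕ} (hw : ∀ i, 0 < w i) (N : ℕ) :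
    {e : Fin 2 →₀ ℕ | wt w e < N}.Finite := by
  refine (Set.finite_Iic (expo N N)).subset fun e he => ?_
  have h0 := hw 0
  have h1 := hw 1
  simp only [Set.mem_ofPred_eq, wt] at he
  have h2 : e 0 ≤ w 0 * e 0 := Nat.le_mul_of_pos_left _ h0
  have h3 : e 1 ≤ w 1 * e 1 := Nat.le_mul_of_pos_left _ h1
  intro i
  fin_cases i
  · simp only [Fin.zero_eta, expo_apply_zero]; omega
  · simp only [Fin.mk_one, expo_apply_one]; omega

theorem eq_zero_of_mem_wtIdeal {w : Fin 2 → ℕ} {g : Series} (h : ∀ N, g ∈ wtIdeal w N) :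
    g = 0 := by
  ext e
  rw [h (wt w e + 1) e (Nat.lt_succ_self _), map_zero]

/-- An additive map which is continuous for the filtration is controlled by its values on the
monomials. -/
theorem map_mem_wtIdeal_of_monomial {w : Fin 2 → ℕ} (hw : ∀ i, 0 < w i) (Λ : Series →+ Series)
    {N K M : ℕ} (hK : ∀ g ∈ wtIdeal w K, Λ g ∈ wtIdeal w M)
    (hmon : ∀ e c, N ≤ wt w e → Λ (monomial e c) ∈ wtIdeal w M) {g : Series}
    (hg : g ∈ wtIdeal w N) : Λ g ∈ wtIdeal w M := by
  classical
  set S := (wt_finite hw K).toFinset with hS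
  set p : Series := ∑ e ∈ S, monomial e (coeff e g) with hp
  have h1 : g - p ∈ wtIdeal w K := by
    intro e he
    have : e ∈ S := by simpa [hS] using he
    rw [map_sub, hp, map_sum, Finset.sum_eq_single e]
    · simp
    · intro b _ hb
      rw [coeff_monomial, if_neg (Ne.symm hb)]
    · intro h; exact absurd this h
  have h2 : Λ p ∈ wtIdeal w M := by
    rw [hp, map_sum]
    refine Ideal.sum_mem _ fun e _ => ?_
    by_cases h : N ≤ wt w e
    · exact hmon e _ h
    · rw [hg e (by omega), map_zero, map_zero]; exact Ideal.zero_mem _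
  have h3 := Ideal.add_mem _ (hK _ h1) h2
  rwa [← map_add, sub_add_cancel] at h3

/-! ### Derivations -/

theorem pderiv_mem_wtIdeal {w : Fin 2 → ℕ} {N M : ℕ} {g : Series} (hg : g ∈ wtIdeal w N)
    (i : Fin 2) (h : M + w i ≤ N) : pderiv ℂ i g ∈ wtIdeal w M := by
  intro e he
  rw [coeff_pderiv, hg, zero_mul]
  rw [wt_add, wt_single]
  omega

/-- The Euler derivation `x_i ∂/∂x_i`. -/
def eu (i : Fin 2) : Derivation ℂ Series Series := (X i : Series) • pderiv ℂ i

theorem eu_apply (i : Fin 2) (f : Series) : eu i f = X i * pderiv ℂ i f := rfl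

theorem coeff_eu (i : Fin 2) (f : Series) (e : Fin 2 →₀ ℕ) :
    coeff e (eu i f) = e i * coeff e f := by
  classical
  rw [eu_apply, X_def, coeff_monomial_mul, one_mul]
  split_ifs with h
  · have h1 : 1 ≤ e i := by simpa using h i
    rw [coeff_pderiv, tsub_add_cancel_of_le h, mul_comm]
    congr 1
    simp [Nat.cast_sub h1]
  · have : e i = 0 := by
      by_contra h0
      exact h (by simpa using Nat.one_le_iff_ne_zero.mpr h0)
    simp [this]

theorem eu_mem_wtIdeal {w : Fin 2 → ℕ} {N : ℕ} {g : Series} (hg : g ∈ wtIdeal w N)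
    (i : Fin 2) : eu i g ∈ wtIdeal w N := by
  intro e he
  rw [coeff_eu, hg e he, mul_zero]

theorem eu_X (i j : Fin 2) : eu i (X j) = if i = j then (X j : Series) else 0 := by
  classical
  rw [eu_apply]
  split_ifs with h
  · subst h; rw [pderiv_X_self, mul_one]
  · rw [pderiv_X_of_ne (Ne.symm h), mul_zero]

theorem eu_X_self (i : Fin 2) : eu i (X i : Series) = X i := by simp [eu_X]

theorem eu_X_ne {i j : Fin 2} (h : i ≠ j) : eu i (X j : Series) = 0 := by simp [eu_X, h]

theorem eu_C (i : Fin 2) (c : ℂ) : eu i (C c : Series) = 0 := by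
  rw [eu_apply, pderiv_C, mul_zero]

theorem eu_comm (i j : Fin 2) (f : Series) : eu i (eu j f) = eu j (eu i f) := by
  ext e; simp only [coeff_eu]; ring

theorem of_X_mul_mem_wtIdeal {w : Fin 2 → ℕ} {N : ℕ} {g : Series} {i : Fin 2}
    (h : X i * g ∈ wtIdeal w (N + w i)) : g ∈ wtIdeal w N := by
  intro e he
  have := h (Finsupp.single i 1 + e) (by rw [wt_add, wt_single]; omega)
  rwa [X_def, coeff_add_monomial_mul, one_mul] at this

/-- The derivation `ξ₀ ∂/∂x + ξ₁ ∂/∂y`. -/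
def field (ξ : Fin 2 → Series) : Derivation ℂ Series Series :=
  ξ 0 • pderiv ℂ 0 + ξ 1 • pderiv ℂ 1

theorem field_apply (ξ : Fin 2 → Series) (f : Series) :
    field ξ f = ξ 0 * pderiv ℂ 0 f + ξ 1 * pderiv ℂ 1 f := rfl

theorem field_X (ξ : Fin 2 → Series) (i : Fin 2) : field ξ (X i) = ξ i := by
  fin_cases i
  · simp [field_apply, pderiv_X_self, pderiv_X_of_ne]
  · simp [field_apply, pderiv_X_self, pderiv_X_of_ne]

theorem field_mem_wtIdeal {w : Fin 2 → ℕ} {N m : ℕ} {ξ : Fin 2 → Series}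
    (hξ : ∀ i, ξ i ∈ wtIdeal w (w i + m)) {g : Series} (hg : g ∈ wtIdeal w N) :
    field ξ g ∈ wtIdeal w (N + m) := by
  have key : ∀ i, ξ i * pderiv ℂ i g ∈ wtIdeal w (N + m) := by
    intro i
    -- For `N < w i` the derivative carries no usable weight, but `ξ i` alone already has weight at
    -- least `N + m`.
    by_cases h : w i ≤ N
    · exact wtIdeal_mono (by omega) (mul_mem_wtIdeal (hξ i)
        (pderiv_mem_wtIdeal (M := N - w i) hg i (by omega)))
    · exact Ideal.mul_mem_right _ _ (wtIdeal_mono (by omega) (hξ i))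
  exact Ideal.add_mem _ (key 0) (key 1)

/-! ### Substitutions -/

theorem hasSubst_of_mem {w : Fin 2 → ℕ} (hw : ∀ i, 0 < w i) {φ : Fin 2 → Series}
    (hφ : ∀ i, φ i ∈ wtIdeal w (w i)) : HasSubst φ := by
  refine hasSubst_of_constantCoeff_zero fun i => ?_
  rw [← coeff_zero_eq_constantCoeff_apply]
  exact hφ i 0 (by simpa [wt] using hw i)

theorem prod_mem_wtIdeal {w : Fin 2 → ℕ} {φ : Fin 2 → Series}
    (hφ : ∀ i, φ i ∈ wtIdeal w (w i)) (d : Fin 2 →₀ ℕ) :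
    (d.prod fun s e => φ s ^ e) ∈ wtIdeal w (wt w d) := by
  rw [Finsupp.prod_fintype _ _ (fun _ => pow_zero _), Fin.prod_univ_two]
  exact mul_mem_wtIdeal (pow_mem_wtIdeal (hφ 0) _) (pow_mem_wtIdeal (hφ 1) _)

theorem subst_mem_wtIdeal {w : Fin 2 → ℕ} (hw : ∀ i, 0 < w i) {φ : Fin 2 → Series}
    (hφ : ∀ i, φ i ∈ wtIdeal w (w i)) {N : ℕ} {g : Series} (hg : g ∈ wtIdeal w N) :
    subst φ g ∈ wtIdeal w N := by
  intro e he
  rw [coeff_subst (hasSubst_of_mem hw hφ)]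
  refine finsum_eq_zero_of_forall_eq_zero fun d => ?_
  by_cases h : wt w d < N
  · rw [hg d h, zero_smul]
  · rw [prod_mem_wtIdeal hφ d e (by omega), smul_zero]

theorem monomial_eq (e : Fin 2 →₀ ℕ) (c : ℂ) :
    (monomial e c : Series) = C c * (X 0 ^ e 0 * X 1 ^ e 1) := by
  rw [X_pow_eq, X_pow_eq, monomial_mul_monomial, ← monomial_zero_eq_C_apply,
    monomial_mul_monomial, zero_add, one_mul, mul_one]
  congr 2
  ext i; fin_cases i <;> simp

theorem subst_monomial_eq {φ : Fin 2 → Series} (hφ : HasSubst φ) (e : Fin 2 →₀ ℕ) (c : ℂ) :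
    subst φ (monomial e c : Series) = C c * (φ 0 ^ e 0 * φ 1 ^ e 1) := by
  rw [monomial_eq, subst_mul hφ, subst_mul hφ, subst_pow hφ, subst_pow hφ, subst_X hφ,
    subst_X hφ, subst_C]

theorem mul_sub_mul_mem {w : Fin 2 → ℕ} {N M c : ℕ} {f g f' g' : Series}
    (hg : g ∈ wtIdeal w M) (hf' : f' ∈ wtIdeal w N) (h1 : f - f' ∈ wtIdeal w (N + c))
    (h2 : g - g' ∈ wtIdeal w (M + c)) : f * g - f' * g' ∈ wtIdeal w (N + M + c) := by
  have h3 := mul_mem_wtIdeal h1 hg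
  have h4 := mul_mem_wtIdeal hf' h2
  have : f * g - f' * g' = (f - f') * g + f' * (g - g') := by ring
  rw [this]
  exact Ideal.add_mem _ (wtIdeal_mono (by omega) h3) (wtIdeal_mono (by omega) h4)

theorem pow_sub_pow_mem {w : Fin 2 → ℕ} {N c : ℕ} {f g : Series}
    (hf : f ∈ wtIdeal w N) (hg : g ∈ wtIdeal w N) (h : f - g ∈ wtIdeal w (N + c)) (r : ℕ) :
    f ^ r - g ^ r ∈ wtIdeal w (N * r + c) := by
  induction r with
  | zero => simp
  | succ r ih =>
    rw [pow_succ, pow_succ, Nat.mul_succ]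
    exact mul_sub_mul_mem hf (pow_mem_wtIdeal hg r) ih h

/-- Substitution of maps which agree up to higher weight. -/
theorem subst_sub_subst_mem {w : Fin 2 → ℕ} (hw : ∀ i, 0 < w i) {φ ψ : Fin 2 → Series} {c : ℕ}
    (hφ : ∀ i, φ i ∈ wtIdeal w (w i)) (hψ : ∀ i, ψ i ∈ wtIdeal w (w i))
    (h : ∀ i, φ i - ψ i ∈ wtIdeal w (w i + c)) {N : ℕ} {g : Series} (hg : g ∈ wtIdeal w N) :
    subst φ g - subst ψ g ∈ wtIdeal w (N + c) := by
  have h1 := hasSubst_of_mem hw hφ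
  have h2 := hasSubst_of_mem hw hψ
  let Λ : Series →+ Series :=
    (substAlgHom (R := ℂ) h1 : Series →+ Series) - (substAlgHom (R := ℂ) h2 : Series →+ Series)
  have hΛ : ∀ f, Λ f = subst φ f - subst ψ f := fun f => by
    rw [← substAlgHom_apply h1, ← substAlgHom_apply h2]; rfl
  rw [← hΛ]
  refine map_mem_wtIdeal_of_monomial hw Λ (K := N + c) (fun f hf => ?_) (fun e a he => ?_) hg
  · rw [hΛ]
    exact Ideal.sub_mem _ (subst_mem_wtIdeal hw hφ hf) (subst_mem_wtIdeal hw hψ hf)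
  · rw [hΛ, subst_monomial_eq h1, subst_monomial_eq h2, ← mul_sub]
    refine Ideal.mul_mem_left _ _ (wtIdeal_mono (M := wt w e + c) (by omega) ?_)
    exact mul_sub_mul_mem (pow_mem_wtIdeal (hφ 1) _) (pow_mem_wtIdeal (hψ 0) _)
      (pow_sub_pow_mem (hφ 0) (hψ 0) (h 0) _) (pow_sub_pow_mem (hφ 1) (hψ 1) (h 1) _)

theorem subst_X_eq (g : Series) : subst (X : Fin 2 → Series) g = g := by
  rw [subst_self]; rfl

theorem mem_of_sub_X {w : Fin 2 → ℕ} {φ : Fin 2 → Series} {c : ℕ}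
    (hφ : ∀ i, φ i - X i ∈ wtIdeal w (w i + c)) (i : Fin 2) : φ i ∈ wtIdeal w (w i) := by
  have := Ideal.add_mem _ (wtIdeal_mono (by omega) (hφ i)) (X_mem_wtIdeal w i)
  rwa [sub_add_cancel] at this

/-- The first order Taylor formula, with respect to the weights. -/
theorem subst_taylor {w : Fin 2 → ℕ} (hw : ∀ i, 0 < w i) {φ ψ : Fin 2 → Series} {m : ℕ}
    (hφ : ∀ i, φ i - X i ∈ wtIdeal w (w i + 1)) (hψ : ∀ i, ψ i - X i ∈ wtIdeal w (w i + 1))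
    (h : ∀ i, ψ i - φ i ∈ wtIdeal w (w i + m)) {N : ℕ} {g : Series} (hg : g ∈ wtIdeal w N) :
    subst ψ g - subst φ g - field (ψ - φ) g ∈ wtIdeal w (N + m + 1) := by
  have hφ' := mem_of_sub_X hφ
  have hψ' := mem_of_sub_X hψ
  have h1 := hasSubst_of_mem hw hφ'
  have h2 := hasSubst_of_mem hw hψ'
  have hD : ∀ {M : ℕ} {f : Series}, f ∈ wtIdeal w M → field (ψ - φ) f ∈ wtIdeal w (M + m) :=
    fun hf => field_mem_wtIdeal (fun i => h i) hf
  have near : ∀ {M : ℕ} {f : Series}, f ∈ wtIdeal w M → subst φ f - f ∈ wtIdeal w (M + 1) := by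
    intro M f hf
    have := subst_sub_subst_mem hw hφ' (X_mem_wtIdeal w) hφ hf
    rwa [subst_X_eq] at this
  have near' : ∀ {M : ℕ} {f : Series}, f ∈ wtIdeal w M → subst ψ f - f ∈ wtIdeal w (M + 1) := by
    intro M f hf
    have := subst_sub_subst_mem hw hψ' (X_mem_wtIdeal w) hψ hf
    rwa [subst_X_eq] at this
  -- The Taylor defect of a product consists of the defects of the factors and of products of two
  -- first-order terms. Each of the latter gains a unit of weight because `φ` and `ψ` are the
  -- identity to lowest order. On a variable the defect is zero, so the monomials follow, and then
  -- all series by continuity.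
  have hmul : ∀ {M L : ℕ} {f g : Series}, f ∈ wtIdeal w M → g ∈ wtIdeal w L →
      subst ψ f - subst φ f - field (ψ - φ) f ∈ wtIdeal w (M + m + 1) →
      subst ψ g - subst φ g - field (ψ - φ) g ∈ wtIdeal w (L + m + 1) →
      subst ψ (f * g) - subst φ (f * g) - field (ψ - φ) (f * g) ∈ wtIdeal w (M + L + m + 1) := by
    intro M L f g hf hg hf1 hg1
    have e : subst ψ (f * g) - subst φ (f * g) - field (ψ - φ) (f * g) =
        (subst ψ f - subst φ f - field (ψ - φ) f) * subst ψ g +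
        subst φ f * (subst ψ g - subst φ g - field (ψ - φ) g) +
        field (ψ - φ) f * (subst ψ g - g) + (subst φ f - f) * field (ψ - φ) g := by
      rw [subst_mul h1, subst_mul h2, Derivation.leibniz, smul_eq_mul, smul_eq_mul]
      ring
    rw [e]
    have a1 := mul_mem_wtIdeal hf1 (subst_mem_wtIdeal hw hψ' hg)
    have a2 := mul_mem_wtIdeal (subst_mem_wtIdeal hw hφ' hf) hg1
    have a3 := mul_mem_wtIdeal (hD hf) (near' hg)
    have a4 := mul_mem_wtIdeal (near hf) (hD hg)
    refine Ideal.add_mem _ (Ideal.add_mem _ (Ideal.add_mem _ ?_ ?_) ?_) ?_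
    · exact wtIdeal_mono (by omega) a1
    · exact wtIdeal_mono (by omega) a2
    · exact wtIdeal_mono (by omega) a3
    · exact wtIdeal_mono (by omega) a4
  have hone : subst ψ (1 : Series) - subst φ (1 : Series) - field (ψ - φ) 1 = 0 := by
    rw [← map_one (C (σ := Fin 2) (R := ℂ)), subst_C, subst_C, sub_self, zero_sub,
      map_one, Derivation.map_one_eq_zero, neg_zero]
  have hX : ∀ i : Fin 2, subst ψ (X i : Series) - subst φ (X i : Series) - field (ψ - φ) (X i : Series) = 0 := by
    intro i
    rw [subst_X h1, subst_X h2, field_X, Pi.sub_apply, sub_self]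
  have hpow : ∀ (i : Fin 2) (r : ℕ), subst ψ ((X i : Series) ^ r) - subst φ ((X i : Series) ^ r) -
      field (ψ - φ) ((X i : Series) ^ r) ∈ wtIdeal w (w i * r + m + 1) := by
    intro i r
    induction r with
    | zero => rw [pow_zero, hone]; exact Ideal.zero_mem _
    | succ r ih =>
      rw [pow_succ, Nat.mul_succ]
      exact hmul (pow_mem_wtIdeal (X_mem_wtIdeal w i) r) (X_mem_wtIdeal w i) ih
        (by rw [hX]; exact Ideal.zero_mem _)
  let Λ : Series →+ Series :=
    (substAlgHom (R := ℂ) h2 : Series →+ Series) - (substAlgHom (R := ℂ) h1 : Series →+ Series) -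
      ((field (ψ - φ) : Series →ₗ[ℂ] Series) : Series →+ Series)
  have hΛ : ∀ f, Λ f = subst ψ f - subst φ f - field (ψ - φ) f := fun f => by
    rw [← substAlgHom_apply h1, ← substAlgHom_apply h2]; rfl
  rw [← hΛ]
  refine map_mem_wtIdeal_of_monomial hw Λ (K := N + m + 1) (fun f hf => ?_)
    (fun e a he => ?_) hg
  · rw [hΛ]
    exact Ideal.sub_mem _ (Ideal.sub_mem _ (subst_mem_wtIdeal hw hψ' hf)
      (subst_mem_wtIdeal hw hφ' hf)) (wtIdeal_mono (by omega) (hD hf))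
  · have hC : Λ (monomial e a) = C a * Λ (X 0 ^ e 0 * X 1 ^ e 1) := by
      rw [hΛ, hΛ, monomial_eq, subst_mul h1, subst_mul h2, subst_C, subst_C,
        Derivation.leibniz, smul_eq_mul, smul_eq_mul]
      have : field (ψ - φ) (C a : Series) = 0 := by
        simp [field_apply, pderiv_C]
      rw [this]; ring
    rw [hC]
    refine Ideal.mul_mem_left _ _ (wtIdeal_mono (M := wt w e + m + 1) (by omega) ?_)
    rw [hΛ]
    exact hmul (pow_mem_wtIdeal (X_mem_wtIdeal w 0) _) (pow_mem_wtIdeal (X_mem_wtIdeal w 1) _)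
      (hpow 0 _) (hpow 1 _)

/-! ### Pull-backs in logarithmic coordinates -/

/-- `x_i` times the `i`-th component of the pull-back by `φ` of the form with components `ω`. -/
def logPullback (φ ω : Fin 2 → Series) (i : Fin 2) : Series :=
  subst φ (ω 0) * eu i (φ 0) + subst φ (ω 1) * eu i (φ 1)

/-- `x_i` times the `i`-th component of the Lie derivative of `ω` along the field `ξ`. -/
def logLie (ξ ω : Fin 2 → Series) (i : Fin 2) : Series :=
  X i * field ξ (ω i) + (ω 0 * eu i (ξ 0) + ω 1 * eu i (ξ 1))

/-- The effect on `u φ^* ω` of a modification of `φ` and `u` in weight `m`, where `ω₀` is the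
initial part of `ω`. -/
theorem mul_logPullback_sub {w : Fin 2 → ℕ} (hw : ∀ i, 0 < w i) {φ ψ : Fin 2 → Series} {m : ℕ}
    (hm : 0 < m) (hφ : ∀ i, φ i - X i ∈ wtIdeal w (w i + 1))
    (h : ∀ i, ψ i - φ i ∈ wtIdeal w (w i + m)) {u v : Series}
    (hu : u - 1 ∈ wtIdeal w 1) (huv : v - u ∈ wtIdeal w m)
    {ω ω₀ : Fin 2 → Series} {d : ℕ} {N : Fin 2 → ℕ} (hN : ∀ i, N i + w i = d)
    (hω : ∀ i, ω i ∈ wtIdeal w (N i)) (hω₀ : ∀ i, ω i - ω₀ i ∈ wtIdeal w (N i + 1)) (i : Fin 2) :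
    v * logPullback ψ ω i - u * logPullback φ ω i -
      (logLie (ψ - φ) ω₀ i + (v - u) * (X i * ω₀ i)) ∈ wtIdeal w (d + m + 1) := by
  have hψ : ∀ i, ψ i - X i ∈ wtIdeal w (w i + 1) := by
    intro i
    have := Ideal.add_mem _ (wtIdeal_mono (N := w i + 1) (by omega) (h i)) (hφ i)
    rwa [sub_add_sub_cancel] at this
  have hφ' := mem_of_sub_X hφ
  have hψ' := mem_of_sub_X hψ
  have near : ∀ j, subst φ (ω j) - ω₀ j ∈ wtIdeal w (N j + 1) := by
    intro j
    have := subst_sub_subst_mem hw hφ' (X_mem_wtIdeal w) hφ (hω j)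
    rw [subst_X_eq] at this
    have := Ideal.add_mem _ this (hω₀ j)
    rwa [sub_add_sub_cancel] at this
  have taylor : ∀ j, subst ψ (ω j) - subst φ (ω j) - field (ψ - φ) (ω₀ j) ∈
      wtIdeal w (N j + m + 1) := by
    intro j
    have h1 := subst_taylor hw hφ hψ h (hω j)
    have h2 := field_mem_wtIdeal (ξ := ψ - φ) (fun i => h i) (hω₀ j)
    rw [map_sub] at h2
    have := Ideal.add_mem _ h1 (wtIdeal_mono (by omega) h2)
    rwa [sub_add_sub_cancel] at this
  have hfield : ∀ j, field (ψ - φ) (ω₀ j) ∈ wtIdeal w (N j + m) := by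
    intro j
    refine field_mem_wtIdeal (fun i => h i) ?_
    have := Ideal.sub_mem _ (hω j) (wtIdeal_mono (by omega) (hω₀ j))
    rwa [sub_sub_cancel] at this
  have hω₀' : ∀ j, ω₀ j ∈ wtIdeal w (N j) := fun j => by
    have := Ideal.sub_mem _ (hω j) (wtIdeal_mono (by omega) (hω₀ j))
    rwa [sub_sub_cancel] at this
  have heX : ∀ j, eu i (X j : Series) ∈ wtIdeal w (w j) := fun j =>
    eu_mem_wtIdeal (X_mem_wtIdeal w j) i
  have heψ : ∀ j, eu i (ψ j) - eu i (X j) ∈ wtIdeal w (w j + 1) := fun j => by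
    rw [← map_sub]; exact eu_mem_wtIdeal (hψ j) i
  have heφ : ∀ j, eu i (φ j) - eu i (X j) ∈ wtIdeal w (w j + 1) := fun j => by
    rw [← map_sub]; exact eu_mem_wtIdeal (hφ j) i
  have heξ : ∀ j, eu i (ψ j) - eu i (φ j) ∈ wtIdeal w (w j + m) := fun j => by
    rw [← map_sub]; exact eu_mem_wtIdeal (h j) i
  -- First-order variation of the single term `φ^* ω_j · dφ_j`: the coefficient varies by the field,
  -- the differential by `d(ψ_j - φ_j)`.
  have key : ∀ j, subst ψ (ω j) * eu i (ψ j) - subst φ (ω j) * eu i (φ j) -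
      (field (ψ - φ) (ω₀ j) * eu i (X j) + ω₀ j * (eu i (ψ j) - eu i (φ j))) ∈
      wtIdeal w (d + m + 1) := by
    intro j
    have hj := hN j
    have e : subst ψ (ω j) * eu i (ψ j) - subst φ (ω j) * eu i (φ j) -
      (field (ψ - φ) (ω₀ j) * eu i (X j) + ω₀ j * (eu i (ψ j) - eu i (φ j))) =
      (subst ψ (ω j) - subst φ (ω j) - field (ψ - φ) (ω₀ j)) * eu i (ψ j) +
      field (ψ - φ) (ω₀ j) * (eu i (ψ j) - eu i (X j)) +
      (subst φ (ω j) - ω₀ j) * (eu i (ψ j) - eu i (φ j)) := by ring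
    rw [e]
    refine Ideal.add_mem _ (Ideal.add_mem _ ?_ ?_) ?_
    · exact wtIdeal_mono (by omega) (mul_mem_wtIdeal (taylor j) (eu_mem_wtIdeal (hψ' j) i))
    · exact wtIdeal_mono (by omega) (mul_mem_wtIdeal (hfield j) (heψ j))
    · exact wtIdeal_mono (by omega) (mul_mem_wtIdeal (near j) (heξ j))
  have main : ∀ j, subst φ (ω j) * eu i (φ j) - ω₀ j * eu i (X j) ∈ wtIdeal w (d + 1) := by
    intro j
    have hj := hN j
    refine wtIdeal_mono (by omega) (mul_sub_mul_mem (c := 1) (eu_mem_wtIdeal (hφ' j) i)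
      (hω₀' j) (near j) (heφ j))
  have hmain : ∀ j, subst φ (ω j) * eu i (φ j) ∈ wtIdeal w d := fun j =>
    wtIdeal_mono (by have := hN j; omega) (mul_mem_wtIdeal
      (subst_mem_wtIdeal hw hφ' (hω j)) (eu_mem_wtIdeal (hφ' j) i))
  have hkey : ∀ j, field (ψ - φ) (ω₀ j) * eu i (X j) + ω₀ j * (eu i (ψ j) - eu i (φ j)) ∈
      wtIdeal w (d + m) := by
    intro j
    have hj := hN j
    exact Ideal.add_mem _ (wtIdeal_mono (by omega) (mul_mem_wtIdeal (hfield j) (heX j)))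
      (wtIdeal_mono (by omega) (mul_mem_wtIdeal (hω₀' j) (heξ j)))
  have hv : v - 1 ∈ wtIdeal w 1 := by
    have := Ideal.add_mem _ (wtIdeal_mono (N := 1) (by omega) huv) hu
    rwa [sub_add_sub_cancel] at this
  have hXi : X i * field (ψ - φ) (ω₀ i) = field (ψ - φ) (ω₀ 0) * eu i (X 0) +
      field (ψ - φ) (ω₀ 1) * eu i (X 1) := by
    fin_cases i <;> simp [eu_X] <;> ring
  have hXω : X i * ω₀ i = ω₀ 0 * eu i (X 0) + ω₀ 1 * eu i (X 1) := by
    fin_cases i <;> simp [eu_X] <;> ring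
  -- Replacing `v` by `1` in front of the linear part, and the pull-back by `ω₀` in front of `v -
  -- u`, costs one more unit of weight; these are the last four terms.
  have e : v * logPullback ψ ω i - u * logPullback φ ω i -
      (logLie (ψ - φ) ω₀ i + (v - u) * (X i * ω₀ i)) =
      v * (subst ψ (ω 0) * eu i (ψ 0) - subst φ (ω 0) * eu i (φ 0) -
        (field (ψ - φ) (ω₀ 0) * eu i (X 0) + ω₀ 0 * (eu i (ψ 0) - eu i (φ 0)))) +
      v * (subst ψ (ω 1) * eu i (ψ 1) - subst φ (ω 1) * eu i (φ 1) -
        (field (ψ - φ) (ω₀ 1) * eu i (X 1) + ω₀ 1 * (eu i (ψ 1) - eu i (φ 1)))) +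
      (v - 1) * (field (ψ - φ) (ω₀ 0) * eu i (X 0) + ω₀ 0 * (eu i (ψ 0) - eu i (φ 0))) +
      (v - 1) * (field (ψ - φ) (ω₀ 1) * eu i (X 1) + ω₀ 1 * (eu i (ψ 1) - eu i (φ 1))) +
      (v - u) * (subst φ (ω 0) * eu i (φ 0) - ω₀ 0 * eu i (X 0)) +
      (v - u) * (subst φ (ω 1) * eu i (φ 1) - ω₀ 1 * eu i (X 1)) := by
    rw [logLie, hXi, hXω]
    simp only [logPullback, Pi.sub_apply, map_sub]
    ring
  rw [e]
  refine Ideal.add_mem _ (Ideal.add_mem _ (Ideal.add_mem _ (Ideal.add_mem _ (Ideal.add_mem _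
    ?_ ?_) ?_) ?_) ?_) ?_
  · exact Ideal.mul_mem_left _ _ (key 0)
  · exact Ideal.mul_mem_left _ _ (key 1)
  · exact wtIdeal_mono (by omega) (mul_mem_wtIdeal hv (hkey 0))
  · exact wtIdeal_mono (by omega) (mul_mem_wtIdeal hv (hkey 1))
  · exact wtIdeal_mono (by omega) (mul_mem_wtIdeal huv (main 0))
  · exact wtIdeal_mono (by omega) (mul_mem_wtIdeal huv (main 1))

end QHFoliation

end

noncomputable section

namespace QHFoliation

section Polynomials

open Polynomial

/-! ### The homological equation for polynomials -/

/-- The operator on polynomials which corresponds to `x ∂/∂x` on the series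
`∑ P_s x ^ (c - ℓ s) y ^ (j + k s)`. -/
def polyE0 (ℓ : ℕ) (c : ℂ) (P : ℂ[X]) : ℂ[X] := C c * P - (ℓ : ℂ[X]) * (X * derivative P)

/-- The operator on polynomials which corresponds to `y ∂/∂y` on the series
`∑ P_s x ^ (i - ℓ s) y ^ (c + k s)`. -/
def polyE1 (k : ℕ) (c : ℂ) (P : ℂ[X]) : ℂ[X] := C c * P + (k : ℂ[X]) * (X * derivative P)

theorem coeff_polyE0 (ℓ : ℕ) (c : ℂ) (P : ℂ[X]) (t : ℕ) :
    (polyE0 ℓ c P).coeff t = (c - ℓ * t) * P.coeff t := by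
  rw [polyE0, coeff_sub, coeff_C_mul, coeff_natCast_mul]
  cases t with
  | zero => simp
  | succ t => rw [coeff_X_mul, coeff_derivative]; push_cast; ring

theorem coeff_polyE1 (k : ℕ) (c : ℂ) (P : ℂ[X]) (t : ℕ) :
    (polyE1 k c P).coeff t = (c + k * t) * P.coeff t := by
  rw [polyE1, coeff_add, coeff_C_mul, coeff_natCast_mul]
  cases t with
  | zero => simp
  | succ t => rw [coeff_X_mul, coeff_derivative]; push_cast; ring

theorem mem_degreeLT_iff {N : ℕ} {P : ℂ[X]} :
    P ∈ degreeLT ℂ N ↔ ∀ t, N ≤ t → P.coeff t = 0 := by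
  rw [mem_degreeLT, degree_lt_iff_coeff_zero]

theorem polyE0_mem {N ℓ : ℕ} {c : ℂ} {P : ℂ[X]} (hP : P ∈ degreeLT ℂ N) :
    polyE0 ℓ c P ∈ degreeLT ℂ N := by
  rw [mem_degreeLT_iff] at *
  intro t ht
  rw [coeff_polyE0, hP t ht, mul_zero]

theorem polyE1_mem {N k : ℕ} {c : ℂ} {P : ℂ[X]} (hP : P ∈ degreeLT ℂ N) :
    polyE1 k c P ∈ degreeLT ℂ N := by
  rw [mem_degreeLT_iff] at *
  intro t ht
  rw [coeff_polyE1, hP t ht, mul_zero]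

theorem mul_mem_degreeLT {N n : ℕ} {P Q : ℂ[X]} (hP : P ∈ degreeLT ℂ N)
    (hQ : Q ∈ degreeLT ℂ (n + 1)) : P * Q ∈ degreeLT ℂ (N + n) := by
  rw [mem_degreeLT_iff] at *
  intro t ht
  rw [coeff_mul]
  refine Finset.sum_eq_zero fun x hx => ?_
  have := Finset.HasAntidiagonal.mem_antidiagonal.mp hx
  by_cases h : N ≤ x.1
  · rw [hP _ h, zero_mul]
  · rw [hQ _ (by omega), mul_zero]

theorem degreeLT_mono' {N M : ℕ} (h : N ≤ M) {P : ℂ[X]} (hP : P ∈ degreeLT ℂ N) :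
    P ∈ degreeLT ℂ M := degreeLT_mono h hP

theorem C_mul_mem_degreeLT {N : ℕ} {P : ℂ[X]} (c : ℂ) (hP : P ∈ degreeLT ℂ N) :
    C c * P ∈ degreeLT ℂ N := by
  rw [← smul_eq_C_mul]; exact Submodule.smul_mem _ _ hP

/-- The data of the homological equation in a given weight. -/
structure PolyData where
  /-- the weight of `x` -/
  k : ℕ
  /-- the weight of `y` -/
  ℓ : ℕ
  /-- the degree of `p` and `r` -/
  n : ℕ
  /-- the first coefficient of the initial form -/
  p : ℂ[X]
  /-- the second coefficient of the initial form -/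
  r : ℂ[X]
  /-- the weight -/
  m : ℕ
  /-- the exponent of `x` in the monomial with the lowest power of `y` -/
  i : ℂ
  /-- the lowest exponent of `y` -/
  j : ℂ
  /-- the number of monomials -/
  e : ℕ
  k_pos : 0 < k
  ℓ_pos : 0 < ℓ
  m_pos : 0 < m
  weight : k * i + ℓ * j = m
  p_mem : p ∈ degreeLT ℂ (n + 1)
  r_mem : r ∈ degreeLT ℂ (n + 1)

/-! ### The hamiltonian and the radial half of the homological equation. -/

namespace PolyData

variable (D : PolyData)

/-- The contraction of the initial form with the radial field. -/
def q : ℂ[X] := (D.k : ℂ[X]) * D.p + (D.ℓ : ℂ[X]) * D.r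

/-- The polynomial with coefficients `A_i`. -/
def A : ℂ[X] := (D.m : ℂ[X]) * D.p + D.q + polyE0 D.ℓ (D.ℓ * D.n) D.q

/-- The polynomial with coefficients `B_{n-i}`. -/
def B : ℂ[X] := (D.m : ℂ[X]) * D.r + D.q + polyE1 D.k 0 D.q

/-- The first component of `L_ξ ω + v ω`. -/
def lie0 (α β v : ℂ[X]) : ℂ[X] :=
  α * polyE0 D.ℓ (D.ℓ * D.n) D.p + β * (D.p + polyE1 D.k 0 D.p) +
    D.p * (α + polyE0 D.ℓ D.i α) + D.r * polyE0 D.ℓ D.i β + v * D.p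

/-- The second component of `L_ξ ω + v ω`. -/
def lie1 (α β v : ℂ[X]) : ℂ[X] :=
  β * polyE1 D.k 0 D.r + α * (D.r + polyE0 D.ℓ (D.ℓ * D.n) D.r) +
    D.r * (β + polyE1 D.k D.j β) + D.p * polyE1 D.k D.j α + v * D.r

/-- The first component of `d(xyh) + s (ℓ y dx - k x dy)`. -/
def nf0 (h s : ℂ[X]) : ℂ[X] := h + polyE0 D.ℓ (D.i + D.ℓ * D.n) h + (D.ℓ : ℂ[X]) * s

/-- The second component of `d(xyh) + s (ℓ y dx - k x dy)`. -/
def nf1 (h s : ℂ[X]) : ℂ[X] := h + polyE1 D.k D.j h - (D.k : ℂ[X]) * s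

/-- The operator which solves the radial part of the homological equation. -/
def radial (v : ℂ[X]) : ℂ[X] := D.r * polyE0 D.ℓ D.i v - D.p * polyE1 D.k D.j v

/-- The common weight of the forms. -/
def total : ℂ := D.k + D.ℓ + D.k * D.ℓ * D.n + D.m

/-- The divergence of the initial form. -/
def curl : ℂ[X] :=
  D.r + polyE0 D.ℓ (D.ℓ * D.n) D.r - D.p - polyE1 D.k 0 D.p

theorem total_ne_zero : D.total ≠ 0 := by
  have : D.total = ((D.k + D.ℓ + D.k * D.ℓ * D.n + D.m : ℕ) : ℂ) := by
    simp only [total]; push_cast; ring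
  rw [this]
  exact_mod_cast by have := D.m_pos; omega

theorem weight_C : (D.k : ℂ[X]) * C D.i + (D.ℓ : ℂ[X]) * C D.j = (D.m : ℂ[X]) := by
  have := congrArg (C : ℂ → ℂ[X]) D.weight
  simpa using this

theorem total_C : C D.total = (D.k : ℂ[X]) + D.ℓ + D.k * D.ℓ * D.n + D.m := by
  simp [total]

/-- With `R` the radial field and `[R, ξ] = m ξ`, Cartan's calculus gives `i_R L_ξ ω = ξ(q) + m
ω(ξ)`. The polynomials `A` and `B` are the coefficients of `α` and `β` on the right. The relation `k
i + ℓ j = m` is Euler's identity for `α` and `β`. -/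
theorem contraction_lie (α β v : ℂ[X]) :
    (D.k : ℂ[X]) * D.lie0 α β v + (D.ℓ : ℂ[X]) * D.lie1 α β v =
      α * D.A + β * D.B + v * D.q := by
  have h := D.weight_C
  simp only [lie0, lie1, A, B, q, polyE0, polyE1, derivative_add, derivative_mul,
    derivative_natCast, map_mul, map_natCast, map_zero]
  linear_combination (D.p * α + D.r * β) * h

/-- The form `ℓ y dx - k x dy` is annihilated by the radial field, and Euler's identity turns
`d(xyh)` into a multiple of `xyh`. -/
theorem contraction_nf (h s : ℂ[X]) :
    (D.k : ℂ[X]) * D.nf0 h s + (D.ℓ : ℂ[X]) * D.nf1 h s = C D.total * h := by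
  have hw := D.weight_C
  rw [total_C]
  simp only [nf0, nf1, polyE0, polyE1, map_add, map_mul, map_natCast]
  linear_combination h * hw

/-- Euler's identity for `q`. It allows a term `v q` to be traded for a multiple of the radial
field. -/
theorem contraction_AB : (D.k : ℂ[X]) * D.A + (D.ℓ : ℂ[X]) * D.B = C D.total * D.q := by
  rw [total_C]
  simp only [A, B, q, polyE0, polyE1, derivative_add, derivative_mul,
    derivative_natCast, map_mul, map_natCast, map_zero]
  ring

/-- The field `-v (k, ℓ)` together with the unit `total · v` does not affect the contraction, by
`contraction_AB`. Its effect is thus a multiple of `ℓ y dx - k x dy`, and the first component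
suffices to identify the multiple. -/
theorem lie0_shift (α β v : ℂ[X]) :
    D.lie0 (α - (D.k : ℂ[X]) * v) (β - (D.ℓ : ℂ[X]) * v) (C D.total * v) =
      D.lie0 α β 0 - (D.ℓ : ℂ[X]) * D.radial v := by
  have hw := D.weight_C
  rw [total_C]
  simp only [lie0, radial, polyE0, polyE1, derivative_sub, derivative_mul, derivative_natCast,
    map_mul, map_natCast, map_zero]
  linear_combination (-(D.p * v)) * hw

theorem lie0_linear (α β v α' β' v' : ℂ[X]) :
    D.lie0 (α + α') (β + β') (v + v') = D.lie0 α β v + D.lie0 α' β' v' := by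
  simp only [lie0, polyE0, derivative_add]; ring

theorem lie0_smul (c : ℂ) (α β v : ℂ[X]) :
    D.lie0 (C c * α) (C c * β) (C c * v) = C c * D.lie0 α β v := by
  simp only [lie0, polyE0, derivative_mul, derivative_C]; ring

/-- The field `G (r, -p)` is annihilated by `ω`, so `L_ξ ω = i_ξ dω` is a multiple of `ω`; in
dimension two the factor is `G` times the coefficient of `dω`. -/
theorem lie0_kernel (G : ℂ[X]) :
    D.lie0 (G * D.r) (-(G * D.p)) (-(G * D.curl)) = 0 := by
  simp only [lie0, curl, polyE0, polyE1, derivative_mul, derivative_neg, map_mul,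
    map_natCast, map_zero]
  ring

theorem q_mem : D.q ∈ degreeLT ℂ (D.n + 1) := by
  have h1 := C_mul_mem_degreeLT (D.k : ℂ) D.p_mem
  have h2 := C_mul_mem_degreeLT (D.ℓ : ℂ) D.r_mem
  simpa [q] using Submodule.add_mem _ h1 h2

theorem A_mem : D.A ∈ degreeLT ℂ (D.n + 1) := by
  have h1 := C_mul_mem_degreeLT (D.m : ℂ) D.p_mem
  simpa [A] using Submodule.add_mem _ (Submodule.add_mem _ h1 D.q_mem) (polyE0_mem D.q_mem)

theorem B_mem : D.B ∈ degreeLT ℂ (D.n + 1) := by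
  have h1 := C_mul_mem_degreeLT (D.m : ℂ) D.r_mem
  simpa [B] using Submodule.add_mem _ (Submodule.add_mem _ h1 D.q_mem) (polyE1_mem D.q_mem)

/-- The solvability of the hamiltonian part of the homological equation, with the uniqueness up to
the fields which are tangent to the initial form. -/
structure Hamiltonian : Prop where
  exists_sol : ∀ H ∈ degreeLT ℂ (D.e + D.n), ∃ α ∈ degreeLT ℂ D.e, ∃ β ∈ degreeLT ℂ D.e,
    ∀ t, t < D.e ∨ D.n ≤ t → (α * D.A + β * D.B - H).coeff t = 0
  kernel : ∀ α ∈ degreeLT ℂ D.e, ∀ β ∈ degreeLT ℂ D.e,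
    (∀ t, t < D.e ∨ D.n ≤ t → (α * D.A + β * D.B).coeff t = 0) →
    ∃ G ∈ degreeLT ℂ (D.e - D.n), α = G * D.B ∧ β = -(G * D.A)

/-- The solvability of the radial part of the homological equation. -/
def Radial : Prop :=
  ∀ s < D.e, D.r.coeff D.n * (D.i - D.ℓ * s) - D.p.coeff D.n * (D.j + D.k * s) ≠ 0

theorem radial_mem {v : ℂ[X]} (hv : v ∈ degreeLT ℂ D.e) : D.radial v ∈ degreeLT ℂ (D.e + D.n) := by
  rw [radial, mul_comm, mul_comm D.p]
  exact Submodule.sub_mem _ (mul_mem_degreeLT (polyE0_mem hv) D.r_mem)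
    (mul_mem_degreeLT (polyE1_mem hv) D.p_mem)

theorem coeff_mul_top {N n t : ℕ} {P Q : ℂ[X]} (hP : P ∈ degreeLT ℂ (N + 1))
    (hQ : Q ∈ degreeLT ℂ (n + 1)) (ht : t = N + n) : (P * Q).coeff t = P.coeff N * Q.coeff n := by
  subst ht
  rw [coeff_mul, Finset.sum_eq_single (N, n)]
  · rintro ⟨a, b⟩ hx hne
    have := Finset.HasAntidiagonal.mem_antidiagonal.mp hx
    rw [mem_degreeLT_iff] at hP hQ
    dsimp only at *
    by_cases h : N + 1 ≤ a
    · rw [hP _ h, zero_mul]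
    · rw [hQ b, mul_zero]
      by_contra h2
      exact hne (Prod.ext_iff.mpr ⟨by dsimp only; omega, by dsimp only; omega⟩)
  · intro h
    exact absurd (Finset.HasAntidiagonal.mem_antidiagonal.mpr (by rfl)) h

/-- If `v` has degree `s`, the coefficient of index `s + n` is the leading coefficient of `v` times
the number which `Radial` requires to be nonzero. -/
theorem radial_injective (hR : D.Radial) {v : ℂ[X]} (hv : v ∈ degreeLT ℂ D.e)
    (h : ∀ t, D.n ≤ t → (D.radial v).coeff t = 0) : v = 0 := by
  by_contra hne
  set s := v.natDegree with hs
  have hse : s < D.e := by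
    by_contra hle
    rw [mem_degreeLT_iff] at hv
    exact hne (leadingCoeff_eq_zero.mp (hv s (by omega)))
  have hvs : v ∈ degreeLT ℂ (s + 1) := by
    rw [mem_degreeLT_iff]
    intro t ht
    exact coeff_eq_zero_of_natDegree_lt (by omega)
  have h1 := h (s + D.n) (by omega)
  rw [radial, mul_comm, mul_comm D.p, coeff_sub, coeff_mul_top (polyE0_mem hvs) D.r_mem rfl,
    coeff_mul_top (polyE1_mem hvs) D.p_mem rfl, coeff_polyE0, coeff_polyE1] at h1
  have h2 : v.coeff s * (D.r.coeff D.n * (D.i - D.ℓ * s) - D.p.coeff D.n * (D.j + D.k * s)) = 0 := by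
    linear_combination h1
  rcases mul_eq_zero.mp h2 with h3 | h3
  · exact hne (leadingCoeff_eq_zero.mp h3)
  · exact hR s hse h3

/-- The radial operator, on the coefficients. -/
def radialMap : (Fin D.e → ℂ) →ₗ[ℂ] (Fin D.e → ℂ) where
  toFun c := fun s => (D.radial ((degreeLTEquiv ℂ D.e).symm c : ℂ[X])).coeff (D.n + s)
  map_add' c c' := by
    ext s
    simp only [map_add, Submodule.coe_add, radial, polyE0, polyE1, Pi.add_apply,
      ← coeff_add]
    congr 1
    ring
  map_smul' a c := by
    ext s
    simp only [map_smul, Submodule.coe_smul, radial, polyE0, polyE1,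
      Pi.smul_apply, RingHom.id_apply, ← coeff_smul, smul_eq_C_mul, derivative_C_mul]
    congr 1
    ring

/-- The coefficients of index `n, …, n + e - 1` give `e` equations in `e` unknowns, so injectivity
suffices. -/
theorem radial_surjective (hR : D.Radial) (Y : ℂ[X]) (hY : Y ∈ degreeLT ℂ (D.e + D.n)) :
    ∃ v ∈ degreeLT ℂ D.e, ∀ t, D.n ≤ t → (D.radial v - Y).coeff t = 0 := by
  have hinj : Function.Injective D.radialMap := by
    rw [injective_iff_map_eq_zero]
    intro c hc
    have hv := ((degreeLTEquiv ℂ D.e).symm c).2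
    have h0 : ((degreeLTEquiv ℂ D.e).symm c : ℂ[X]) = 0 := by
      refine D.radial_injective hR hv fun t ht => ?_
      by_cases hte : t < D.e + D.n
      · have := congrFun hc ⟨t - D.n, by omega⟩
        simp only [radialMap, LinearMap.coe_mk, AddHom.coe_mk, Pi.zero_apply] at this
        rwa [Nat.add_sub_cancel' ht] at this
      · exact mem_degreeLT_iff.mp (D.radial_mem hv) t (by omega)
    have h1 : (degreeLTEquiv ℂ D.e).symm c = 0 := Subtype.ext h0
    simpa using h1
  obtain ⟨c, hc⟩ := LinearMap.injective_iff_surjective.mp hinj (fun s => Y.coeff (D.n + s))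
  refine ⟨_, ((degreeLTEquiv ℂ D.e).symm c).2, fun t ht => ?_⟩
  by_cases hte : t < D.e + D.n
  · have := congrFun hc ⟨t - D.n, by omega⟩
    simp only [radialMap, LinearMap.coe_mk, AddHom.coe_mk] at this
    rw [Nat.add_sub_cancel' ht] at this
    rw [coeff_sub, this, sub_self]
  · rw [coeff_sub, mem_degreeLT_iff.mp (D.radial_mem ((degreeLTEquiv ℂ D.e).symm c).2) t (by omega),
      mem_degreeLT_iff.mp hY t (by omega), sub_self]

theorem lie0_mem {α β v : ℂ[X]} (hα : α ∈ degreeLT ℂ D.e) (hβ : β ∈ degreeLT ℂ D.e)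
    (hv : v ∈ degreeLT ℂ D.e) : D.lie0 α β v ∈ degreeLT ℂ (D.e + D.n) := by
  rw [lie0, mul_comm D.p, mul_comm D.r]
  refine Submodule.add_mem _ (Submodule.add_mem _ (Submodule.add_mem _ (Submodule.add_mem _
    ?_ ?_) ?_) ?_) ?_
  · exact mul_mem_degreeLT hα (polyE0_mem D.p_mem)
  · exact mul_mem_degreeLT hβ (Submodule.add_mem _ D.p_mem (polyE1_mem D.p_mem))
  · exact mul_mem_degreeLT (Submodule.add_mem _ hα (polyE0_mem hα)) D.p_mem
  · exact mul_mem_degreeLT (polyE0_mem hβ) D.r_mem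
  · exact mul_mem_degreeLT hv D.p_mem

/-- Solution of the homological equation. -/
theorem exists_homological (hH : D.Hamiltonian) (hR : D.Radial) {τ₀ τ₁ : ℂ[X]}
    (h₀ : τ₀ ∈ degreeLT ℂ (D.e + D.n)) (h₁ : τ₁ ∈ degreeLT ℂ (D.e + D.n)) :
    ∃ α ∈ degreeLT ℂ D.e, ∃ β ∈ degreeLT ℂ D.e, ∃ v ∈ degreeLT ℂ D.e,
      ∃ h ∈ degreeLT ℂ (D.e + D.n), ∃ s ∈ degreeLT ℂ D.n,
      (∀ t, t < D.e ∨ D.n ≤ t → h.coeff t = 0) ∧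
      D.lie0 α β v + τ₀ = D.nf0 h s ∧ D.lie1 α β v + τ₁ = D.nf1 h s := by
  have hk : (D.k : ℂ) ≠ 0 := Nat.cast_ne_zero.mpr D.k_pos.ne'
  have hℓ : (D.ℓ : ℂ) ≠ 0 := Nat.cast_ne_zero.mpr D.ℓ_pos.ne'
  have hT := D.total_ne_zero
  -- The field is chosen so that the contraction has coefficients only in the window `e ≤ t < n`;
  -- this contraction, divided by `total`, will be `h`.
  obtain ⟨α, hα, β, hβ, hab⟩ := hH.exists_sol (-(C (D.k : ℂ) * τ₀ + C (D.ℓ : ℂ) * τ₁))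
    (Submodule.neg_mem _ (Submodule.add_mem _ (C_mul_mem_degreeLT _ h₀)
      (C_mul_mem_degreeLT _ h₁)))
  set h : ℂ[X] := C D.total⁻¹ * (α * D.A + β * D.B - -(C (D.k : ℂ) * τ₀ + C (D.ℓ : ℂ) * τ₁))
    with hh
  have hmem : h ∈ degreeLT ℂ (D.e + D.n) := by
    rw [mem_degreeLT_iff]
    intro t ht
    rw [hh, coeff_C_mul, hab t (by omega), mul_zero]
  have hCT : C D.total * h = α * D.A + β * D.B + ((D.k : ℂ[X]) * τ₀ + (D.ℓ : ℂ[X]) * τ₁) := by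
    rw [hh, ← mul_assoc, ← C_mul, mul_inv_cancel₀ hT, C_1, C_eq_natCast, C_eq_natCast]
    ring
  have hY : D.lie0 α β 0 + τ₀ - (h + polyE0 D.ℓ (D.i + D.ℓ * D.n) h) ∈ degreeLT ℂ (D.e + D.n) :=
    Submodule.sub_mem _ (Submodule.add_mem _ (D.lie0_mem hα hβ (Submodule.zero_mem _)) h₀)
      (Submodule.add_mem _ hmem (polyE0_mem hmem))
  -- What is left is a multiple of `ℓ y dx - k x dy`; `v` removes its coefficients of index at least
  -- `n`, and the remainder is `s`.
  obtain ⟨v, hv, hvt⟩ := D.radial_surjective hR _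
    (C_mul_mem_degreeLT (D.ℓ : ℂ)⁻¹ hY)
  have e1 : (C D.total : ℂ[X]) * C D.total⁻¹ = 1 := by rw [← C_mul, mul_inv_cancel₀ hT, C_1]
  have e2 : (D.ℓ : ℂ[X]) * C (D.ℓ : ℂ)⁻¹ = 1 := by
    rw [← C_eq_natCast, ← C_mul, mul_inv_cancel₀ hℓ, C_1]
  set V : ℂ[X] := C D.total * v with hV
  set s : ℂ[X] := C (D.ℓ : ℂ)⁻¹ * (D.lie0 α β 0 + τ₀ -
    (h + polyE0 D.ℓ (D.i + D.ℓ * D.n) h)) - D.radial v with hs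
  have hlie := D.lie0_shift α β v
  rw [← hV] at hlie
  have hq0 : D.lie0 (α - (D.k : ℂ[X]) * v) (β - (D.ℓ : ℂ[X]) * v) V + τ₀ = D.nf0 h s := by
    rw [hlie, nf0, hs]
    linear_combination (-(D.lie0 α β 0 + τ₀ - (h + polyE0 D.ℓ (D.i + D.ℓ * D.n) h))) * e2
  refine ⟨α - (D.k : ℂ[X]) * v, ?_, β - (D.ℓ : ℂ[X]) * v, ?_, V, ?_, h, hmem, s, ?_, ?_, hq0, ?_⟩
  · rw [← C_eq_natCast]; exact Submodule.sub_mem _ hα (C_mul_mem_degreeLT _ hv)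
  · rw [← C_eq_natCast]; exact Submodule.sub_mem _ hβ (C_mul_mem_degreeLT _ hv)
  · exact C_mul_mem_degreeLT _ hv
  · rw [mem_degreeLT_iff]
    intro t ht
    have := hvt t ht
    rw [coeff_sub] at this
    rw [hs, coeff_sub]
    linear_combination -this
  · intro t ht
    rw [hh, coeff_C_mul, hab t ht, mul_zero]
  -- The second component follows from the first one and from the contraction, since `ℓ ≠ 0`.
  · have h3 := D.contraction_lie (α - (D.k : ℂ[X]) * v) (β - (D.ℓ : ℂ[X]) * v) V
    have h4 := D.contraction_nf h s
    have h5 := D.contraction_AB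
    have hℓ' : (D.ℓ : ℂ[X]) ≠ 0 := by exact_mod_cast D.ℓ_pos.ne'
    apply mul_left_cancel₀ hℓ'
    clear_value h s V
    subst hV
    linear_combination h3 - h4 - hCT - (D.k : ℂ[X]) * hq0 - v * h5

/-- Uniqueness in the homological equation. -/
theorem unique_homological (hH : D.Hamiltonian) (hR : D.Radial) {α β v h s : ℂ[X]}
    (hα : α ∈ degreeLT ℂ D.e) (hβ : β ∈ degreeLT ℂ D.e) (hv : v ∈ degreeLT ℂ D.e)
    (hs : s ∈ degreeLT ℂ D.n) (hh : ∀ t, t < D.e ∨ D.n ≤ t → h.coeff t = 0)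
    (h0 : D.lie0 α β v = D.nf0 h s) (h1 : D.lie1 α β v = D.nf1 h s) :
    h = 0 ∧ s = 0 ∧ ∃ G ∈ degreeLT ℂ (D.e - D.n), α = G * D.r ∧ β = -(G * D.p) ∧
      v = -(G * D.curl) := by
  have hℓ' : (D.ℓ : ℂ[X]) ≠ 0 := by exact_mod_cast D.ℓ_pos.ne'
  have hT := D.total_ne_zero
  have hT' : (C D.total : ℂ[X]) ≠ 0 := C_ne_zero.mpr hT
  have e1 : (C D.total : ℂ[X]) * C D.total⁻¹ = 1 := by rw [← C_mul, mul_inv_cancel₀ hT, C_1]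
  have hmem : ∀ (c : ℕ) {P : ℂ[X]}, P ∈ degreeLT ℂ D.e → (c : ℂ[X]) * P ∈ degreeLT ℂ D.e := by
    intro c P hP
    rw [← C_eq_natCast]; exact C_mul_mem_degreeLT _ hP
  -- After multiplication by `total`, the relation `k A + ℓ B = total q` absorbs `v q` into the
  -- field, so that the hamiltonian kernel can be applied.
  have hq : (C D.total * α + (D.k : ℂ[X]) * v) * D.A + (C D.total * β + (D.ℓ : ℂ[X]) * v) * D.B =
      C (D.total * D.total) * h := by
    have h3 := D.contraction_lie α β v
    have h4 := D.contraction_nf h s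
    have h5 := D.contraction_AB
    rw [C_mul]
    linear_combination (-C D.total) * h3 + C D.total * h4 + v * h5 +
      C D.total * (D.k : ℂ[X]) * h0 + C D.total * (D.ℓ : ℂ[X]) * h1
  obtain ⟨G, hG, hG0, hG1⟩ := hH.kernel _
    (Submodule.add_mem _ (C_mul_mem_degreeLT _ hα) (hmem _ hv)) _
    (Submodule.add_mem _ (C_mul_mem_degreeLT _ hβ) (hmem _ hv)) (fun t ht => by
      rw [hq, coeff_C_mul, hh t ht, mul_zero])
  have hzero : h = 0 := by
    have h6 : C (D.total * D.total) * h = 0 := by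
      rw [← hq, hG0, hG1]; ring
    rcases mul_eq_zero.mp h6 with h7 | h7
    · exact absurd h7 (C_ne_zero.mpr (mul_ne_zero hT hT))
    · exact h7
  subst hzero
  -- Once the tangent field `G (r, -p)` with unit `-G curl` is subtracted, the rest is a multiple
  -- `v'` of the radial field (`ha`, `hb` below). Injectivity of the radial operator then gives `v'
  -- = 0`.
  set v' : ℂ[X] := v + G * D.curl with hv'
  have hB : D.B = C D.total * D.r - (D.k : ℂ[X]) * D.curl := by
    rw [total_C]
    simp only [B, curl, q, polyE0, polyE1, derivative_add, derivative_mul,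
      derivative_natCast, map_mul, map_natCast, map_zero]
    ring
  have hA : D.A = C D.total * D.p + (D.ℓ : ℂ[X]) * D.curl := by
    rw [total_C]
    simp only [A, curl, q, polyE0, polyE1, derivative_add, derivative_mul,
      derivative_natCast, map_mul, map_natCast, map_zero]
    ring
  have ha : C D.total * (α - G * D.r) = -((D.k : ℂ[X]) * v') := by
    rw [hv']; linear_combination hG0 + G * hB
  have hb : C D.total * (β + G * D.p) = -((D.ℓ : ℂ[X]) * v') := by
    rw [hv']; linear_combination hG1 - G * hA
  have hc : D.curl ∈ degreeLT ℂ (D.n + 1) :=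
    Submodule.sub_mem _ (Submodule.sub_mem _ (Submodule.add_mem _ D.r_mem (polyE0_mem D.r_mem))
      D.p_mem) (polyE1_mem D.p_mem)
  have hv'mem : v' ∈ degreeLT ℂ D.e := by
    by_cases hle : D.n ≤ D.e
    · have := mul_mem_degreeLT hG hc
      rw [Nat.sub_add_cancel hle] at this
      exact Submodule.add_mem _ hv this
    · have : G = 0 := by
        rw [Nat.sub_eq_zero_of_le (by omega)] at hG
        ext t
        rw [mem_degreeLT_iff.mp hG t (Nat.zero_le _), coeff_zero]
      rw [hv', this, zero_mul, add_zero]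
      exact hv
  have hlie : D.lie0 (α - G * D.r) (β + G * D.p) v' = (D.ℓ : ℂ[X]) * s := by
    have h2 := D.lie0_linear (α - G * D.r) (β + G * D.p) v' (G * D.r) (-(G * D.p))
      (-(G * D.curl))
    rw [D.lie0_kernel, add_zero, sub_add_cancel, add_neg_cancel_right, hv',
      add_neg_cancel_right, h0] at h2
    rw [hv', ← h2]
    simp [nf0, polyE0]
  have hrad : -((D.ℓ : ℂ[X]) * D.radial v') = C D.total * ((D.ℓ : ℂ[X]) * s) := by
    have h5 := D.lie0_shift 0 0 v'
    have h6 := D.lie0_smul D.total (α - G * D.r) (β + G * D.p) v'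
    have h7 : D.lie0 0 0 0 = 0 := by simp [lie0, polyE0]
    rw [ha, hb, hlie, ← zero_sub, ← zero_sub ((D.ℓ : ℂ[X]) * v'), h5, h7] at h6
    linear_combination h6
  have hrad' : D.radial v' = -(C D.total * s) := by
    apply mul_left_cancel₀ hℓ'
    linear_combination -hrad
  have hv0 : v' = 0 := by
    refine D.radial_injective hR hv'mem fun t ht => ?_
    rw [hrad', coeff_neg, coeff_C_mul, mem_degreeLT_iff.mp hs t ht, mul_zero, neg_zero]
  have hs0 : s = 0 := by
    rw [hv0] at hrad'
    have : C D.total * s = 0 := by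
      have h2 : D.radial 0 = 0 := by simp [radial, polyE0, polyE1]
      rw [h2] at hrad'
      linear_combination hrad'
    exact (mul_eq_zero.mp this).resolve_left hT'
  refine ⟨rfl, hs0, G, hG, ?_, ?_, ?_⟩
  · rw [hv0, mul_zero, neg_zero] at ha
    exact sub_eq_zero.mp ((mul_eq_zero.mp ha).resolve_left hT')
  · rw [hv0, mul_zero, neg_zero] at hb
    exact eq_neg_of_add_eq_zero_left ((mul_eq_zero.mp hb).resolve_left hT')
  · exact eq_neg_of_add_eq_zero_left hv0

/-! ### Solvability of the hamiltonian half. -/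

/-- The coefficients of a polynomial, extended by zero to the integers. -/
def icoeff (P : ℂ[X]) (t : ℤ) : ℂ := if 0 ≤ t then P.coeff t.toNat else 0

/-- Multiplication by `P` acts on coefficients by a Toeplitz matrix; the extension by zero to
negative indices makes the entries uniform. -/
theorem coeff_mul_icoeff {e : ℕ} {α : ℂ[X]} (hα : α ∈ degreeLT ℂ e) (P : ℂ[X]) (t : ℕ) :
    (α * P).coeff t = ∑ s : Fin e, icoeff P (t - (s : ℕ)) * α.coeff s := by
  have h1 : α = ∑ s : Fin e, C (α.coeff s) * X ^ (s : ℕ) := by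
    rw [Fin.sum_univ_eq_sum_range (fun s => C (α.coeff s) * X ^ s) e]
    ext t
    simp only [finsetSum_coeff, coeff_C_mul, coeff_X_pow, mul_ite, mul_one, mul_zero,
      Finset.sum_ite_eq, Finset.mem_range]
    split_ifs with h
    · rfl
    · exact mem_degreeLT_iff.mp hα t (by omega)
  conv_lhs => rw [h1]
  rw [Finset.sum_mul, finsetSum_coeff]
  refine Finset.sum_congr rfl fun s _ => ?_
  rw [mul_assoc, coeff_C_mul, coeff_X_pow_mul', icoeff]
  by_cases h : (s : ℕ) ≤ t
  · rw [if_pos h, if_pos (by omega), mul_comm]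
    congr 2
    omega
  · rw [if_neg h, if_neg (by omega)]
    ring

/-- The hamiltonian part can be solved when a block Toeplitz determinant does not vanish. -/
theorem hamiltonian_of_det (h : (Matrix.fromBlocks
      (Matrix.of fun r s : Fin D.e => icoeff D.A ((r : ℕ) - (s : ℕ)))
      (Matrix.of fun r s : Fin D.e => icoeff D.B ((r : ℕ) - (s : ℕ)))
      (Matrix.of fun r s : Fin D.e => icoeff D.A ((D.n : ℤ) + (r : ℕ) - (s : ℕ)))
      (Matrix.of fun r s : Fin D.e => icoeff D.B ((D.n : ℤ) + (r : ℕ) - (s : ℕ)))).det ≠ 0) :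
    D.Hamiltonian := by
  set M := Matrix.fromBlocks
      (Matrix.of fun r s : Fin D.e => icoeff D.A ((r : ℕ) - (s : ℕ)))
      (Matrix.of fun r s : Fin D.e => icoeff D.B ((r : ℕ) - (s : ℕ)))
      (Matrix.of fun r s : Fin D.e => icoeff D.A ((D.n : ℤ) + (r : ℕ) - (s : ℕ)))
      (Matrix.of fun r s : Fin D.e => icoeff D.B ((D.n : ℤ) + (r : ℕ) - (s : ℕ))) with hM
  have hu : IsUnit M := (Matrix.isUnit_iff_isUnit_det M).mpr (isUnit_iff_ne_zero.mpr h)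
  have hl : ∀ {α β : ℂ[X]}, α ∈ degreeLT ℂ D.e → β ∈ degreeLT ℂ D.e → ∀ r : Fin D.e,
      M.mulVec (Sum.elim (fun s : Fin D.e => α.coeff s) (fun s : Fin D.e => β.coeff s))
        (Sum.inl r) = (α * D.A + β * D.B).coeff r := by
    intro α β hα hβ r
    rw [coeff_add, coeff_mul_icoeff hα, coeff_mul_icoeff hβ, hM, Matrix.fromBlocks_mulVec]
    simp [Matrix.mulVec, dotProduct]
  have hr : ∀ {α β : ℂ[X]}, α ∈ degreeLT ℂ D.e → β ∈ degreeLT ℂ D.e → ∀ r : Fin D.e,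
      M.mulVec (Sum.elim (fun s : Fin D.e => α.coeff s) (fun s : Fin D.e => β.coeff s))
        (Sum.inr r) = (α * D.A + β * D.B).coeff (D.n + r) := by
    intro α β hα hβ r
    rw [coeff_add, coeff_mul_icoeff hα, coeff_mul_icoeff hβ, hM, Matrix.fromBlocks_mulVec]
    simp [Matrix.mulVec, dotProduct]
  have hbig : ∀ {α β : ℂ[X]}, α ∈ degreeLT ℂ D.e → β ∈ degreeLT ℂ D.e → ∀ t, D.e + D.n ≤ t →
      (α * D.A + β * D.B).coeff t = 0 := fun hα hβ t ht =>
    mem_degreeLT_iff.mp (Submodule.add_mem _ (mul_mem_degreeLT hα D.A_mem)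
      (mul_mem_degreeLT hβ D.B_mem)) t ht
  constructor
  · intro H hH
    obtain ⟨c, hc⟩ := Matrix.mulVec_surjective_iff_isUnit.mpr hu
      (Sum.elim (fun s : Fin D.e => H.coeff s) (fun s : Fin D.e => H.coeff (D.n + s)))
    have hα := ((degreeLTEquiv ℂ D.e).symm (c ∘ Sum.inl)).2
    have hβ := ((degreeLTEquiv ℂ D.e).symm (c ∘ Sum.inr)).2
    have hcoe : ∀ (f : Fin D.e → ℂ) (s : Fin D.e),
        ((degreeLTEquiv ℂ D.e).symm f : ℂ[X]).coeff s = f s := fun f s => by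
      have := congrFun ((degreeLTEquiv ℂ D.e).apply_symm_apply f) s
      exact this
    refine ⟨_, hα, _, hβ, fun t ht => ?_⟩
    have hc' : c = Sum.elim
        (fun s : Fin D.e => ((degreeLTEquiv ℂ D.e).symm (c ∘ Sum.inl) : ℂ[X]).coeff s)
        (fun s : Fin D.e => ((degreeLTEquiv ℂ D.e).symm (c ∘ Sum.inr) : ℂ[X]).coeff s) := by
      ext s; rcases s with s | s <;> simp only [hcoe, Sum.elim_inl, Sum.elim_inr] <;> rfl
    rw [hc'] at hc
    rw [coeff_sub]
    by_cases h1 : t < D.e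
    · have := congrFun hc (Sum.inl ⟨t, h1⟩)
      rw [hl hα hβ] at this
      rw [this]; simp
    · by_cases h2 : t < D.e + D.n
      · have := congrFun hc (Sum.inr ⟨t - D.n, by omega⟩)
        rw [hr hα hβ] at this
        simp only [Sum.elim_inr] at this
        rw [Nat.add_sub_cancel' (by omega)] at this
        rw [this, sub_self]
      · rw [hbig hα hβ t (by omega), mem_degreeLT_iff.mp hH t (by omega), sub_self]
  · intro α hα β hβ hab
    have h0 : M.mulVec (Sum.elim (fun s : Fin D.e => α.coeff s) (fun s : Fin D.e => β.coeff s)) =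
        M.mulVec 0 := by
      rw [Matrix.mulVec_zero]
      ext s
      rcases s with s | s
      · rw [hl hα hβ, hab _ (by omega)]; rfl
      · rw [hr hα hβ, hab _ (by omega)]; rfl
    have h1 := Matrix.mulVec_injective_iff_isUnit.mpr hu h0
    -- An invertible matrix leaves no nonzero solution, so the tangent factor is zero.
    refine ⟨0, Submodule.zero_mem _, ?_, ?_⟩
    · rw [zero_mul]
      ext t
      by_cases ht : t < D.e
      · exact congrFun h1 (Sum.inl ⟨t, ht⟩)
      · exact mem_degreeLT_iff.mp hα t (by omega)
    · rw [zero_mul, neg_zero]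
      ext t
      by_cases ht : t < D.e
      · exact congrFun h1 (Sum.inr ⟨t, ht⟩)
      · exact mem_degreeLT_iff.mp hβ t (by omega)

theorem mem_degreeLT_of_mul {N n : ℕ} {G P : ℂ[X]} (hP : P ∈ degreeLT ℂ (n + 1))
    (hn : P.coeff n ≠ 0) (h : G * P ∈ degreeLT ℂ N) : G ∈ degreeLT ℂ (N - n) := by
  rcases eq_or_ne G 0 with rfl | hG
  · exact Submodule.zero_mem _
  have hGm : G ∈ degreeLT ℂ (G.natDegree + 1) := by
    rw [mem_degreeLT_iff]; intro t ht; exact coeff_eq_zero_of_natDegree_lt (by omega)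
  have h1 := coeff_mul_top hGm hP rfl
  have h2 : G.natDegree + n < N := by
    by_contra hle
    rw [mem_degreeLT_iff.mp h _ (by omega)] at h1
    exact mul_ne_zero (leadingCoeff_ne_zero.mpr hG) hn h1.symm
  rw [mem_degreeLT_iff]
  intro t ht
  exact coeff_eq_zero_of_natDegree_lt (by omega)

/-- In a Bézout relation for `H` the coefficient of `B` is reduced modulo `A`; the degree of the
other coefficient is then forced, because `A` has degree exactly `n`. -/
theorem exists_coprime_combination {e n : ℕ} (he : n ≤ e) {A B : ℂ[X]}
    (hA : A ∈ degreeLT ℂ (n + 1)) (hB : B ∈ degreeLT ℂ (n + 1)) (hco : IsCoprime A B)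
    (hn : A.coeff n ≠ 0) {H : ℂ[X]} (hH : H ∈ degreeLT ℂ (e + n)) :
    ∃ α ∈ degreeLT ℂ e, ∃ β ∈ degreeLT ℂ e, α * A + β * B = H := by
  obtain ⟨a, b, hab⟩ := hco
  have hA0 : A ≠ 0 := by rintro rfl; simp at hn
  have hdeg : A.natDegree = n := by
    refine le_antisymm ?_ (le_natDegree_of_ne_zero hn)
    rw [natDegree_le_iff_coeff_eq_zero]
    intro t ht
    exact mem_degreeLT_iff.mp hA t ht
  set β := (H * b) % A with hβ
  have hβm : β ∈ degreeLT ℂ n := by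
    rw [mem_degreeLT, ← hdeg, ← degree_eq_natDegree hA0]
    exact EuclideanDomain.mod_lt _ hA0
  set α := H * a + (H * b) / A * B with hα
  have hsum : α * A + β * B = H := by
    have := EuclideanDomain.div_add_mod (H * b) A
    rw [hα, hβ]
    linear_combination B * this + H * hab
  have hβB := mul_mem_degreeLT (degreeLT_mono' he hβm) hB
  have hαA : α * A ∈ degreeLT ℂ (e + n) := by
    have : α * A = H - β * B := by rw [← hsum]; ring
    rw [this]
    exact Submodule.sub_mem _ hH hβB
  have := mem_degreeLT_of_mul hA hn hαA
  rw [Nat.add_sub_cancel] at this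
  exact ⟨α, this, β, degreeLT_mono' he hβm, hsum⟩

/-- The hamiltonian part can be solved in high weight when `A` and `B` are coprime. -/
theorem hamiltonian_of_coprime (he : D.n ≤ D.e) (hco : IsCoprime D.A D.B)
    (hn : D.A.coeff D.n ≠ 0 ∨ D.B.coeff D.n ≠ 0) : D.Hamiltonian := by
  constructor
  · intro H hH
    rcases hn with hn | hn
    · obtain ⟨α, hα, β, hβ, h⟩ := exists_coprime_combination he D.A_mem D.B_mem hco hn hH
      exact ⟨α, hα, β, hβ, fun t _ => by rw [h, sub_self, coeff_zero]⟩
    · obtain ⟨α, hα, β, hβ, h⟩ := exists_coprime_combination he D.B_mem D.A_mem hco.symm hn hH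
      exact ⟨β, hβ, α, hα, fun t _ => by rw [add_comm, h, sub_self, coeff_zero]⟩
  · intro α hα β hβ hab
    -- Since `n ≤ e`, every index satisfies `t < e` or `n ≤ t`: the window for `h` is empty.
    have h0 : α * D.A + β * D.B = 0 := by
      ext t
      rw [hab t (by omega), coeff_zero]
    have hdvd : D.B ∣ α := by
      refine hco.symm.dvd_of_dvd_mul_right ⟨-β, ?_⟩
      linear_combination h0
    obtain ⟨G, hG⟩ := hdvd
    -- If `B = 0`, then `A` is a unit by coprimality, and `G` is read off from `β` instead of `α`.
    by_cases hB : D.B = 0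
    · obtain ⟨u, hu⟩ : ∃ u, D.A * u = 1 := by
        obtain ⟨a, b, hab⟩ := hco
        exact ⟨a, by rw [hB] at hab; linear_combination hab⟩
      refine ⟨-(β * u), ?_, ?_, ?_⟩
      · refine mem_degreeLT_of_mul D.A_mem (hn.resolve_right (by simp [hB])) ?_
        have : -(β * u) * D.A = -β := by linear_combination -β * hu
        rw [this]; exact Submodule.neg_mem _ hβ
      · rw [hB, mul_zero]; rw [hB, zero_mul] at hG; exact hG
      · linear_combination (-β) * hu
    · have hβG : β = -(G * D.A) := by
        apply mul_right_cancel₀ hB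
        rw [hG] at h0
        linear_combination h0
      refine ⟨G, ?_, by rw [hG, mul_comm], hβG⟩
      rcases hn with hn | hn
      · refine mem_degreeLT_of_mul D.A_mem hn ?_
        rw [← neg_neg (G * D.A), ← hβG]
        exact Submodule.neg_mem _ hβ
      · refine mem_degreeLT_of_mul D.B_mem hn ?_
        rw [mul_comm, ← hG]
        exact hα

end PolyData

end Polynomials

end QHFoliation

end

noncomputable section

namespace QHFoliation

open MvPowerSeries
open Polynomial (degreeLT)

/-! ### Quasi-homogeneous series in terms of polynomials in one variable -/

/-- The quasi-homogeneous polynomial `∑ P_s x ^ (I - ℓ s) y ^ (J + k s)`. -/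
def hom (k ℓ I J : ℕ) (P : Polynomial ℂ) : Series :=
  ∑ s ∈ Finset.range (I / ℓ + 1), C (P.coeff s) * (X 0 ^ (I - ℓ * s) * X 1 ^ (J + k * s))

/-- The weights `(k, ℓ)`. -/
def wts (k ℓ : ℕ) : Fin 2 → ℕ := ![k, ℓ]

theorem wts_zero (k ℓ : ℕ) : wts k ℓ 0 = k := rfl

theorem wts_one (k ℓ : ℕ) : wts k ℓ 1 = ℓ := rfl

theorem wts_pos {k ℓ : ℕ} (hk : 0 < k) (hℓ : 0 < ℓ) (i : Fin 2) : 0 < wts k ℓ i := by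
  fin_cases i
  · exact hk
  · exact hℓ

theorem mul_le_of_lt_div {ℓ I s : ℕ} (h : s < I / ℓ + 1) : ℓ * s ≤ I := by
  have h1 : ℓ * s ≤ ℓ * (I / ℓ) := Nat.mul_le_mul_left _ (by omega)
  exact h1.trans (Nat.mul_div_le I ℓ)

theorem hom_add (k ℓ I J : ℕ) (P Q : Polynomial ℂ) :
    hom k ℓ I J (P + Q) = hom k ℓ I J P + hom k ℓ I J Q := by
  simp only [hom, Polynomial.coeff_add, map_add, add_mul, Finset.sum_add_distrib]

theorem hom_zero (k ℓ I J : ℕ) : hom k ℓ I J 0 = 0 := by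
  simp [hom]

theorem hom_natCast_mul (k ℓ I J c : ℕ) (P : Polynomial ℂ) :
    hom k ℓ I J ((c : Polynomial ℂ) * P) = C (c : ℂ) * hom k ℓ I J P := by
  simp only [hom, Polynomial.coeff_natCast_mul, map_mul, Finset.mul_sum, mul_assoc]

theorem hom_neg (k ℓ I J : ℕ) (P : Polynomial ℂ) :
    hom k ℓ I J (-P) = -hom k ℓ I J P := by
  simp only [hom, Polynomial.coeff_neg, map_neg, neg_mul, Finset.sum_neg_distrib]

theorem hom_sub (k ℓ I J : ℕ) (P Q : Polynomial ℂ) :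
    hom k ℓ I J (P - Q) = hom k ℓ I J P - hom k ℓ I J Q := by
  rw [sub_eq_add_neg, hom_add, hom_neg, sub_eq_add_neg]

theorem monomial_expo (c : ℂ) (i j : ℕ) :
    (C c * (X 0 ^ i * X 1 ^ j) : Series) = monomial (expo i j) c := by
  rw [monomial_eq, expo_apply_zero, expo_apply_one]

theorem hom_eq_sum_monomial (k ℓ I J : ℕ) (P : Polynomial ℂ) :
    hom k ℓ I J P =
      ∑ s ∈ Finset.range (I / ℓ + 1), monomial (expo (I - ℓ * s) (J + k * s)) (P.coeff s) := by
  simp only [hom, monomial_expo]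

theorem eu_monomial (i : Fin 2) (e : Fin 2 →₀ ℕ) (c : ℂ) :
    eu i (monomial e c : Series) = monomial e (e i * c) := by
  classical
  ext f
  rw [coeff_eu, coeff_monomial, coeff_monomial]
  split_ifs with h
  · rw [h]
  · rw [mul_zero]

theorem eu_zero_hom (k ℓ I J : ℕ) (P : Polynomial ℂ) :
    eu 0 (hom k ℓ I J P) = hom k ℓ I J (polyE0 ℓ I P) := by
  rw [hom_eq_sum_monomial, hom_eq_sum_monomial, map_sum]
  refine Finset.sum_congr rfl fun s hs => ?_
  have := mul_le_of_lt_div (Finset.mem_range.mp hs)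
  rw [eu_monomial, coeff_polyE0, expo_apply_zero]
  push_cast [Nat.cast_sub this]
  rfl

theorem eu_one_hom (k ℓ I J : ℕ) (P : Polynomial ℂ) :
    eu 1 (hom k ℓ I J P) = hom k ℓ I J (polyE1 k J P) := by
  rw [hom_eq_sum_monomial, hom_eq_sum_monomial, map_sum]
  refine Finset.sum_congr rfl fun s _ => ?_
  rw [eu_monomial, coeff_polyE1, expo_apply_one]
  push_cast
  rfl

theorem hom_mem_wtIdeal (k ℓ I J : ℕ) (P : Polynomial ℂ) :
    hom k ℓ I J P ∈ wtIdeal (wts k ℓ) (k * I + ℓ * J) := by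
  rw [hom_eq_sum_monomial]
  refine Ideal.sum_mem _ fun s hs => monomial_mem_wtIdeal _ ?_ _
  have := mul_le_of_lt_div (Finset.mem_range.mp hs)
  rw [wt_expo, wts_zero, wts_one]
  obtain ⟨t, rfl⟩ := Nat.exists_eq_add_of_le this
  rw [Nat.add_sub_cancel_left]
  nlinarith

theorem expo_injective {i j i' j' : ℕ} (h : expo i j = expo i' j') : i = i' ∧ j = j' := by
  constructor
  · rw [← expo_apply_zero i j, h, expo_apply_zero]
  · rw [← expo_apply_one i j, h, expo_apply_one]

theorem coeff_hom {k ℓ I J : ℕ} (hk : 0 < k) (P : Polynomial ℂ) {s : ℕ} (hs : s < I / ℓ + 1) :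
    coeff (expo (I - ℓ * s) (J + k * s)) (hom k ℓ I J P) = P.coeff s := by
  classical
  rw [hom_eq_sum_monomial, map_sum, Finset.sum_eq_single s]
  · rw [coeff_monomial, if_pos rfl]
  · intro t _ hts
    rw [coeff_monomial, if_neg]
    intro h
    have := (expo_injective h).2
    apply hts
    have h2 : k * s = k * t := by omega
    exact (Nat.eq_of_mul_eq_mul_left hk h2).symm
  · intro h; exact absurd (Finset.mem_range.mpr hs) h

theorem coeff_hom_ne_zero {k ℓ I J : ℕ} {P : Polynomial ℂ} {e : Fin 2 →₀ ℕ}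
    (h : coeff e (hom k ℓ I J P) ≠ 0) :
    ∃ s < I / ℓ + 1, e = expo (I - ℓ * s) (J + k * s) ∧ P.coeff s ≠ 0 := by
  classical
  rw [hom_eq_sum_monomial, map_sum] at h
  obtain ⟨s, hs, hne⟩ := Finset.exists_ne_zero_of_sum_ne_zero h
  rw [coeff_monomial] at hne
  split_ifs at hne with h1
  · exact ⟨s, Finset.mem_range.mp hs, h1, hne⟩
  · exact absurd rfl hne

theorem eq_zero_of_hom_mem {k ℓ I J : ℕ} (hk : 0 < k) {P : Polynomial ℂ}
    (hP : P ∈ degreeLT ℂ (I / ℓ + 1))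
    (h : hom k ℓ I J P ∈ wtIdeal (wts k ℓ) (k * I + ℓ * J + 1)) : P = 0 := by
  ext s
  by_cases hs : s < I / ℓ + 1
  · rw [← coeff_hom hk P hs (J := J), Polynomial.coeff_zero]
    refine h _ ?_
    have := mul_le_of_lt_div hs
    rw [wt_expo, wts_zero, wts_one]
    obtain ⟨t, ht⟩ := Nat.exists_eq_add_of_le this
    rw [ht, Nat.add_sub_cancel_left]
    nlinarith
  · exact mem_degreeLT_iff.mp hP s (by omega)

/-- The degree bounds are essential: `hom` discards the coefficients of index above `I / ℓ`, for
which the exponent of `x` would be negative, and truncation is not multiplicative. -/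
theorem hom_mul {k ℓ I J I' J' : ℕ} {P Q : Polynomial ℂ}
    (hP : P ∈ degreeLT ℂ (I / ℓ + 1)) (hQ : Q ∈ degreeLT ℂ (I' / ℓ + 1)) :
    hom k ℓ I J P * hom k ℓ I' J' Q = hom k ℓ (I + I') (J + J') (P * Q) := by
  have key : ∀ {K L : ℕ} (R : Polynomial ℂ) {M : ℕ}, M ≤ K / ℓ + 1 → R ∈ degreeLT ℂ M →
      hom k ℓ K L R = ∑ s ∈ Finset.range M, C (R.coeff s) * (X 0 ^ (K - ℓ * s) * X 1 ^ (L + k * s)) := by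
    intro K L R M hM hR
    rw [hom]
    refine (Finset.sum_subset (Finset.range_mono hM) fun s _ hs => ?_).symm
    rw [mem_degreeLT_iff.mp hR s (by simpa using hs), map_zero, zero_mul]
  have hdiv : I / ℓ + 1 + I' / ℓ ≤ (I + I') / ℓ + 1 := by
    have : I / ℓ + I' / ℓ ≤ (I + I') / ℓ := Nat.div_add_div_le_add_div
    omega
  rw [key (P * Q) hdiv (mul_mem_degreeLT hP hQ), hom, hom, Finset.sum_mul_sum]
  have h1 : ∀ t ∈ Finset.range (I / ℓ + 1 + I' / ℓ),
      (C ((P * Q).coeff t) * (X 0 ^ (I + I' - ℓ * t) * X 1 ^ (J + J' + k * t)) : Series) =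
      ∑ x ∈ Finset.range (I / ℓ + 1) ×ˢ Finset.range (I' / ℓ + 1),
        if x.1 + x.2 = t then
          C (P.coeff x.1) * (X 0 ^ (I - ℓ * x.1) * X 1 ^ (J + k * x.1)) *
          (C (Q.coeff x.2) * (X 0 ^ (I' - ℓ * x.2) * X 1 ^ (J' + k * x.2))) else 0 := by
    intro t _
    rw [Polynomial.coeff_mul, map_sum, Finset.sum_mul, ← Finset.sum_filter]
    refine (Finset.sum_subset_zero_on_sdiff (s₁ := Finset.filter (fun x : ℕ × ℕ => x.1 + x.2 = t)
      (Finset.range (I / ℓ + 1) ×ˢ Finset.range (I' / ℓ + 1))) ?_ ?_ ?_).symm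
    · intro x hx
      exact Finset.HasAntidiagonal.mem_antidiagonal.mpr (Finset.mem_filter.mp hx).2
    · intro x hx
      have h2 := Finset.HasAntidiagonal.mem_antidiagonal.mp (Finset.mem_sdiff.mp hx).1
      have h3 := (Finset.mem_sdiff.mp hx).2
      simp only [Finset.mem_filter, Finset.mem_product, Finset.mem_range, h2, and_true, not_and_or]
        at h3
      rcases h3 with h3 | h3
      · rw [mem_degreeLT_iff.mp hP _ (by omega), zero_mul, map_zero, zero_mul]
      · rw [mem_degreeLT_iff.mp hQ _ (by omega), mul_zero, map_zero, zero_mul]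
    · intro x hx
      obtain ⟨h2, h3⟩ := Finset.mem_filter.mp hx
      rw [Finset.mem_product, Finset.mem_range, Finset.mem_range] at h2
      have h4 := mul_le_of_lt_div h2.1
      have h5 := mul_le_of_lt_div h2.2
      have e1 : I + I' - ℓ * t = (I - ℓ * x.1) + (I' - ℓ * x.2) := by
        rw [← h3, Nat.mul_add]; omega
      have e2 : J + J' + k * t = (J + k * x.1) + (J' + k * x.2) := by
        rw [← h3]; ring
      rw [e1, e2, pow_add, pow_add, map_mul]
      ring
  rw [Finset.sum_congr rfl h1]
  conv_rhs => rw [Finset.sum_comm, Finset.sum_product]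
  refine Finset.sum_congr rfl fun a ha => Finset.sum_congr rfl fun b hb => ?_
  rw [Finset.mem_range] at ha hb
  simp only
  rw [Finset.sum_ite_eq, if_pos]
  rw [Finset.mem_range]; omega

/-- The polynomial of the quasi-homogeneous part of lowest weight. -/
def dehom (k ℓ I J : ℕ) (f : Series) : Polynomial ℂ :=
  ∑ s ∈ Finset.range (I / ℓ + 1),
    Polynomial.monomial s (coeff (expo (I - ℓ * s) (J + k * s)) f)

theorem coeff_dehom {k ℓ I J : ℕ} {f : Series} {s : ℕ} (hs : s < I / ℓ + 1) :
    (dehom k ℓ I J f).coeff s = coeff (expo (I - ℓ * s) (J + k * s)) f := by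
  rw [dehom, Polynomial.finsetSum_coeff, Finset.sum_eq_single s]
  · rw [Polynomial.coeff_monomial, if_pos rfl]
  · intro t _ ht
    rw [Polynomial.coeff_monomial, if_neg ht]
  · intro h; exact absurd (Finset.mem_range.mpr hs) h

theorem dehom_mem (k ℓ I J : ℕ) (f : Series) : dehom k ℓ I J f ∈ degreeLT ℂ (I / ℓ + 1) := by
  refine Submodule.sum_mem _ fun s hs => ?_
  rw [mem_degreeLT_iff]
  intro t ht
  rw [Polynomial.coeff_monomial, if_neg]
  have := Finset.mem_range.mp hs
  omega

/-- Modulo `k` the weight determines the exponent of `y`. As `J < k` is the least representative,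
all monomials of a given weight arise from `(I, J)` by steps `(-ℓ, k)`. -/
theorem exists_of_weight_eq {k ℓ I J i j : ℕ} (hk : 0 < k) (hc : Nat.Coprime k ℓ)
    (hJ : J < k) (h : k * i + ℓ * j = k * I + ℓ * J) :
    ∃ s, ℓ * s ≤ I ∧ i = I - ℓ * s ∧ j = J + k * s := by
  have hmod : j ≡ J [MOD k] := by
    have h1 : ℓ * j ≡ ℓ * J [MOD k] := by
      have h2 : (k * i + ℓ * j) % k = (k * I + ℓ * J) % k := by rw [h]
      rwa [Nat.mul_add_mod, Nat.mul_add_mod] at h2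
    exact Nat.ModEq.cancel_left_of_coprime hc h1
  have hle : J ≤ j := by
    have h1 : j % k = J := by
      have := hmod
      rw [Nat.ModEq, Nat.mod_eq_of_lt hJ] at this
      exact this
    rw [← h1]; exact Nat.mod_le _ _
  obtain ⟨s, hs⟩ := (Nat.modEq_iff_dvd' hle).mp hmod.symm
  have hj : j = J + k * s := by omega
  subst hj
  have h2 : k * (i + ℓ * s) = k * I := by nlinarith
  have h3 := Nat.eq_of_mul_eq_mul_left hk h2
  exact ⟨s, by omega, by omega, rfl⟩

/-- The quasi-homogeneous part of lowest weight is recovered from its polynomial because the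
monomials listed by `hom` are all those of this weight. -/
theorem sub_hom_dehom_mem {k ℓ I J : ℕ} (hk : 0 < k) (hℓ : 0 < ℓ) (hc : Nat.Coprime k ℓ)
    (hJ : J < k) {f : Series} (hf : f ∈ wtIdeal (wts k ℓ) (k * I + ℓ * J)) :
    f - hom k ℓ I J (dehom k ℓ I J f) ∈ wtIdeal (wts k ℓ) (k * I + ℓ * J + 1) := by
  intro e he
  rw [map_sub]
  by_cases h : wt (wts k ℓ) e < k * I + ℓ * J
  · rw [hf e h, hom_mem_wtIdeal k ℓ I J _ e h, sub_zero]
  · have h1 : k * e 0 + ℓ * e 1 = k * I + ℓ * J := by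
      simp only [wt, wts_zero, wts_one] at he h
      omega
    obtain ⟨s, hs, h2, h3⟩ := exists_of_weight_eq hk hc hJ h1
    have hs' : s < I / ℓ + 1 := by
      rw [Nat.lt_succ_iff, Nat.le_div_iff_mul_le hℓ, mul_comm]
      exact hs
    rw [← expo_eta e, h2, h3, coeff_hom hk _ hs', coeff_dehom hs', sub_self]

/-! ### Transfer of the homological equation to power series. -/

/-- The relation between the data `D` of the homological equation and the exponents of the monomials
of weight `k ℓ n + m`. -/
structure Level (D : PolyData) where
  /-- the exponent of `x` in the monomial with the lowest power of `y` -/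
  I : ℕ
  /-- the lowest exponent of `y` -/
  J : ℕ
  J_lt : J < D.k
  weight : D.k * I + D.ℓ * J = D.k * D.ℓ * D.n + D.m
  hi : D.i = (I : ℂ) - D.ℓ * D.n
  hj : D.j = J
  he : D.e + D.n = I / D.ℓ + 1
  coprime : Nat.Coprime D.k D.ℓ

namespace Level

variable {D : PolyData} (L : Level D)

/-- The weights. -/
abbrev w (_ : Level D) : Fin 2 → ℕ := wts D.k D.ℓ

/-- The quasi-homogeneous polynomials of weight `m`. -/
def low (P : Polynomial ℂ) : Series := hom D.k D.ℓ (L.I - D.ℓ * D.n) L.J P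

/-- The quasi-homogeneous polynomials of weight `k ℓ n + m`. -/
def high (P : Polynomial ℂ) : Series := hom D.k D.ℓ L.I L.J P

/-- The first coefficient of the initial form. -/
def P (_ : Level D) : Series := hom D.k D.ℓ (D.ℓ * D.n) 0 D.p

/-- The second coefficient of the initial form. -/
def R (_ : Level D) : Series := hom D.k D.ℓ (D.ℓ * D.n) 0 D.r

theorem e_pos_iff : 0 < D.e ↔ D.ℓ * D.n ≤ L.I := by
  have h := L.he
  have h1 : D.n ≤ L.I / D.ℓ ↔ D.ℓ * D.n ≤ L.I := by
    rw [Nat.le_div_iff_mul_le D.ℓ_pos, mul_comm]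
  rw [← h1]; omega

theorem e_eq (h : D.ℓ * D.n ≤ L.I) : D.e = (L.I - D.ℓ * D.n) / D.ℓ + 1 := by
  have h1 := L.he
  rw [Nat.sub_mul_div]
  have h2 : D.n ≤ L.I / D.ℓ := by rw [Nat.le_div_iff_mul_le D.ℓ_pos, mul_comm]; exact h
  omega

/-- For `I < ℓ n` no monomial has weight `m`, and the truncated exponent `I - ℓ n` has no meaning;
all unknowns vanish in this case. -/
theorem eq_zero_of_e {P : Polynomial ℂ} (hP : P ∈ degreeLT ℂ D.e) (h : ¬ D.ℓ * D.n ≤ L.I) :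
    P = 0 := by
  have : D.e = 0 := by
    by_contra h0
    exact h (L.e_pos_iff.mp (Nat.pos_of_ne_zero h0))
  ext t
  rw [mem_degreeLT_iff.mp hP t (by omega), Polynomial.coeff_zero]

theorem low_weight (h : D.ℓ * D.n ≤ L.I) : D.k * (L.I - D.ℓ * D.n) + D.ℓ * L.J = D.m := by
  have := L.weight
  obtain ⟨t, ht⟩ := Nat.exists_eq_add_of_le h
  rw [ht] at this ⊢
  rw [Nat.add_sub_cancel_left]
  nlinarith

theorem low_mem {P : Polynomial ℂ} (hP : P ∈ degreeLT ℂ D.e) : L.low P ∈ wtIdeal L.w D.m := by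
  by_cases h : D.ℓ * D.n ≤ L.I
  · rw [← L.low_weight h]; exact hom_mem_wtIdeal _ _ _ _ _
  · rw [L.eq_zero_of_e hP h, low, hom_zero]; exact Ideal.zero_mem _

theorem high_mem (P : Polynomial ℂ) : L.high P ∈ wtIdeal L.w (D.k * D.ℓ * D.n + D.m) := by
  rw [← L.weight]; exact hom_mem_wtIdeal _ _ _ _ _

theorem P_mem : L.P ∈ wtIdeal L.w (D.k * D.ℓ * D.n) := by
  have := hom_mem_wtIdeal D.k D.ℓ (D.ℓ * D.n) 0 D.p
  rwa [mul_zero, add_zero, ← mul_assoc] at this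

theorem R_mem : L.R ∈ wtIdeal L.w (D.k * D.ℓ * D.n) := by
  have := hom_mem_wtIdeal D.k D.ℓ (D.ℓ * D.n) 0 D.r
  rwa [mul_zero, add_zero, ← mul_assoc] at this

theorem low_mul {α q : Polynomial ℂ} (hα : α ∈ degreeLT ℂ D.e) (hq : q ∈ degreeLT ℂ (D.n + 1)) :
    L.low α * hom D.k D.ℓ (D.ℓ * D.n) 0 q = L.high (α * q) := by
  by_cases h : D.ℓ * D.n ≤ L.I
  · rw [low, hom_mul (by rwa [← L.e_eq h])
      (by rwa [Nat.mul_div_cancel_left _ D.ℓ_pos]), Nat.sub_add_cancel h, high, add_zero]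
  · rw [L.eq_zero_of_e hα h, low, hom_zero, zero_mul, zero_mul, high, hom_zero]

theorem eu_zero_low {α : Polynomial ℂ} (hα : α ∈ degreeLT ℂ D.e) :
    eu 0 (L.low α) = L.low (polyE0 D.ℓ D.i α) := by
  by_cases h : D.ℓ * D.n ≤ L.I
  · rw [low, low, eu_zero_hom, L.hi, Nat.cast_sub h]; push_cast; rfl
  · rw [L.eq_zero_of_e hα h, low, low, hom_zero]; simp [polyE0, hom_zero]

theorem eu_one_low (α : Polynomial ℂ) : eu 1 (L.low α) = L.low (polyE1 D.k D.j α) := by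
  rw [low, low, eu_one_hom, L.hj]

theorem exists_low {f : Series} (hf : f ∈ wtIdeal L.w D.m) :
    ∃ α ∈ degreeLT ℂ D.e, f - L.low α ∈ wtIdeal L.w (D.m + 1) := by
  by_cases h : D.ℓ * D.n ≤ L.I
  · refine ⟨dehom D.k D.ℓ (L.I - D.ℓ * D.n) L.J f, ?_, ?_⟩
    · rw [L.e_eq h]; exact dehom_mem _ _ _ _ _
    · have := sub_hom_dehom_mem (I := L.I - D.ℓ * D.n) (f := f) D.k_pos D.ℓ_pos L.coprime L.J_lt
        (by rwa [L.low_weight h])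
      rwa [L.low_weight h] at this
  -- A monomial of weight `m`, multiplied by `x ^ (ℓ n)`, would have weight `k ℓ n + m` and an
  -- exponent of `x` above the maximal one, `I`.
  · refine ⟨0, Submodule.zero_mem _, ?_⟩
    rw [low, hom_zero, sub_zero]
    intro e he
    by_cases h1 : wt L.w e < D.m
    · exact hf e h1
    · exfalso
      have h2 : D.k * e 0 + D.ℓ * e 1 = D.m := by
        simp only [wt, wts_zero, wts_one] at he h1
        omega
      have h3 : D.k * (e 0 + D.ℓ * D.n) + D.ℓ * e 1 = D.k * L.I + D.ℓ * L.J := by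
        rw [L.weight, ← h2]; ring
      obtain ⟨s, _, h4, _⟩ := exists_of_weight_eq D.k_pos L.coprime L.J_lt h3
      omega

/-- The first component of `L_ξ ω + v ω` on series, in logarithmic form. -/
def lie0 (p r a b v : Series) : Series :=
  a * eu 0 p + b * (p + eu 1 p) + p * (a + eu 0 a) + r * eu 0 b + v * p

/-- The second component of `L_ξ ω + v ω` on series, in logarithmic form. -/
def lie1 (p r a b v : Series) : Series :=
  b * eu 1 r + a * (r + eu 0 r) + r * (b + eu 1 b) + p * eu 1 a + v * r

/-- The first component of `d(xyh) + s (ℓ y dx - k x dy)`, in logarithmic form. -/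
def nf0 (ℓ : ℕ) (h s : Series) : Series := h + eu 0 h + C (ℓ : ℂ) * s

/-- The second component of `d(xyh) + s (ℓ y dx - k x dy)`, in logarithmic form. -/
def nf1 (k : ℕ) (h s : Series) : Series := h + eu 1 h - C (k : ℂ) * s

theorem lie0_low {α β v : Polynomial ℂ} (hα : α ∈ degreeLT ℂ D.e) (hβ : β ∈ degreeLT ℂ D.e)
    (hv : v ∈ degreeLT ℂ D.e) :
    lie0 L.P L.R (L.low α) (L.low β) (L.low v) = L.high (D.lie0 α β v) := by
  have e0 : eu 0 L.P = hom D.k D.ℓ (D.ℓ * D.n) 0 (polyE0 D.ℓ (D.ℓ * D.n) D.p) := by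
    rw [P, eu_zero_hom]; push_cast; rfl
  have e1 : L.P + eu 1 L.P = hom D.k D.ℓ (D.ℓ * D.n) 0 (D.p + polyE1 D.k 0 D.p) := by
    rw [P, eu_one_hom, hom_add]; push_cast; rfl
  have e2 : L.low α + eu 0 (L.low α) = L.low (α + polyE0 D.ℓ D.i α) := by
    rw [L.eu_zero_low hα, low, low, low, hom_add]
  rw [lie0, e0, e1, e2, L.eu_zero_low hβ, mul_comm L.P, mul_comm L.R, P, R,
    L.low_mul hα (polyE0_mem D.p_mem),
    L.low_mul hβ (Submodule.add_mem _ D.p_mem (polyE1_mem D.p_mem)),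
    L.low_mul (Submodule.add_mem _ hα (polyE0_mem hα)) D.p_mem,
    L.low_mul (polyE0_mem hβ) D.r_mem, L.low_mul hv D.p_mem]
  simp only [high, PolyData.lie0, hom_add, mul_comm D.p, mul_comm D.r]

theorem lie1_low {α β v : Polynomial ℂ} (hα : α ∈ degreeLT ℂ D.e) (hβ : β ∈ degreeLT ℂ D.e)
    (hv : v ∈ degreeLT ℂ D.e) :
    lie1 L.P L.R (L.low α) (L.low β) (L.low v) = L.high (D.lie1 α β v) := by
  have e0 : eu 1 L.R = hom D.k D.ℓ (D.ℓ * D.n) 0 (polyE1 D.k 0 D.r) := by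
    rw [R, eu_one_hom]; push_cast; rfl
  have e1 : L.R + eu 0 L.R = hom D.k D.ℓ (D.ℓ * D.n) 0 (D.r + polyE0 D.ℓ (D.ℓ * D.n) D.r) := by
    rw [R, eu_zero_hom, hom_add]; push_cast; rfl
  have e2 : L.low β + eu 1 (L.low β) = L.low (β + polyE1 D.k D.j β) := by
    rw [L.eu_one_low, low, low, low, hom_add]
  rw [lie1, e0, e1, e2, L.eu_one_low, mul_comm L.P, mul_comm L.R, P, R,
    L.low_mul hβ (polyE1_mem D.r_mem),
    L.low_mul hα (Submodule.add_mem _ D.r_mem (polyE0_mem D.r_mem)),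
    L.low_mul (Submodule.add_mem _ hβ (polyE1_mem hβ)) D.r_mem,
    L.low_mul (polyE1_mem hα) D.p_mem, L.low_mul hv D.r_mem]
  simp only [high, PolyData.lie1, hom_add, mul_comm D.p, mul_comm D.r]

theorem nf0_high (h s : Polynomial ℂ) :
    nf0 D.ℓ (L.high h) (L.high s) = L.high (D.nf0 h s) := by
  simp only [nf0, PolyData.nf0, high, eu_zero_hom, hom_add, hom_natCast_mul, L.hi, sub_add_cancel]

theorem nf1_high (h s : Polynomial ℂ) :
    nf1 D.k (L.high h) (L.high s) = L.high (D.nf1 h s) := by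
  simp only [nf1, PolyData.nf1, high, eu_one_hom, hom_add, hom_sub, hom_natCast_mul, L.hj]

theorem lie0_mem {w : Fin 2 → ℕ} {N m : ℕ} {p r a b v : Series} (hp : p ∈ wtIdeal w N)
    (hr : r ∈ wtIdeal w N) (ha : a ∈ wtIdeal w m) (hb : b ∈ wtIdeal w m) (hv : v ∈ wtIdeal w m) :
    lie0 p r a b v ∈ wtIdeal w (N + m) := by
  rw [lie0, add_comm N]
  refine Ideal.add_mem _ (Ideal.add_mem _ (Ideal.add_mem _ (Ideal.add_mem _ ?_ ?_) ?_) ?_) ?_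
  · exact mul_mem_wtIdeal ha (eu_mem_wtIdeal hp 0)
  · exact mul_mem_wtIdeal hb (Ideal.add_mem _ hp (eu_mem_wtIdeal hp 1))
  · rw [mul_comm]; exact mul_mem_wtIdeal (Ideal.add_mem _ ha (eu_mem_wtIdeal ha 0)) hp
  · rw [mul_comm]; exact mul_mem_wtIdeal (eu_mem_wtIdeal hb 0) hr
  · exact mul_mem_wtIdeal hv hp

theorem lie1_mem {w : Fin 2 → ℕ} {N m : ℕ} {p r a b v : Series} (hp : p ∈ wtIdeal w N)
    (hr : r ∈ wtIdeal w N) (ha : a ∈ wtIdeal w m) (hb : b ∈ wtIdeal w m) (hv : v ∈ wtIdeal w m) :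
    lie1 p r a b v ∈ wtIdeal w (N + m) := by
  rw [lie1, add_comm N]
  refine Ideal.add_mem _ (Ideal.add_mem _ (Ideal.add_mem _ (Ideal.add_mem _ ?_ ?_) ?_) ?_) ?_
  · exact mul_mem_wtIdeal hb (eu_mem_wtIdeal hr 1)
  · exact mul_mem_wtIdeal ha (Ideal.add_mem _ hr (eu_mem_wtIdeal hr 0))
  · rw [mul_comm]; exact mul_mem_wtIdeal (Ideal.add_mem _ hb (eu_mem_wtIdeal hb 1)) hr
  · rw [mul_comm]; exact mul_mem_wtIdeal (eu_mem_wtIdeal ha 1) hp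
  · exact mul_mem_wtIdeal hv hr

theorem lie0_sub (p r a b v a' b' v' : Series) :
    lie0 p r (a - a') (b - b') (v - v') = lie0 p r a b v - lie0 p r a' b' v' := by
  simp only [lie0, map_sub]; ring

theorem lie1_sub (p r a b v a' b' v' : Series) :
    lie1 p r (a - a') (b - b') (v - v') = lie1 p r a b v - lie1 p r a' b' v' := by
  simp only [lie1, map_sub]; ring

theorem nf0_mem {w : Fin 2 → ℕ} {N ℓ : ℕ} {h s : Series} (hh : h ∈ wtIdeal w N)
    (hs : s ∈ wtIdeal w N) : nf0 ℓ h s ∈ wtIdeal w N :=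
  Ideal.add_mem _ (Ideal.add_mem _ hh (eu_mem_wtIdeal hh 0)) (Ideal.mul_mem_left _ _ hs)

theorem nf1_mem {w : Fin 2 → ℕ} {N k : ℕ} {h s : Series} (hh : h ∈ wtIdeal w N)
    (hs : s ∈ wtIdeal w N) : nf1 k h s ∈ wtIdeal w N :=
  Ideal.sub_mem _ (Ideal.add_mem _ hh (eu_mem_wtIdeal hh 1)) (Ideal.mul_mem_left _ _ hs)

theorem nf0_sub (ℓ : ℕ) (h s h' s' : Series) :
    nf0 ℓ (h - h') (s - s') = nf0 ℓ h s - nf0 ℓ h' s' := by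
  simp only [nf0, map_sub]; ring

theorem nf1_sub (k : ℕ) (h s h' s' : Series) :
    nf1 k (h - h') (s - s') = nf1 k h s - nf1 k h' s' := by
  simp only [nf1, map_sub]; ring

/-- The homological equation can be solved in each weight. -/
theorem exists_step (hH : D.Hamiltonian) (hR : D.Radial) {T₀ T₁ : Series}
    (h₀ : T₀ ∈ wtIdeal L.w (D.k * D.ℓ * D.n + D.m))
    (h₁ : T₁ ∈ wtIdeal L.w (D.k * D.ℓ * D.n + D.m)) :
    ∃ a ∈ wtIdeal L.w D.m, ∃ b ∈ wtIdeal L.w D.m, ∃ v ∈ wtIdeal L.w D.m,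
    ∃ h ∈ wtIdeal L.w (D.k * D.ℓ * D.n + D.m), ∃ s ∈ wtIdeal L.w (D.k * D.ℓ * D.n + D.m),
      (∀ e, coeff e h ≠ 0 → e 0 < D.ℓ * D.n ∧ e 1 < D.k * D.n) ∧
      (∀ e, coeff e s ≠ 0 → e 1 < D.k * D.n) ∧
      lie0 L.P L.R a b v + T₀ - nf0 D.ℓ h s ∈ wtIdeal L.w (D.k * D.ℓ * D.n + D.m + 1) ∧
      lie1 L.P L.R a b v + T₁ - nf1 D.k h s ∈ wtIdeal L.w (D.k * D.ℓ * D.n + D.m + 1) := by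
  have hd : ∀ T, dehom D.k D.ℓ L.I L.J T ∈ degreeLT ℂ (D.e + D.n) := fun T => by
    rw [L.he]; exact dehom_mem _ _ _ _ _
  have hs' : ∀ {T}, T ∈ wtIdeal L.w (D.k * D.ℓ * D.n + D.m) →
      T - L.high (dehom D.k D.ℓ L.I L.J T) ∈ wtIdeal L.w (D.k * D.ℓ * D.n + D.m + 1) := by
    intro T hT
    rw [← L.weight] at hT ⊢
    exact sub_hom_dehom_mem D.k_pos D.ℓ_pos L.coprime L.J_lt hT
  obtain ⟨α, hα, β, hβ, v, hv, h, hh, s, hs, hht, e0, e1⟩ :=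
    D.exists_homological hH hR (hd T₀) (hd T₁)
  have hlt : ∀ {t}, t < D.n → L.J + D.k * t < D.k * D.n := by
    intro t ht
    have h1 : D.k * (t + 1) ≤ D.k * D.n := Nat.mul_le_mul_left _ ht
    have h2 := L.J_lt
    rw [Nat.mul_succ] at h1
    omega
  refine ⟨L.low α, L.low_mem hα, L.low β, L.low_mem hβ, L.low v, L.low_mem hv,
    L.high h, L.high_mem h, L.high s, L.high_mem s, ?_, ?_, ?_, ?_⟩
  · intro e he
    obtain ⟨t, ht, rfl, hne⟩ := coeff_hom_ne_zero he
    rw [expo_apply_zero, expo_apply_one]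
    -- The window `e ≤ t < n` is the rectangle of the normal form: `t < n` bounds the exponent of
    -- `y` since `J < k`, and `e ≤ t` bounds that of `x` since `I < ℓ (e + n)`.
    have h1 : ¬ (t < D.e ∨ D.n ≤ t) := fun hc => hne (hht t hc)
    push Not at h1
    refine ⟨?_, hlt h1.2⟩
    have h2 : L.I < D.ℓ * (L.I / D.ℓ + 1) := by
      have := Nat.lt_mul_div_succ L.I D.ℓ_pos
      exact this
    rw [← L.he] at h2
    have h3 : D.ℓ * D.e ≤ D.ℓ * t := Nat.mul_le_mul_left _ h1.1
    have h4 := mul_le_of_lt_div ht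
    rw [Nat.mul_add] at h2
    omega
  · intro e he
    obtain ⟨t, ht, rfl, hne⟩ := coeff_hom_ne_zero he
    rw [expo_apply_one]
    refine hlt ?_
    by_contra hc
    exact hne (mem_degreeLT_iff.mp hs t (by omega))
  · rw [L.lie0_low hα hβ hv, L.nf0_high, ← e0, high, high, hom_add]
    have := hs' h₀
    rw [high] at this
    convert this using 1
    ring
  · rw [L.lie1_low hα hβ hv, L.nf1_high, ← e1, high, high, hom_add]
    have := hs' h₁
    rw [high] at this
    convert this using 1
    ring

/-- Uniqueness in the homological equation in a given weight. -/
theorem unique_step (hH : D.Hamiltonian) (hR : D.Radial) {a b v h s : Series}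
    (ha : a ∈ wtIdeal L.w D.m) (hb : b ∈ wtIdeal L.w D.m) (hv : v ∈ wtIdeal L.w D.m)
    (hh : h ∈ wtIdeal L.w (D.k * D.ℓ * D.n + D.m))
    (hs : s ∈ wtIdeal L.w (D.k * D.ℓ * D.n + D.m))
    (hh' : ∀ e, coeff e h ≠ 0 → e 0 < D.ℓ * D.n ∧ e 1 < D.k * D.n)
    (hs' : ∀ e, coeff e s ≠ 0 → e 1 < D.k * D.n)
    (h0 : lie0 L.P L.R a b v - nf0 D.ℓ h s ∈ wtIdeal L.w (D.k * D.ℓ * D.n + D.m + 1))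
    (h1 : lie1 L.P L.R a b v - nf1 D.k h s ∈ wtIdeal L.w (D.k * D.ℓ * D.n + D.m + 1)) :
    h ∈ wtIdeal L.w (D.k * D.ℓ * D.n + D.m + 1) ∧ s ∈ wtIdeal L.w (D.k * D.ℓ * D.n + D.m + 1) ∧
    ∃ g : Series, (g = 0 ∨ ∃ M, M + D.k * D.ℓ * D.n = D.m ∧ g ∈ wtIdeal L.w M) ∧
      a - g * L.R ∈ wtIdeal L.w (D.m + 1) ∧ b + g * L.P ∈ wtIdeal L.w (D.m + 1) := by
  obtain ⟨α, hα, ha'⟩ := L.exists_low ha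
  obtain ⟨β, hβ, hb'⟩ := L.exists_low hb
  obtain ⟨V, hV, hv'⟩ := L.exists_low hv
  set η := dehom D.k D.ℓ L.I L.J h with hη
  set ζ := dehom D.k D.ℓ L.I L.J s with hζ
  have hsub : ∀ {T}, T ∈ wtIdeal L.w (D.k * D.ℓ * D.n + D.m) →
      T - L.high (dehom D.k D.ℓ L.I L.J T) ∈ wtIdeal L.w (D.k * D.ℓ * D.n + D.m + 1) := by
    intro T hT
    rw [← L.weight] at hT ⊢
    exact sub_hom_dehom_mem D.k_pos D.ℓ_pos L.coprime L.J_lt hT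
  have hd : ∀ T, dehom D.k D.ℓ L.I L.J T ∈ degreeLT ℂ (D.e + D.n) := fun T => by
    rw [L.he]; exact dehom_mem _ _ _ _ _
  have hcoef : ∀ t, t < D.e ∨ D.n ≤ t → η.coeff t = 0 := by
    intro t ht
    by_cases h2 : t < L.I / D.ℓ + 1
    · rw [hη, coeff_dehom h2]
      by_contra hne
      have h3 := hh' _ hne
      rw [expo_apply_zero, expo_apply_one] at h3
      rcases ht with ht | ht
      · have h4 : D.ℓ * (D.n + t) ≤ L.I := by
          have h5 : D.n + t < L.I / D.ℓ + 1 := by rw [← L.he]; omega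
          exact mul_le_of_lt_div h5
        rw [Nat.mul_add] at h4
        omega
      · have : D.k * D.n ≤ D.k * t := Nat.mul_le_mul_left _ ht
        omega
    · exact mem_degreeLT_iff.mp (dehom_mem _ _ _ _ _) t (by omega)
  have hζm : ζ ∈ degreeLT ℂ D.n := by
    rw [mem_degreeLT_iff]
    intro t ht
    by_cases h2 : t < L.I / D.ℓ + 1
    · rw [hζ, coeff_dehom h2]
      by_contra hne
      have h3 := hs' _ hne
      rw [expo_apply_one] at h3
      have : D.k * D.n ≤ D.k * t := Nat.mul_le_mul_left _ ht
      omega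
    · exact mem_degreeLT_iff.mp (dehom_mem _ _ _ _ _) t (by omega)
  have hP : ∀ {Q : Polynomial ℂ}, Q ∈ degreeLT ℂ (D.e + D.n) →
      L.high Q ∈ wtIdeal L.w (D.k * D.ℓ * D.n + D.m + 1) → Q = 0 := by
    intro Q hQ hm
    rw [L.he] at hQ
    rw [← L.weight] at hm
    exact eq_zero_of_hom_mem D.k_pos hQ hm
  have hnfmem0 : D.nf0 η ζ ∈ degreeLT ℂ (D.e + D.n) := by
    rw [PolyData.nf0, ← Polynomial.C_eq_natCast]
    exact Submodule.add_mem _ (Submodule.add_mem _ (hd h) (polyE0_mem (hd h)))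
      (C_mul_mem_degreeLT _ (hd s))
  have hnfmem1 : D.nf1 η ζ ∈ degreeLT ℂ (D.e + D.n) := by
    rw [PolyData.nf1, ← Polynomial.C_eq_natCast]
    exact Submodule.sub_mem _ (Submodule.add_mem _ (hd h) (polyE1_mem (hd h)))
      (C_mul_mem_degreeLT _ (hd s))
  -- Replacing every series by its lowest part changes both sides only in higher weight, and `hom`
  -- is injective on polynomials of bounded degree.
  have e0 : D.lie0 α β V = D.nf0 η ζ := by
    rw [← sub_eq_zero]
    refine hP (Submodule.sub_mem _ (D.lie0_mem hα hβ hV) hnfmem0) ?_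
    have h2 := lie0_mem L.P_mem L.R_mem ha' hb' hv'
    have h3 := nf0_mem (ℓ := D.ℓ) (hsub hh) (hsub hs)
    rw [lie0_sub, L.lie0_low hα hβ hV] at h2
    rw [nf0_sub, L.nf0_high] at h3
    have h4 := Ideal.add_mem _ (Ideal.sub_mem _ h0 h2) h3
    rw [high, hom_sub]
    convert h4 using 1
    rw [high, high]
    ring
  have e1 : D.lie1 α β V = D.nf1 η ζ := by
    rw [← sub_eq_zero]
    refine hP (Submodule.sub_mem _ ?_ hnfmem1) ?_
    · rw [PolyData.lie1, mul_comm D.p, mul_comm D.r]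
      refine Submodule.add_mem _ (Submodule.add_mem _ (Submodule.add_mem _ (Submodule.add_mem _
        ?_ ?_) ?_) ?_) ?_
      · exact mul_mem_degreeLT hβ (polyE1_mem D.r_mem)
      · exact mul_mem_degreeLT hα (Submodule.add_mem _ D.r_mem (polyE0_mem D.r_mem))
      · exact mul_mem_degreeLT (Submodule.add_mem _ hβ (polyE1_mem hβ)) D.r_mem
      · exact mul_mem_degreeLT (polyE1_mem hα) D.p_mem
      · exact mul_mem_degreeLT hV D.r_mem
    have h2 := lie1_mem L.P_mem L.R_mem ha' hb' hv'
    have h3 := nf1_mem (k := D.k) (hsub hh) (hsub hs)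
    rw [lie1_sub, L.lie1_low hα hβ hV] at h2
    rw [nf1_sub, L.nf1_high] at h3
    have h4 := Ideal.add_mem _ (Ideal.sub_mem _ h1 h2) h3
    rw [high, hom_sub]
    convert h4 using 1
    rw [high, high]
    ring
  obtain ⟨hη0, hζ0, G, hG, hGα, hGβ, _⟩ := D.unique_homological hH hR hα hβ hV hζm hcoef e0 e1
  -- The factor `G`, of degree less than `e - n`, represents a function of weight `m - k ℓ n`, whose
  -- highest power of `x` is `I - 2 ℓ n`. If this is negative, then `e ≤ n` and `G = 0`.
  refine ⟨?_, ?_, hom D.k D.ℓ (L.I - D.ℓ * D.n - D.ℓ * D.n) L.J G, ?_, ?_⟩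
  · have := hsub hh
    rwa [← hη, hη0, high, hom_zero, sub_zero] at this
  · have := hsub hs
    rwa [← hζ, hζ0, high, hom_zero, sub_zero] at this
  · by_cases hle : D.ℓ * D.n + D.ℓ * D.n ≤ L.I
    · right
      refine ⟨D.k * (L.I - D.ℓ * D.n - D.ℓ * D.n) + D.ℓ * L.J, ?_, hom_mem_wtIdeal _ _ _ _ _⟩
      rw [← L.low_weight (by omega)]
      obtain ⟨t, ht⟩ := Nat.exists_eq_add_of_le hle
      rw [show L.I - D.ℓ * D.n - D.ℓ * D.n = t by omega,
        show L.I - D.ℓ * D.n = D.ℓ * D.n + t by omega]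
      ring
    · left
      have : D.e ≤ D.n := by
        by_contra hc
        have h5 : D.n + D.n < L.I / D.ℓ + 1 := by rw [← L.he]; omega
        have := mul_le_of_lt_div h5
        rw [Nat.mul_add] at this
        exact hle this
      rw [Nat.sub_eq_zero_of_le this] at hG
      have : G = 0 := by
        ext t; rw [mem_degreeLT_iff.mp hG t (Nat.zero_le _), Polynomial.coeff_zero]
      rw [this, hom_zero]
  · have hmul : ∀ {Q : Polynomial ℂ}, Q ∈ degreeLT ℂ (D.n + 1) →
        hom D.k D.ℓ (L.I - D.ℓ * D.n - D.ℓ * D.n) L.J G * hom D.k D.ℓ (D.ℓ * D.n) 0 Q =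
        L.low (G * Q) := by
      intro Q hQ
      by_cases hlt : D.n < D.e
      · have h5 : D.n + D.n < L.I / D.ℓ + 1 := by rw [← L.he]; omega
        have h6 := mul_le_of_lt_div h5
        rw [Nat.mul_add] at h6
        rw [hom_mul _ (by rwa [Nat.mul_div_cancel_left _ D.ℓ_pos]), add_zero,
          Nat.sub_add_cancel (by omega), low]
        rw [Nat.sub_mul_div, Nat.sub_mul_div]
        have : L.I / D.ℓ - D.n - D.n + 1 = D.e - D.n := by
          have := L.he
          omega
        rwa [this]
      · have : G = 0 := by
          rw [Nat.sub_eq_zero_of_le (by omega)] at hG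
          ext t; rw [mem_degreeLT_iff.mp hG t (Nat.zero_le _), Polynomial.coeff_zero]
        rw [this, hom_zero, zero_mul, zero_mul, low, hom_zero]
    constructor
    · rw [R, hmul D.r_mem, ← hGα]; exact ha'
    · rw [P, hmul D.p_mem]
      rw [hGβ, low, hom_neg, sub_neg_eq_add] at hb'
      exact hb'

end Level

end QHFoliation

end

noncomputable section

namespace QHFoliation

open MvPowerSeries

/-! ### Truncated exponentials -/

section Exponential

variable {A B M : Type*} [AddCommGroup A] [Module ℂ A] [AddCommGroup B] [Module ℂ B]
  [AddCommGroup M] [Module ℂ M]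

/-- The truncated exponential of an endomorphism. -/
def expTrunc (K : ℕ) (T : Module.End ℂ A) : Module.End ℂ A :=
  ∑ j ∈ Finset.range K, ((j.factorial : ℂ)⁻¹) • T ^ j

theorem expTrunc_apply (K : ℕ) (T : Module.End ℂ A) (x : A) :
    expTrunc K T x = ∑ j ∈ Finset.range K, ((j.factorial : ℂ)⁻¹) • (T ^ j) x := by
  simp [expTrunc, LinearMap.sum_apply]

theorem pow_leibniz (β : A →ₗ[ℂ] B →ₗ[ℂ] M) {S : Module.End ℂ A} {T : Module.End ℂ B}
    {R : Module.End ℂ M} (h : ∀ x y, R (β x y) = β (S x) y + β x (T y)) (x : A) (y : B) (n : ℕ) :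
    (R ^ n) (β x y) = ∑ ij ∈ Finset.HasAntidiagonal.antidiagonal n,
      n.choose ij.1 • β ((S ^ ij.1) x) ((T ^ ij.2) y) := by
  induction n with
  | zero => simp
  | succ n ih =>
    rw [Finset.sum_antidiagonal_choose_succ_nsmul
      (fun i j => β ((S ^ i) x) ((T ^ j) y)), pow_succ', Module.End.mul_apply, ih, map_sum,
      ← Finset.sum_add_distrib]
    refine Finset.sum_congr rfl fun ij hij => ?_
    have h1 : n.choose ij.2 = n.choose ij.1 := by
      have := Finset.HasAntidiagonal.mem_antidiagonal.mp hij
      rw [← this]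
      exact (Nat.choose_symm_add).symm
    rw [map_nsmul, h, h1, pow_succ', pow_succ', Module.End.mul_apply, Module.End.mul_apply,
      nsmul_add, add_comm]

/-- The exponential of a derivation is multiplicative. The truncated one fails to be so only by the
terms with `i, j < K ≤ i + j`, which are assumed to lie in `W`. -/
theorem expTrunc_leibniz (β : A →ₗ[ℂ] B →ₗ[ℂ] M) {S : Module.End ℂ A} {T : Module.End ℂ B}
    {R : Module.End ℂ M} (h : ∀ x y, R (β x y) = β (S x) y + β x (T y)) (K : ℕ) (x : A) (y : B)
    (W : Submodule ℂ M) (hW : ∀ i j, K ≤ i + j → β ((S ^ i) x) ((T ^ j) y) ∈ W) :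
    β (expTrunc K S x) (expTrunc K T y) - expTrunc K R (β x y) ∈ W := by
  have h1 : β (expTrunc K S x) (expTrunc K T y) =
      ∑ p ∈ Finset.range K ×ˢ Finset.range K,
        ((p.1.factorial : ℂ)⁻¹ * (p.2.factorial : ℂ)⁻¹) • β ((S ^ p.1) x) ((T ^ p.2) y) := by
    rw [expTrunc_apply, expTrunc_apply, map_sum, Finset.sum_product_right]
    refine Finset.sum_congr rfl fun i _ => ?_
    rw [map_sum, LinearMap.sum_apply]
    refine Finset.sum_congr rfl fun j _ => ?_
    rw [map_smul, map_smul, LinearMap.smul_apply, smul_smul, mul_comm]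
  have h2 : expTrunc K R (β x y) =
      ∑ p ∈ (Finset.range K ×ˢ Finset.range K).filter (fun p => p.1 + p.2 < K),
        ((p.1.factorial : ℂ)⁻¹ * (p.2.factorial : ℂ)⁻¹) • β ((S ^ p.1) x) ((T ^ p.2) y) := by
    rw [expTrunc_apply]
    have h3 : ∀ n ∈ Finset.range K, ((n.factorial : ℂ)⁻¹) • (R ^ n) (β x y) =
        ∑ p ∈ (((Finset.range K ×ˢ Finset.range K).filter (fun p => p.1 + p.2 < K)).filter
          (fun p => p.1 + p.2 = n)),
        ((p.1.factorial : ℂ)⁻¹ * (p.2.factorial : ℂ)⁻¹) • β ((S ^ p.1) x) ((T ^ p.2) y) := by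
      intro n hn
      have hn' := Finset.mem_range.mp hn
      rw [pow_leibniz β h, Finset.smul_sum]
      refine Finset.sum_congr ?_ ?_
      · ext p
        rw [Finset.HasAntidiagonal.mem_antidiagonal]
        simp only [Finset.mem_filter, Finset.mem_product, Finset.mem_range]
        omega
      · intro p hp
        have hp' : p.1 + p.2 = n := (Finset.mem_filter.mp hp).2
        rw [← Nat.cast_smul_eq_nsmul ℂ, smul_smul]
        congr 1
        rw [← hp']
        have h4 := Nat.add_choose_mul_factorial_mul_factorial p.1 p.2
        have h5 : ((p.1 + p.2).choose p.1 : ℂ) * p.1.factorial * p.2.factorial =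
            (p.1 + p.2).factorial := by
          rw [Nat.choose_symm_add]; exact_mod_cast h4
        have h6 : ((p.1 + p.2).factorial : ℂ) ≠ 0 := by exact_mod_cast Nat.factorial_ne_zero _
        have h7 : (p.1.factorial : ℂ) ≠ 0 := by exact_mod_cast Nat.factorial_ne_zero _
        have h8 : (p.2.factorial : ℂ) ≠ 0 := by exact_mod_cast Nat.factorial_ne_zero _
        field_simp
        linear_combination h5
    rw [Finset.sum_congr rfl h3]
    refine Finset.sum_fiberwise_of_maps_to (fun p hp => ?_) _
    exact Finset.mem_range.mpr (Finset.mem_filter.mp hp).2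
  rw [h1, h2, ← Finset.sum_filter_add_sum_filter_not _ (fun p : ℕ × ℕ => p.1 + p.2 < K),
    add_sub_cancel_left]
  refine Submodule.sum_mem _ fun p hp => Submodule.smul_mem _ _ (hW _ _ ?_)
  have := (Finset.mem_filter.mp hp).2
  omega

theorem expTrunc_intertwine (f : A →ₗ[ℂ] B) {S : Module.End ℂ A} {T : Module.End ℂ B}
    (h : ∀ x, f (S x) = T (f x)) (K : ℕ) (x : A) : f (expTrunc K S x) = expTrunc K T (f x) := by
  have h1 : ∀ j, f ((S ^ j) x) = (T ^ j) (f x) := by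
    intro j
    induction j with
    | zero => rfl
    | succ j ih => rw [pow_succ', pow_succ', Module.End.mul_apply, Module.End.mul_apply, h, ih]
  rw [expTrunc_apply, expTrunc_apply, map_sum]
  exact Finset.sum_congr rfl fun j _ => by rw [map_smul, h1]

end Exponential

/-! ### The flow of a field on forms -/

/-- The field `ζ₀ x ∂/∂x + ζ₁ y ∂/∂y`. -/
def logField (ζ : Fin 2 → Series) : Derivation ℂ Series Series := ζ 0 • eu 0 + ζ 1 • eu 1

theorem logField_apply (ζ : Fin 2 → Series) (f : Series) :
    logField ζ f = ζ 0 * eu 0 f + ζ 1 * eu 1 f := rfl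

/-- The field as an endomorphism. -/
def fieldEnd (ζ : Fin 2 → Series) : Module.End ℂ Series := (logField ζ : Series →ₗ[ℂ] Series)

theorem fieldEnd_apply (ζ : Fin 2 → Series) (f : Series) : fieldEnd ζ f = logField ζ f := rfl

/-- The Lie derivative of the form `Ω₀ dx/x + Ω₁ dy/y` along `ζ₀ x ∂/∂x + ζ₁ y ∂/∂y`. -/
def lieEnd (ζ : Fin 2 → Series) : Module.End ℂ (Fin 2 → Series) where
  toFun Ω i := logField ζ (Ω i) + (Ω 0 * eu i (ζ 0) + Ω 1 * eu i (ζ 1))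
  map_add' Ω Θ := by
    ext1 i
    simp only [Pi.add_apply, map_add]
    ring
  map_smul' c Ω := by
    ext1 i
    simp only [Pi.smul_apply, Derivation.map_smul, RingHom.id_apply, smul_add, smul_mul_assoc]

theorem lieEnd_apply (ζ Ω : Fin 2 → Series) (i : Fin 2) :
    lieEnd ζ Ω i = logField ζ (Ω i) + (Ω 0 * eu i (ζ 0) + Ω 1 * eu i (ζ 1)) := rfl

/-- The differential, in logarithmic coordinates. -/
def dlog : Series →ₗ[ℂ] (Fin 2 → Series) where
  toFun f i := eu i f
  map_add' f g := by ext1 i; simp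
  map_smul' c f := by ext1 i; simp

theorem dlog_apply (f : Series) (i : Fin 2) : dlog f i = eu i f := rfl

/-- The Lie derivative commutes with the exterior derivative; hence the flow on forms is compatible
with the flow on functions. -/
theorem dlog_fieldEnd (ζ : Fin 2 → Series) (f : Series) :
    dlog (fieldEnd ζ f) = lieEnd ζ (dlog f) := by
  ext1 i
  rw [dlog_apply, fieldEnd_apply, lieEnd_apply, logField_apply, logField_apply]
  simp only [dlog_apply, map_add, Derivation.leibniz, smul_eq_mul]
  rw [eu_comm i 0, eu_comm i 1]
  ring

/-- The forms of weighted order at least `N`. -/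
def formSubmodule (w : Fin 2 → ℕ) (N : ℕ) : Submodule ℂ (Fin 2 → Series) where
  carrier := {Ω | ∀ i, Ω i ∈ wtIdeal w N}
  add_mem' h1 h2 i := Ideal.add_mem _ (h1 i) (h2 i)
  zero_mem' i := Ideal.zero_mem _
  smul_mem' c Ω h i := by
    rw [Pi.smul_apply, smul_eq_C_mul]
    exact Ideal.mul_mem_left _ _ (h i)

theorem smul_mem_wtIdeal {w : Fin 2 → ℕ} {N : ℕ} {f : Series} (c : ℂ) (hf : f ∈ wtIdeal w N) :
    c • f ∈ wtIdeal w N := by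
  rw [smul_eq_C_mul]; exact Ideal.mul_mem_left _ _ hf

variable {w : Fin 2 → ℕ} {ζ : Fin 2 → Series} {c : ℕ}

theorem fieldEnd_mem (hζ : ∀ i, ζ i ∈ wtIdeal w c) {N : ℕ} {f : Series} (hf : f ∈ wtIdeal w N) :
    fieldEnd ζ f ∈ wtIdeal w (N + c) := by
  rw [fieldEnd_apply, logField_apply, add_comm N]
  exact Ideal.add_mem _ (mul_mem_wtIdeal (hζ 0) (eu_mem_wtIdeal hf 0))
    (mul_mem_wtIdeal (hζ 1) (eu_mem_wtIdeal hf 1))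

theorem fieldEnd_pow_mem (hζ : ∀ i, ζ i ∈ wtIdeal w c) {N : ℕ} {f : Series}
    (hf : f ∈ wtIdeal w N) (j : ℕ) : (fieldEnd ζ ^ j) f ∈ wtIdeal w (N + c * j) := by
  induction j with
  | zero => simpa using hf
  | succ j ih =>
    rw [pow_succ', Module.End.mul_apply, Nat.mul_succ, ← Nat.add_assoc]
    exact fieldEnd_mem hζ ih

theorem lieEnd_mem (hζ : ∀ i, ζ i ∈ wtIdeal w c) {N : ℕ} {Ω : Fin 2 → Series}
    (hΩ : Ω ∈ formSubmodule w N) : lieEnd ζ Ω ∈ formSubmodule w (N + c) := by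
  intro i
  rw [lieEnd_apply]
  exact Ideal.add_mem _ (fieldEnd_mem hζ (hΩ i)) (Ideal.add_mem _
    (mul_mem_wtIdeal (hΩ 0) (eu_mem_wtIdeal (hζ 0) i))
    (mul_mem_wtIdeal (hΩ 1) (eu_mem_wtIdeal (hζ 1) i)))

theorem lieEnd_pow_mem (hζ : ∀ i, ζ i ∈ wtIdeal w c) {N : ℕ} {Ω : Fin 2 → Series}
    (hΩ : Ω ∈ formSubmodule w N) (j : ℕ) : (lieEnd ζ ^ j) Ω ∈ formSubmodule w (N + c * j) := by
  induction j with
  | zero => simpa using hΩ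
  | succ j ih =>
    rw [pow_succ', Module.End.mul_apply, Nat.mul_succ, ← Nat.add_assoc]
    exact lieEnd_mem hζ ih

theorem expTrunc_field_mem (hζ : ∀ i, ζ i ∈ wtIdeal w c) {N : ℕ} {f : Series}
    (hf : f ∈ wtIdeal w N) (K : ℕ) : expTrunc K (fieldEnd ζ) f ∈ wtIdeal w N := by
  rw [expTrunc_apply]
  exact Ideal.sum_mem _ fun j _ => smul_mem_wtIdeal _
    (wtIdeal_mono (by omega) (fieldEnd_pow_mem hζ hf j))

theorem expTrunc_lie_mem (hζ : ∀ i, ζ i ∈ wtIdeal w c) {N : ℕ} {Ω : Fin 2 → Series}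
    (hΩ : Ω ∈ formSubmodule w N) (K : ℕ) : expTrunc K (lieEnd ζ) Ω ∈ formSubmodule w N := by
  rw [expTrunc_apply]
  exact Submodule.sum_mem _ fun j _ => Submodule.smul_mem _ _ fun i =>
    wtIdeal_mono (by omega) (lieEnd_pow_mem hζ hΩ j i)

/-- Each application of the field raises the weight by `c ≥ 1`, so the terms lost by truncation have
weight at least `K`. -/
theorem expTrunc_field_mul (hc : 0 < c) (hζ : ∀ i, ζ i ∈ wtIdeal w c) (K : ℕ) (f g : Series) :
    expTrunc K (fieldEnd ζ) f * expTrunc K (fieldEnd ζ) g - expTrunc K (fieldEnd ζ) (f * g) ∈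
      wtIdeal w K := by
  refine expTrunc_leibniz (LinearMap.mul ℂ Series) (S := fieldEnd ζ) (T := fieldEnd ζ)
    (R := fieldEnd ζ) (fun x y => ?_) K f g ((wtIdeal w K).restrictScalars ℂ) (fun i j hij => ?_)
  · simp only [LinearMap.mul_apply', fieldEnd_apply, Derivation.leibniz, smul_eq_mul]
    ring
  · rw [Submodule.restrictScalars_mem, LinearMap.mul_apply']
    refine wtIdeal_mono ?_ (mul_mem_wtIdeal (fieldEnd_pow_mem hζ (mem_wtIdeal_zero f) i)
      (fieldEnd_pow_mem hζ (mem_wtIdeal_zero g) j))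
    have h1 : i ≤ c * i := Nat.le_mul_of_pos_left _ hc
    have h2 : j ≤ c * j := Nat.le_mul_of_pos_left _ hc
    omega

theorem expTrunc_lie_smul (hc : 0 < c) (hζ : ∀ i, ζ i ∈ wtIdeal w c) (K : ℕ) (f : Series)
    (Ω : Fin 2 → Series) :
    expTrunc K (fieldEnd ζ) f • expTrunc K (lieEnd ζ) Ω - expTrunc K (lieEnd ζ) (f • Ω) ∈
      formSubmodule w K := by
  refine expTrunc_leibniz (LinearMap.mk₂ ℂ (fun (f : Series) (Ω : Fin 2 → Series) => f • Ω)
    add_smul smul_assoc smul_add (fun c f Ω => smul_comm f c Ω)) (S := fieldEnd ζ) (T := lieEnd ζ)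
    (R := lieEnd ζ) (fun x y => ?_) K f Ω (formSubmodule w K) (fun i j hij => ?_)
  · ext1 i
    simp only [LinearMap.mk₂_apply, lieEnd_apply, fieldEnd_apply, Pi.smul_apply, Pi.add_apply,
      Derivation.leibniz, smul_eq_mul]
    ring
  · intro l
    rw [LinearMap.mk₂_apply, Pi.smul_apply, smul_eq_mul]
    refine wtIdeal_mono ?_ (mul_mem_wtIdeal (fieldEnd_pow_mem hζ (mem_wtIdeal_zero f) i)
      (lieEnd_pow_mem (N := 0) hζ (fun i => mem_wtIdeal_zero (Ω i)) j l))
    have h1 : i ≤ c * i := Nat.le_mul_of_pos_left _ hc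
    have h2 : j ≤ c * j := Nat.le_mul_of_pos_left _ hc
    omega

theorem expTrunc_field_sub_self_mem (hζ : ∀ i, ζ i ∈ wtIdeal w c) {N : ℕ} {f : Series}
    (hf : f ∈ wtIdeal w N) (K : ℕ) :
    expTrunc (K + 1) (fieldEnd ζ) f - f ∈ wtIdeal w (N + c) := by
  rw [expTrunc_apply, Finset.sum_range_succ']
  simp only [Nat.factorial_zero, Nat.cast_one, inv_one, pow_zero, one_smul, Module.End.one_apply,
    add_sub_cancel_right]
  refine Ideal.sum_mem _ fun j _ => smul_mem_wtIdeal _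
    (wtIdeal_mono ?_ (fieldEnd_pow_mem hζ hf (j + 1)))
  rw [Nat.mul_succ]; omega

/-- The terms from the second order on gain weight `2 c`, which is at least `c + 1`. -/
theorem expTrunc_field_sub_mem (hc : 0 < c) (hζ : ∀ i, ζ i ∈ wtIdeal w c) {N : ℕ} {f : Series}
    (hf : f ∈ wtIdeal w N) (K : ℕ) :
    expTrunc (K + 2) (fieldEnd ζ) f - f - logField ζ f ∈ wtIdeal w (N + c + 1) := by
  rw [expTrunc_apply, Finset.sum_range_succ', Finset.sum_range_succ']
  simp only [Nat.factorial_zero, Nat.cast_one, inv_one, pow_zero, one_smul, Module.End.one_apply,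
    zero_add, Nat.factorial_one, pow_one, fieldEnd_apply, add_sub_cancel_right]
  refine Ideal.sum_mem _ fun j _ => smul_mem_wtIdeal _
    (wtIdeal_mono ?_ (fieldEnd_pow_mem hζ hf (j + 1 + 1)))
  rw [Nat.mul_succ, Nat.mul_succ]; omega

/-- A logarithmic field is tangent to the axes, and so is its flow. -/
theorem X_dvd_expTrunc {i : Fin 2} {f : Series} (hf : X i ∣ f) (K : ℕ) :
    X i ∣ expTrunc K (fieldEnd ζ) f := by
  have h1 : ∀ g : Series, X i ∣ g → X i ∣ fieldEnd ζ g := by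
    rintro _ ⟨g, rfl⟩
    rw [fieldEnd_apply, Derivation.leibniz, smul_eq_mul, smul_eq_mul]
    refine dvd_add (dvd_mul_right _ _) (Dvd.dvd.mul_left ?_ _)
    rw [logField_apply, eu_X, eu_X]
    refine dvd_add (Dvd.dvd.mul_left ?_ _) (Dvd.dvd.mul_left ?_ _)
    · split_ifs
      · exact dvd_rfl
      · exact dvd_zero _
    · split_ifs
      · exact dvd_rfl
      · exact dvd_zero _
  have h2 : ∀ j, X i ∣ (fieldEnd ζ ^ j) f := by
    intro j
    induction j with
    | zero => exact hf
    | succ j ih => rw [pow_succ', Module.End.mul_apply]; exact h1 _ ih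
  rw [expTrunc_apply]
  refine Finset.dvd_sum fun j _ => ?_
  rw [smul_eq_C_mul]
  exact (h2 j).mul_left _

/-- Composition with a flow commutes with substitution: `(g ∘ φ) ∘ flow = g ∘ (φ ∘ flow)`. In the
truncated setting this is multiplicativity modulo high weight, checked on monomials. -/
theorem subst_expTrunc (hw : ∀ i, 0 < w i) (hc : 0 < c) (hζ : ∀ i, ζ i ∈ wtIdeal w c)
    {φ : Fin 2 → Series} (hφ : ∀ i, φ i ∈ wtIdeal w (w i)) (K : ℕ) (g : Series) :
    expTrunc (K + 1) (fieldEnd ζ) (subst φ g) -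
      subst (fun i => expTrunc (K + 1) (fieldEnd ζ) (φ i)) g ∈ wtIdeal w (K + 1) := by
  set E := expTrunc (K + 1) (fieldEnd ζ) with hE
  have hψ : ∀ i, E (φ i) ∈ wtIdeal w (w i) := fun i => expTrunc_field_mem hζ (hφ i) _
  have h1 := hasSubst_of_mem hw hφ
  have h2 := hasSubst_of_mem hw hψ
  let Λ : Series →+ Series :=
    (E : Series →+ Series).comp (substAlgHom (R := ℂ) h1 : Series →+ Series) -
      (substAlgHom (R := ℂ) h2 : Series →+ Series)
  have hΛ : ∀ f, Λ f = E (subst φ f) - subst (fun i => E (φ i)) f := fun f => by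
    rw [← substAlgHom_apply h1, ← substAlgHom_apply h2]; rfl
  have hmul := expTrunc_field_mul hc hζ (K + 1)
  have hone : E 1 - 1 = 0 := by
    have h0 : (fieldEnd ζ) 1 = 0 := by
      rw [fieldEnd_apply, Derivation.map_one_eq_zero]
    rw [hE, expTrunc_apply, Finset.sum_range_succ']
    simp [pow_succ, h0]
  have hpow : ∀ (f : Series) (r : ℕ), E (f ^ r) - E f ^ r ∈ wtIdeal w (K + 1) := by
    intro f r
    induction r with
    | zero => rw [pow_zero, pow_zero, hone]; exact Ideal.zero_mem _
    | succ r ih =>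
      have e : E (f ^ (r + 1)) - E f ^ (r + 1) =
          -(E (f ^ r) * E f - E (f ^ r * f)) + (E (f ^ r) - E f ^ r) * E f := by
        rw [pow_succ, pow_succ]; ring
      rw [e]
      exact Ideal.add_mem _ (Ideal.neg_mem_iff _ |>.mpr (hmul _ _)) (Ideal.mul_mem_right _ _ ih)
  rw [← hΛ]
  refine map_mem_wtIdeal_of_monomial hw Λ (K := K + 1) (N := 0) (fun f hf => ?_)
    (fun e a _ => ?_) (mem_wtIdeal_zero g)
  · rw [hΛ]
    exact Ideal.sub_mem _ (expTrunc_field_mem hζ (subst_mem_wtIdeal hw hφ hf) _)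
      (subst_mem_wtIdeal hw hψ hf)
  · rw [hΛ, subst_monomial_eq h1, subst_monomial_eq h2, ← smul_eq_C_mul, map_smul, smul_eq_C_mul,
      ← mul_sub]
    refine Ideal.mul_mem_left _ _ ?_
    have e1 : E (φ 0 ^ e 0 * φ 1 ^ e 1) - E (φ 0) ^ e 0 * E (φ 1) ^ e 1 =
        -(E (φ 0 ^ e 0) * E (φ 1 ^ e 1) - E (φ 0 ^ e 0 * φ 1 ^ e 1)) +
        (E (φ 0 ^ e 0) - E (φ 0) ^ e 0) * E (φ 1 ^ e 1) +
        E (φ 0) ^ e 0 * (E (φ 1 ^ e 1) - E (φ 1) ^ e 1) := by ring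
    rw [e1]
    exact Ideal.add_mem _ (Ideal.add_mem _ (Ideal.neg_mem_iff _ |>.mpr (hmul _ _))
      (Ideal.mul_mem_right _ _ (hpow _ _))) (Ideal.mul_mem_left _ _ (hpow _ _))

theorem isUnit_of_sub_one_mem (hc : 0 < c) {U : Series}
    (hU : U - 1 ∈ wtIdeal w c) : ∃ V, U * V = 1 ∧ V - 1 ∈ wtIdeal w c := by
  have h1 : constantCoeff U = 1 := by
    have := hU 0 (by simpa [wt] using hc)
    rw [map_sub, coeff_zero_eq_constantCoeff_apply, coeff_zero_eq_constantCoeff_apply,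
      map_one] at this
    exact sub_eq_zero.mp this
  obtain ⟨V, hV⟩ := (isUnit_iff_constantCoeff.mpr (by rw [h1]; exact isUnit_one)).exists_right_inv
  refine ⟨V, hV, ?_⟩
  have : V - 1 = -(V * (U - 1)) := by linear_combination hV
  rw [this]
  exact Ideal.neg_mem_iff _ |>.mpr (Ideal.mul_mem_left _ _ hU)

/-- The flow of a field which preserves the foliation `η`, applied to a map which sends the
foliation `ω` to `η` up to high weight. -/
theorem exists_flow (hw : ∀ i, 0 < w i) (hc : 0 < c) (hζ : ∀ i, ζ i ∈ wtIdeal w c)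
    {φ : Fin 2 → Series} (hφ : ∀ i, φ i ∈ wtIdeal w (w i)) {u W : Series} (hW : W ∈ wtIdeal w c)
    {ω η : Fin 2 → Series} (hη : lieEnd ζ η = W • η) {N : ℕ}
    (h : ∀ i, u * logPullback φ ω i - η i ∈ wtIdeal w N) :
    ∃ (ψ : Fin 2 → Series) (v : Series), (∀ i, X i ∣ φ i → X i ∣ ψ i) ∧
      (∀ i, ψ i - φ i - logField ζ (φ i) ∈ wtIdeal w (w i + c + 1)) ∧
      v - u ∈ wtIdeal w c ∧ ∀ i, v * logPullback ψ ω i - η i ∈ wtIdeal w N := by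
  -- The truncation order exceeds `N`, so modulo weight `N` the truncated exponentials behave like a
  -- true flow.
  set K := N + 1 with hK
  set E := expTrunc (K + 1) (fieldEnd ζ) with hE
  set F := expTrunc (K + 1) (lieEnd ζ) with hF
  -- The exponential acts on functions by composition with the flow, so `ψ` stands for `φ ∘ flow`
  -- and its pull-back is the flow applied to the pull-back by `φ`.
  set ψ : Fin 2 → Series := fun i => E (φ i) with hψ
  have hdlog : ∀ f i, eu i (E f) = F (dlog f) i := by
    intro f i
    have := expTrunc_intertwine dlog (S := fieldEnd ζ) (T := lieEnd ζ) (dlog_fieldEnd ζ) (K + 1) f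
    rw [hF, ← this]; rfl
  have hform : ∀ Ω : Fin 2 → Series, logPullback φ ω = subst φ (ω 0) • dlog (φ 0) +
      subst φ (ω 1) • dlog (φ 1) := fun _ => rfl
  have hpull : ∀ i, logPullback ψ ω i - F (logPullback φ ω) i ∈ wtIdeal w N := by
    intro i
    have a : ∀ j, subst ψ (ω j) * eu i (ψ j) - F (subst φ (ω j) • dlog (φ j)) i ∈ wtIdeal w N := by
      intro j
      have h1 := subst_expTrunc hw hc hζ hφ K (ω j)
      have h2 := expTrunc_lie_smul hc hζ (K + 1) (subst φ (ω j)) (dlog (φ j)) i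
      rw [Pi.sub_apply, Pi.smul_apply, smul_eq_mul, ← hF, ← hE] at h2
      rw [← hE] at h1
      have e : subst ψ (ω j) * eu i (ψ j) - F (subst φ (ω j) • dlog (φ j)) i =
          -((E (subst φ (ω j)) - subst ψ (ω j)) * F (dlog (φ j)) i) +
          (E (subst φ (ω j)) * F (dlog (φ j)) i - F (subst φ (ω j) • dlog (φ j)) i) := by
        rw [hψ]; simp only [hdlog]; ring
      rw [e]
      exact Ideal.add_mem _ (Ideal.neg_mem_iff _ |>.mpr (Ideal.mul_mem_right _ _
        (wtIdeal_mono (by omega) h1))) (wtIdeal_mono (by omega) h2)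
    have := Ideal.add_mem _ (a 0) (a 1)
    rw [hform ω, map_add, Pi.add_apply]
    convert this using 1
    rw [logPullback]; ring
  have hWpow : ∀ j, ∃ g, g ∈ wtIdeal w (c * j) ∧ (lieEnd ζ ^ j) η = g • η := by
    intro j
    induction j with
    | zero => exact ⟨1, by simpa using mem_wtIdeal_zero 1, by simp⟩
    | succ j ih =>
      obtain ⟨g, hg, he⟩ := ih
      refine ⟨logField ζ g + g * W, ?_, ?_⟩
      · rw [Nat.mul_succ]
        exact Ideal.add_mem _ (fieldEnd_mem hζ hg) (mul_mem_wtIdeal hg hW)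
      · rw [pow_succ', Module.End.mul_apply, he]
        have h1 : lieEnd ζ (g • η) = logField ζ g • η + g • lieEnd ζ η := by
          ext1 i
          simp only [lieEnd_apply, Pi.smul_apply, Pi.add_apply, Derivation.leibniz, smul_eq_mul]
          ring
        rw [h1, hη, add_smul, mul_smul]
  -- As the field preserves `η` up to a factor, its flow multiplies `η` by a unit `U`, which is
  -- compensated by putting `U⁻¹` into the new unit `v`.
  have hU : ∃ U, U - 1 ∈ wtIdeal w c ∧ F η = U • η := by
    choose g hg he using hWpow
    refine ⟨∑ j ∈ Finset.range K, (((j + 1).factorial : ℂ)⁻¹) • g (j + 1) + 1, ?_, ?_⟩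
    · rw [add_sub_cancel_right]
      refine Ideal.sum_mem _ fun j _ => smul_mem_wtIdeal _ (wtIdeal_mono ?_ (hg (j + 1)))
      rw [Nat.mul_succ]; omega
    · rw [hF, expTrunc_apply, Finset.sum_range_succ', add_smul, Finset.sum_smul]
      simp [he, smul_assoc]
  obtain ⟨U, hU1, hU2⟩ := hU
  obtain ⟨V, hV, hV1⟩ := isUnit_of_sub_one_mem hc hU1
  refine ⟨ψ, V * E u, fun i hi => X_dvd_expTrunc hi _, fun i => ?_, ?_, fun i => ?_⟩
  · exact expTrunc_field_sub_mem hc hζ (hφ i) N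
  · have h1 := expTrunc_field_sub_self_mem hζ (mem_wtIdeal_zero u) K
    have e : V * E u - u = V * (E u - u) + (V - 1) * u := by ring
    rw [e]
    exact Ideal.add_mem _ (Ideal.mul_mem_left _ _ (by simpa using h1))
      (Ideal.mul_mem_right _ _ hV1)
  · have h1 := expTrunc_lie_smul hc hζ (K + 1) u (logPullback φ ω) i
    have h2 : F (u • logPullback φ ω - η) ∈ formSubmodule w N :=
      expTrunc_lie_mem hζ (fun i => h i) _
    have h2i := h2 i
    rw [map_sub, Pi.sub_apply, hU2] at h2i
    rw [Pi.sub_apply, Pi.smul_apply, smul_eq_mul, ← hF, ← hE] at h1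
    have e : V * E u * logPullback ψ ω i - η i =
        V * (E u * (logPullback ψ ω i - F (logPullback φ ω) i) +
          (E u * F (logPullback φ ω) i - F (u • logPullback φ ω) i) +
          (F (u • logPullback φ ω) i - (U • η) i)) := by
      rw [Pi.smul_apply, smul_eq_mul]
      linear_combination (η i) * hV
    rw [e]
    exact Ideal.mul_mem_left _ _ (Ideal.add_mem _ (Ideal.add_mem _
      (Ideal.mul_mem_left _ _ (hpull i)) (wtIdeal_mono (by omega) h1)) h2i)

end QHFoliation

end

noncomputable section

namespace QHFoliation

open MvPowerSeries

/-! ### Formal conjugacies preserve the axes -/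

theorem wt_eq_of_ne {i j : Fin 2} (hij : i ≠ j) (w : Fin 2 → ℕ) (e : Fin 2 →₀ ℕ) :
    wt w e = w i * e i + w j * e j := by
  fin_cases i <;> fin_cases j <;> simp_all [wt, add_comm]

theorem eq_single_of_apply_eq_zero {i j : Fin 2} (hij : i ≠ j) {e : Fin 2 →₀ ℕ} (h : e j = 0) :
    e = Finsupp.single i (e i) := by
  ext l
  fin_cases i <;> fin_cases j <;> fin_cases l <;> simp_all

theorem logPullback_eq {i j : Fin 2} (hij : i ≠ j) (φ ω : Fin 2 → Series) (l : Fin 2) :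
    logPullback φ ω l = subst φ (ω i) * eu l (φ i) + subst φ (ω j) * eu l (φ j) := by
  fin_cases i <;> fin_cases j <;> simp_all [logPullback, add_comm]

theorem coeff_single_eq_zero_of_dvd {i j : Fin 2} (hij : i ≠ j) {f : Series} (h : X j ∣ f)
    (r : ℕ) : coeff (Finsupp.single i r) f = 0 := by
  rw [X_dvd_iff] at h
  exact h _ (by simp [hij])

/-! ### Pull-backs along monomial curves. -/

/-- The curve `x_i = t`, `x_j = τ t ^ P`. -/
def monCurve (i : Fin 2) (P : ℕ) (τ : ℂ) : Fin 2 → Series :=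
  fun l => if l = i then X i else C τ * X i ^ P

theorem monCurve_self (i : Fin 2) (P : ℕ) (τ : ℂ) : monCurve i P τ i = X i := by
  simp [monCurve]

theorem monCurve_ne {i j : Fin 2} (hij : i ≠ j) (P : ℕ) (τ : ℂ) :
    monCurve i P τ j = C τ * X i ^ P := by
  simp [monCurve, hij.symm]

theorem X_pow_mem {v : Fin 2 → ℕ} {i : Fin 2} (hi : v i = 1) (r : ℕ) :
    (X i : Series) ^ r ∈ wtIdeal v r := by
  have := pow_mem_wtIdeal (X_mem_wtIdeal v i) r
  rwa [hi, one_mul] at this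

theorem monCurve_mem {i j : Fin 2} (hij : i ≠ j) {v : Fin 2 → ℕ} {P : ℕ} (hi : v i = 1)
    (hj : v j = P) (τ : ℂ) (l : Fin 2) : monCurve i P τ l ∈ wtIdeal v (v l) := by
  by_cases h : l = i
  · subst h; rw [monCurve_self]; exact X_mem_wtIdeal v l
  · have : l = j := by omega
    subst this
    rw [monCurve_ne hij, hj]
    exact Ideal.mul_mem_left _ _ (X_pow_mem hi P)

theorem coeff_single_C_mul_X_pow (i : Fin 2) (c : ℂ) (r : ℕ) :
    coeff (Finsupp.single i r) (C c * X i ^ r : Series) = c := by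
  classical
  rw [coeff_C_mul, coeff_X_pow, if_pos rfl, mul_one]

theorem eq_of_C_mul_X_pow_sub_mem {v : Fin 2 → ℕ} {i : Fin 2} (hi : v i = 1) {c c' : ℂ} {r : ℕ}
    (h : C c * X i ^ r - C c' * X i ^ r ∈ wtIdeal v (r + 1)) : c = c' := by
  have := h (Finsupp.single i r) (by rw [wt_single, hi]; omega)
  rwa [map_sub, coeff_single_C_mul_X_pow, coeff_single_C_mul_X_pow, sub_eq_zero] at this

theorem mul_sub_C_mul_mem {v : Fin 2 → ℕ} {i : Fin 2} (hi : v i = 1) {f g : Series} {c c' : ℂ}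
    {N M : ℕ} (hf : f - C c * X i ^ N ∈ wtIdeal v (N + 1))
    (hg : g - C c' * X i ^ M ∈ wtIdeal v (M + 1)) :
    f * g - C (c * c') * X i ^ (N + M) ∈ wtIdeal v (N + M + 1) := by
  have hg' : g ∈ wtIdeal v M := by
    have := Ideal.add_mem _ (wtIdeal_mono (Nat.le_succ M) hg)
      (Ideal.mul_mem_left _ (C c') (X_pow_mem hi M))
    rwa [sub_add_cancel] at this
  have := mul_sub_mul_mem (c := 1) hg' (Ideal.mul_mem_left _ (C c) (X_pow_mem hi N)) hf hg
  convert this using 1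
  rw [map_mul, pow_add]; ring

/-- The leading coefficients of the pull-back of a form along a monomial curve. -/
theorem subst_logPullback_mem {i j : Fin 2} (hij : i ≠ j) {v : Fin 2 → ℕ} {P : ℕ} (hP : 0 < P)
    (hi : v i = 1) (hj : v j = P) {φ : Fin 2 → Series} {c : ℂ}
    (hφi : φ i - X i ∈ wtIdeal v 2) (hφj : φ j - (X j + C c * X i ^ P) ∈ wtIdeal v (P + 1))
    {a ω : Fin 2 → Series} {M : ℕ} (ha : ∀ l, a l ∈ wtIdeal v M) {q : Fin 2 → ℂ → ℂ}
    (hq : ∀ l τ, subst (monCurve i P τ) (a l) - C (q l τ) * X i ^ M ∈ wtIdeal v (M + 1))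
    (hωi : ω i = X j * a i) (hωj : ω j = X i * a j) (τ : ℂ) :
    subst (monCurve i P τ) (logPullback φ ω i) -
        C ((τ + c) * q i (τ + c) + P * c * q j (τ + c)) * X i ^ (M + P + 1) ∈
        wtIdeal v (M + P + 2) ∧
      subst (monCurve i P τ) (logPullback φ ω j) -
        C (τ * q j (τ + c)) * X i ^ (M + P + 1) ∈ wtIdeal v (M + P + 2) := by
  have hv : ∀ l, 0 < v l := by
    intro l
    by_cases h : l = i
    · subst h; omega
    · have : l = j := by omega
      subst this; omega
  set γ := monCurve i P τ with hγ
  have hγm : ∀ l, γ l ∈ wtIdeal v (v l) := monCurve_mem hij hi hj τ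
  have hγs := hasSubst_of_mem hv hγm
  have hγi : γ i = X i := monCurve_self i P τ
  have hγj : γ j = C τ * X i ^ P := monCurve_ne hij P τ
  have hsub : ∀ {f g : Series} {N : ℕ}, f - g ∈ wtIdeal v N →
      subst γ f - subst γ g ∈ wtIdeal v N := by
    intro f g N h
    rw [← subst_sub hγs]
    exact subst_mem_wtIdeal hv hγm h
  have hXi : subst γ (X i : Series) = X i := by rw [subst_X hγs, hγi]
  have hXj : subst γ (X j : Series) = C τ * X i ^ P := by rw [subst_X hγs, hγj]
  have hφmem : ∀ l, φ l ∈ wtIdeal v (v l) := by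
    intro l
    by_cases h : l = i
    · subst h
      have := Ideal.add_mem _ (wtIdeal_mono (by omega : 1 ≤ 2) hφi) (hi ▸ X_mem_wtIdeal v l)
      rw [hi]; rwa [sub_add_cancel] at this
    · have : l = j := by omega
      subst this
      have := Ideal.add_mem _ (wtIdeal_mono (Nat.le_succ P) hφj)
        (Ideal.add_mem _ (hj ▸ X_mem_wtIdeal v l) (Ideal.mul_mem_left _ (C c) (X_pow_mem hi P)))
      rw [hj]; rwa [sub_add_cancel] at this
  have hφs := hasSubst_of_mem hv hφmem
  have e1 : subst γ (φ i) - C 1 * X i ^ 1 ∈ wtIdeal v (1 + 1) := by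
    have := hsub hφi
    rwa [hXi, ← pow_one (X i : Series), ← one_mul ((X i : Series) ^ 1),
      ← map_one (C (σ := Fin 2) (R := ℂ))] at this
  have e2 : subst γ (φ j) - C (τ + c) * X i ^ P ∈ wtIdeal v (P + 1) := by
    have := hsub hφj
    rw [subst_add hγs, hXj, subst_mul hγs, subst_pow hγs, hXi, subst_C] at this
    convert this using 1
    rw [map_add]; ring
  have heu : ∀ {f g : Series} {N : ℕ} (l : Fin 2), f - g ∈ wtIdeal v N →
      subst γ (eu l f) - subst γ (eu l g) ∈ wtIdeal v N := by
    intro f g N l h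
    refine hsub ?_
    rw [← map_sub]; exact eu_mem_wtIdeal h l
  have e3 : subst γ (eu i (φ i)) - C 1 * X i ^ 1 ∈ wtIdeal v (1 + 1) := by
    have := heu i hφi
    rwa [eu_X_self, hXi, ← pow_one (X i : Series), ← one_mul ((X i : Series) ^ 1),
      ← map_one (C (σ := Fin 2) (R := ℂ))] at this
  have e4 : subst γ (eu i (φ j)) - C (P * c) * X i ^ P ∈ wtIdeal v (P + 1) := by
    have := heu i hφj
    have e : eu i (X j + C c * X i ^ P : Series) = C (P * c) * X i ^ P := by
      rw [map_add, eu_X_ne hij, zero_add, Derivation.leibniz, eu_C, smul_zero, add_zero,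
        Derivation.leibniz_pow, eu_X_self, smul_eq_mul, smul_eq_mul, nsmul_eq_mul, map_mul,
        map_natCast, ← pow_succ, Nat.sub_add_cancel hP]
      ring
    rw [e, subst_mul hγs, subst_pow hγs, hXi, subst_C] at this
    exact this
  have e5 : subst γ (eu j (φ i)) - C 0 * X i ^ 1 ∈ wtIdeal v (1 + 1) := by
    have := heu j hφi
    rw [eu_X_ne hij.symm, ← map_zero (C (σ := Fin 2) (R := ℂ)), subst_C] at this
    rw [map_zero] at this ⊢
    rwa [zero_mul]
  have e6 : subst γ (eu j (φ j)) - C τ * X i ^ P ∈ wtIdeal v (P + 1) := by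
    have := heu j hφj
    have e : eu j (X j + C c * X i ^ P : Series) = X j := by
      rw [map_add, eu_X_self, Derivation.leibniz, eu_C, smul_zero, add_zero,
        Derivation.leibniz_pow, eu_X_ne hij.symm, smul_zero, smul_zero, smul_zero, add_zero]
    rwa [e, hXj] at this
  -- To lowest order `φ` sends the curve with parameter `τ` to the one with parameter `τ + c`.
  have e7 : ∀ l, subst γ (subst φ (a l)) - C (q l (τ + c)) * X i ^ M ∈ wtIdeal v (M + 1) := by
    intro l
    rw [subst_comp_subst_apply hφs hγs]
    have h1 := subst_sub_subst_mem (c := 1) hv (φ := fun l => subst γ (φ l))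
      (ψ := monCurve i P (τ + c)) (fun l => subst_mem_wtIdeal hv hγm (hφmem l))
      (monCurve_mem hij hi hj _) (fun l => by
        by_cases h : l = i
        · subst h
          rw [monCurve_self, hi]
          simpa using e1
        · have : l = j := by omega
          subst this
          rw [monCurve_ne hij, hj]
          exact e2) (ha l)
    have := Ideal.add_mem _ h1 (hq l (τ + c))
    rwa [sub_add_sub_cancel] at this
  have hl : ∀ l, subst γ (logPullback φ ω l) =
      subst γ (φ j) * subst γ (subst φ (a i)) * subst γ (eu l (φ i)) +
      subst γ (φ i) * subst γ (subst φ (a j)) * subst γ (eu l (φ j)) := by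
    intro l
    rw [logPullback_eq hij, hωi, hωj, subst_mul hφs, subst_mul hφs, subst_X hφs, subst_X hφs,
      subst_add hγs, subst_mul hγs, subst_mul hγs, subst_mul hγs, subst_mul hγs]
  constructor
  · have h1 := mul_sub_C_mul_mem hi (mul_sub_C_mul_mem hi e2 (e7 i)) e3
    have h2 := mul_sub_C_mul_mem hi (mul_sub_C_mul_mem hi e1 (e7 j)) e4
    have := Ideal.add_mem _ (wtIdeal_mono (by omega : M + P + 2 ≤ _) h1)
      (wtIdeal_mono (by omega : M + P + 2 ≤ _) h2)
    rw [hl]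
    convert this using 1
    rw [show P + M + 1 = M + P + 1 by omega, show 1 + M + P = M + P + 1 by omega]
    simp only [map_add, map_mul, map_one]
    ring
  · have h1 := mul_sub_C_mul_mem hi (mul_sub_C_mul_mem hi e2 (e7 i)) e5
    have h2 := mul_sub_C_mul_mem hi (mul_sub_C_mul_mem hi e1 (e7 j)) e6
    have := Ideal.add_mem _ (wtIdeal_mono (by omega : M + P + 2 ≤ _) h1)
      (wtIdeal_mono (by omega : M + P + 2 ≤ _) h2)
    rw [hl]
    convert this using 1
    rw [show P + M + 1 = M + P + 1 by omega, show 1 + M + P = M + P + 1 by omega]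
    simp only [map_mul, map_one, map_zero]
    ring

/-- All the numbers `N c`, `N ∈ ℕ`, are roots. -/
theorem eq_zero_of_periodic {g : Polynomial ℂ} {c : ℂ} (hc : c ≠ 0) (h0 : g.eval 0 = 0)
    (h : ∀ τ, g.eval (τ + c) = g.eval τ) : g = 0 := by
  have h1 : ∀ N : ℕ, g.eval (N * c) = 0 := by
    intro N
    induction N with
    | zero => simpa using h0
    | succ N ih =>
      rw [← ih, ← h (N * c)]
      congr 1
      push_cast; ring
  refine Polynomial.eq_zero_of_infinite_isRoot g ?_
  refine Set.Infinite.mono (s := Set.range fun N : ℕ => (N : ℂ) * c) ?_ ?_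
  · rintro _ ⟨N, rfl⟩
    exact h1 N
  · refine Set.infinite_range_of_injective fun a b hab => ?_
    have := mul_right_cancel₀ hc hab
    exact_mod_cast this

/-- A formal conjugacy between forms with the same initial part, tangent to the identity, preserves
the axis `x_j = 0`, as soon as no curve `x_j = c x_i ^ P` can be a separatrix for an exponent `P`
different from the ratio of the weights. -/
theorem X_dvd_of_conjugacy {i j : Fin 2} (hij : i ≠ j) {w : Fin 2 → ℕ} (hw : ∀ l, 0 < w l)
    (hcop : Nat.Coprime (w i) (w j)) {n : ℕ} {a a' ω ω' : Fin 2 → Series}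
    (ha : ∀ l, a l ∈ wtIdeal w (w i * w j * n)) (hωi : ω i = X j * a i) (hωj : ω j = X i * a j)
    (hωi' : ω' i = X j * a' i) (hωj' : ω' j = X i * a' j)
    (h1 : ∀ P : ℕ, w j < w i * P → coeff (Finsupp.single i (w j * n)) (a i) +
      P * coeff (Finsupp.single i (w j * n)) (a j) ≠ 0)
    (h2 : ∀ P : ℕ, w i * P < w j → coeff (Finsupp.single j (w i * n)) (a i) +
      P * coeff (Finsupp.single j (w i * n)) (a j) ≠ 0)
    (q : Fin 2 → Polynomial ℂ) (hq0 : q i + (w j : Polynomial ℂ) * q j ≠ 0)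
    (hq : w i = 1 → ∀ l τ, subst (monCurve i (w j) τ) (a l) -
      C ((q l).eval τ) * X i ^ (w j * n) ∈ wtIdeal w (w j * n + 1))
    (hq' : w i = 1 → ∀ l τ, subst (monCurve i (w j) τ) (a' l) -
      C ((q l).eval τ) * X i ^ (w j * n) ∈ wtIdeal w (w j * n + 1))
    {φ : Fin 2 → Series} {u : Series} (hφ : IsStrictDiffeo φ) (hu : constantCoeff u = 1)
    (heq : ∀ l, u * logPullback φ ω l = X l * ω' l) : X j ∣ φ j := by
  classical
  have hzero : ∀ l, coeff 0 (φ l) = 0 := fun l => by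
    rw [coeff_zero_eq_constantCoeff_apply]; exact (hφ l).1
  rw [X_dvd_iff]
  by_contra hne
  push Not at hne
  obtain ⟨e, he, hne⟩ := hne
  have hex : ∃ m, coeff (Finsupp.single i m) (φ j) ≠ 0 :=
    ⟨e i, by rwa [← eq_single_of_apply_eq_zero hij he]⟩
  -- `c x_i ^ P` is the leading term of `φ j` on the axis `x_j = 0`. Tangency to the identity forces
  -- `P ≥ 2`.
  set P := Nat.find hex with hPdef
  set c := coeff (Finsupp.single i P) (φ j) with hc
  have hc0 : c ≠ 0 := Nat.find_spec hex
  have hmin : ∀ m < P, coeff (Finsupp.single i m) (φ j) = 0 := fun m hm => by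
    have := Nat.find_min hex hm
    push Not at this
    exact this
  have hP2 : 2 ≤ P := by
    by_contra hlt
    have : P = 0 ∨ P = 1 := by omega
    rcases this with h | h
    · apply hc0; rw [hc, h, Finsupp.single_zero, hzero]
    · apply hc0; rw [hc, h, (hφ j).2, if_neg hij.symm]
  -- Weights adapted to the curves `x_j = τ x_i ^ P`; they need not be the weights `w`.
  set v : Fin 2 → ℕ := fun l => if l = i then 1 else P with hv
  have hvi : v i = 1 := by simp [hv]
  have hvj : v j = P := by simp [hv, hij.symm]
  have hwt : ∀ e, wt v e = e i + P * e j := fun e => by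
    rw [wt_eq_of_ne hij, hvi, hvj, one_mul]
  have hφi : φ i - X i ∈ wtIdeal v 2 := by
    intro e he
    rw [hwt] at he
    have hej : e j = 0 := by
      by_contra h0
      have : P * 1 ≤ P * e j := Nat.mul_le_mul_left _ (by omega)
      omega
    rw [hej, mul_zero, add_zero] at he
    rw [eq_single_of_apply_eq_zero hij hej, map_sub, coeff_X]
    have : e i = 0 ∨ e i = 1 := by omega
    rcases this with h | h
    · rw [h, Finsupp.single_zero, hzero, if_neg, sub_zero]
      intro h'
      have := DFunLike.congr_fun h' i
      simp at this
    · rw [h, (hφ i).2, if_pos rfl, if_pos rfl, sub_self]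
  have hφj : φ j - (X j + C c * X i ^ P) ∈ wtIdeal v (P + 1) := by
    intro e he
    rw [hwt] at he
    rw [map_sub, map_add, coeff_C_mul, coeff_X, coeff_X_pow]
    by_cases hej : e j = 0
    · have hes := eq_single_of_apply_eq_zero hij hej
      rw [hej, mul_zero, add_zero] at he
      have hne1 : e ≠ Finsupp.single j 1 := by
        intro h'; rw [h'] at hej; simp at hej
      rw [if_neg hne1, zero_add]
      by_cases hei : e i = P
      · rw [hes, hei, if_pos rfl, mul_one, ← hc, sub_self]
      · rw [hes, hmin _ (by omega), if_neg, mul_zero, sub_zero]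
        intro h'
        have := DFunLike.congr_fun h' i
        simp at this
        exact hei this
    · have hej1 : e j = 1 := by
        by_contra h0
        have : P * 2 ≤ P * e j := Nat.mul_le_mul_left _ (by omega)
        omega
      have hei : e i = 0 := by rw [hej1] at he; omega
      have hes := eq_single_of_apply_eq_zero hij.symm hei
      rw [hej1] at hes
      rw [hes, (hφ j).2, if_pos rfl, if_pos rfl, if_neg, mul_zero, add_zero, sub_self]
      intro h'
      have := DFunLike.congr_fun h' j
      simp [hij] at this
  have hvpos : ∀ l, 0 < v l := by
    intro l; simp only [hv]; split_ifs <;> omega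
  have hγs := fun τ => hasSubst_of_mem hvpos (monCurve_mem hij hvi hvj τ)
  have hXlp : X j ∣ logPullback φ ω i := by
    obtain ⟨u', hu'⟩ := (isUnit_iff_constantCoeff.mpr (by rw [hu]; exact isUnit_one) :
      IsUnit u).exists_left_inv
    refine ⟨u' * X i * a' i, ?_⟩
    have := heq i
    rw [hωi'] at this
    linear_combination (logPullback φ ω i) * (-hu') + u' * this
  have hlp0 : subst (monCurve i P 0) (logPullback φ ω i) = 0 := by
    obtain ⟨g, hg⟩ := hXlp
    rw [hg, subst_mul (hγs 0), subst_X (hγs 0), monCurve_ne hij, map_zero, zero_mul, zero_mul]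
  -- The axis is invariant for the pull-back, whose leading coefficient along it (`τ = 0`) must
  -- vanish. This says that `x_j = c x_i ^ P` is a separatrix to lowest order.
  have crit : ∀ {M : ℕ} (Q : Fin 2 → ℂ → ℂ), (∀ l, a l ∈ wtIdeal v M) →
      (∀ l τ, subst (monCurve i P τ) (a l) - C (Q l τ) * X i ^ M ∈ wtIdeal v (M + 1)) →
      Q i c + P * Q j c = 0 := by
    intro M Q hM hQ
    have h := (subst_logPullback_mem hij (by omega) hvi hvj hφi hφj hM hQ hωi hωj 0).1
    rw [hlp0] at h
    have h3 := eq_of_C_mul_X_pow_sub_mem hvi (c := 0)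
      (c' := (0 + c) * Q i (0 + c) + P * c * Q j (0 + c)) (r := M + P + 1)
      (by rw [map_zero, zero_mul]; exact h)
    rw [zero_add] at h3
    have h4 : c * (Q i c + P * Q j c) = 0 := by linear_combination -h3
    exact (mul_eq_zero.mp h4).resolve_left hc0
  -- Away from the ratio of the weights, the part of `a` of lowest `v`-order is a pure power of a
  -- single variable, whose coefficients are excluded by `h2` and `h1`.
  rcases lt_trichotomy (w i * P) (w j) with hlt | heq' | hgt
  · have hmem : ∀ l, a l - C (coeff (Finsupp.single j (w i * n)) (a l)) * X j ^ (w i * n) ∈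
        wtIdeal v (P * (w i * n) + 1) := by
      intro l e he
      rw [hwt] at he
      rw [map_sub, coeff_C_mul, coeff_X_pow]
      by_cases h0 : wt w e < w i * w j * n
      · rw [ha l e h0, if_neg, mul_zero, sub_zero]
        rintro rfl
        rw [wt_single] at h0
        nlinarith
      · rw [wt_eq_of_ne hij] at h0
        push Not at h0
        have h5 : w j * (e i + P * e j) ≤ w j * (P * (w i * n)) :=
          Nat.mul_le_mul_left _ (by omega)
        have h6 : P * (w i * w j * n) ≤ P * (w i * e i + w j * e j) := Nat.mul_le_mul_left _ h0
        have h7 : (w i * P + 1) * e i ≤ w j * e i := Nat.mul_le_mul_right _ hlt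
        have hei : e i = 0 := by nlinarith
        have hes := eq_single_of_apply_eq_zero hij.symm hei
        rw [hei, mul_zero, zero_add] at h0
        rw [hei, zero_add] at he
        have h8 : e j ≤ w i * n := by
          have : P * e j ≤ P * (w i * n) := by omega
          exact Nat.le_of_mul_le_mul_left this (by omega)
        have h9 : w i * n ≤ e j := by
          have : w j * (w i * n) ≤ w j * e j := by nlinarith
          exact Nat.le_of_mul_le_mul_left this (hw j)
        rw [hes, le_antisymm h8 h9, if_pos rfl, mul_one, sub_self]
    have := crit (M := P * (w i * n))
      (fun l τ => coeff (Finsupp.single j (w i * n)) (a l) * τ ^ (w i * n)) (fun l => by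
        have := Ideal.add_mem _ (wtIdeal_mono (Nat.le_succ _) (hmem l))
          (Ideal.mul_mem_left _ (C (coeff (Finsupp.single j (w i * n)) (a l)))
            (pow_mem_wtIdeal (hvj ▸ X_mem_wtIdeal v j) (w i * n)))
        rwa [sub_add_cancel] at this) (fun l τ => by
        have := subst_mem_wtIdeal hvpos (monCurve_mem hij hvi hvj τ) (hmem l)
        rw [subst_sub (hγs τ), subst_mul (hγs τ), subst_pow (hγs τ), subst_X (hγs τ), subst_C,
          monCurve_ne hij, mul_pow, ← pow_mul, ← map_pow] at this
        rwa [map_mul, mul_assoc])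
    refine h2 P hlt ?_
    have h4 : c ^ (w i * n) * (coeff (Finsupp.single j (w i * n)) (a i) +
      P * coeff (Finsupp.single j (w i * n)) (a j)) = 0 := by linear_combination this
    exact (mul_eq_zero.mp h4).resolve_left (pow_ne_zero _ hc0)
  -- At the ratio of the weights all terms of the initial form contribute, and a nonzero `c` could
  -- be the parameter of an actual separatrix. One therefore compares both components along all
  -- curves `τ`: the polynomial `X (q i + P q j)` has period `c` and vanishes at `0`.
  · have hwi : w i = 1 := Nat.Coprime.eq_one_of_dvd hcop ⟨P, heq'.symm⟩
    have hwj : w j = P := by rw [← heq', hwi, one_mul]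
    have hvw : v = w := by
      ext l
      by_cases h : l = i
      · rw [h, hvi, hwi]
      · have : l = j := by omega
        rw [this, hvj, hwj]
    rw [hvw] at hφi hφj hvi hvj hvpos
    have hu1 : u - 1 ∈ wtIdeal w 1 := by
      intro e he
      rw [wt_eq_of_ne hij, hwi, hwj] at he
      have hei : e i = 0 := by omega
      have hej : e j = 0 := by
        by_contra h0
        have : P * 1 ≤ P * e j := Nat.mul_le_mul_left _ (by omega)
        omega
      have := eq_single_of_apply_eq_zero hij hej
      rw [hei, Finsupp.single_zero] at this
      rw [this, map_sub, coeff_zero_eq_constantCoeff_apply, coeff_zero_eq_constantCoeff_apply, hu,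
        map_one, sub_self]
    rw [hwj] at hq hq' hq0
    have hq := hq hwi
    have hq' := hq' hwi
    have ha' : ∀ l, a l ∈ wtIdeal w (P * n) := by
      intro l; have := ha l; rwa [hwi, hwj, one_mul] at this
    have key := subst_logPullback_mem hij (by omega) hvi hvj hφi hφj ha'
      (q := fun l τ => (q l).eval τ) hq hωi hωj
    have hu2 : ∀ τ, subst (monCurve i P τ) u - C 1 * X i ^ 0 ∈ wtIdeal w (0 + 1) := by
      intro τ
      have := subst_mem_wtIdeal hvpos (monCurve_mem hij hvi hvj τ) hu1
      rwa [subst_sub (hγs τ), ← map_one (C (σ := Fin 2) (R := ℂ)), subst_C, ← mul_one (C (1 : ℂ)),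
        ← pow_zero (X i)] at this
    have eqn : ∀ {l : Fin 2} {τ κ κ' : ℂ}, subst (monCurve i P τ) (logPullback φ ω l) -
        C κ * X i ^ (P * n + P + 1) ∈ wtIdeal w (P * n + P + 2) →
        subst (monCurve i P τ) (X l * ω' l) - C κ' * X i ^ (P * n + P + 1) ∈
          wtIdeal w (P * n + P + 2) → κ = κ' := by
      intro l τ κ κ' hκ hκ'
      have h3 := mul_sub_C_mul_mem hvi (hu2 τ) hκ
      rw [← subst_mul (hγs τ), heq l, one_mul, zero_add] at h3
      have h4 := Ideal.sub_mem _ hκ' h3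
      rw [sub_sub_sub_cancel_left] at h4
      exact eq_of_C_mul_X_pow_sub_mem hvi h4
    have hXi : ∀ τ, subst (monCurve i P τ) (X i : Series) = X i := fun τ => by
      rw [subst_X (hγs τ), monCurve_self]
    have hXj : ∀ τ, subst (monCurve i P τ) (X j : Series) = C τ * X i ^ P := fun τ => by
      rw [subst_X (hγs τ), monCurve_ne hij]
    have E1 : ∀ τ, (τ + c) * (q i).eval (τ + c) + P * c * (q j).eval (τ + c) =
        τ * (q i).eval τ := by
      intro τ
      refine eqn (key τ).1 ?_
      rw [hωi', subst_mul (hγs τ), subst_mul (hγs τ), hXi, hXj]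
      have := Ideal.mul_mem_left _ (C τ) (mul_mem_wtIdeal (X_pow_mem hvi (P + 1)) (hq' i τ))
      refine wtIdeal_mono (by omega : P * n + P + 2 ≤ P + 1 + (P * n + 1)) ?_
      convert this using 1
      rw [map_mul]; ring
    have E2 : ∀ τ, τ * (q j).eval (τ + c) = τ * (q j).eval τ := by
      intro τ
      refine eqn (key τ).2 ?_
      rw [hωj', subst_mul (hγs τ), subst_mul (hγs τ), hXi, hXj]
      have := Ideal.mul_mem_left _ (C τ) (mul_mem_wtIdeal (X_pow_mem hvi (P + 1)) (hq' j τ))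
      refine wtIdeal_mono (by omega : P * n + P + 2 ≤ P + 1 + (P * n + 1)) ?_
      convert this using 1
      rw [map_mul]; ring
    have hg := eq_zero_of_periodic (g := Polynomial.X * (q i + (P : Polynomial ℂ) * q j)) hc0
      (by simp) (fun τ => by
        simp only [Polynomial.eval_mul, Polynomial.eval_X, Polynomial.eval_add,
          Polynomial.eval_natCast]
        linear_combination E1 τ + P * E2 τ)
    exact hq0 ((mul_eq_zero.mp hg).resolve_left Polynomial.X_ne_zero)
  · have hmem : ∀ l, a l - C (coeff (Finsupp.single i (w j * n)) (a l)) * X i ^ (w j * n) ∈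
        wtIdeal v (w j * n + 1) := by
      intro l e he
      rw [hwt] at he
      rw [map_sub, coeff_C_mul, coeff_X_pow]
      by_cases h0 : wt w e < w i * w j * n
      · rw [ha l e h0, if_neg, mul_zero, sub_zero]
        rintro rfl
        rw [wt_single] at h0
        nlinarith
      · rw [wt_eq_of_ne hij] at h0
        push Not at h0
        have h5 : w i * (e i + P * e j) ≤ w i * (w j * n) := Nat.mul_le_mul_left _ (by omega)
        have h7 : (w j + 1) * e j ≤ w i * P * e j := Nat.mul_le_mul_right _ hgt
        have hej : e j = 0 := by nlinarith
        have hes := eq_single_of_apply_eq_zero hij hej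
        rw [hej, mul_zero, add_zero] at h0 he
        have h9 : w j * n ≤ e i := by
          have : w i * (w j * n) ≤ w i * e i := by nlinarith
          exact Nat.le_of_mul_le_mul_left this (hw i)
        have h8 : e i = w j * n := by omega
        rw [hes, h8, if_pos rfl, mul_one, sub_self]
    have := crit (M := w j * n)
      (fun l _ => coeff (Finsupp.single i (w j * n)) (a l)) (fun l => by
        have := Ideal.add_mem _ (wtIdeal_mono (Nat.le_succ _) (hmem l))
          (Ideal.mul_mem_left _ (C (coeff (Finsupp.single i (w j * n)) (a l)))
            (X_pow_mem hvi (w j * n)))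
        rwa [sub_add_cancel] at this) (fun l τ => by
        have := subst_mem_wtIdeal hvpos (monCurve_mem hij hvi hvj τ) (hmem l)
        rw [subst_sub (hγs τ), subst_mul (hγs τ), subst_pow (hγs τ), subst_X (hγs τ), subst_C,
          monCurve_self] at this
        exact this)
    exact h1 P hgt this

end QHFoliation

end

noncomputable section

namespace QHFoliation

open MvPowerSeries
open Polynomial (degreeLT)

/-! ### Restriction to an axis -/

theorem restrictAxis_mul (i : Fin 2) (f g : Series) :
    restrictAxis i (f * g) = restrictAxis i f * restrictAxis i g := by
  classical
  ext m
  rw [PowerSeries.coeff_mul, restrictAxis, PowerSeries.coeff_mk, coeff_mul,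
    Finsupp.antidiagonal_single, Finset.sum_map]
  simp [restrictAxis]

theorem restrictAxis_C (i : Fin 2) (c : ℂ) :
    restrictAxis i (C c : Series) = PowerSeries.C c := by
  classical
  ext m
  simp [restrictAxis, coeff_C, PowerSeries.coeff_C]

theorem restrictAxis_X_self (i : Fin 2) : restrictAxis i (X i : Series) = PowerSeries.X := by
  classical
  ext m
  have : (Finsupp.single i m = Finsupp.single i 1) ↔ m = 1 :=
    (Finsupp.single_injective i).eq_iff
  simp [restrictAxis, coeff_X, PowerSeries.coeff_X, this]

theorem restrictAxis_X_ne {i j : Fin 2} (hij : i ≠ j) : restrictAxis i (X j : Series) = 0 := by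
  classical
  ext m
  have : Finsupp.single i m ≠ Finsupp.single j 1 := fun h => by
    have := DFunLike.congr_fun h j
    simp [hij] at this
  simp [restrictAxis, coeff_X, this]

/-- The restriction to an axis as a homomorphism. -/
def restrictHom (i : Fin 2) : Series →ₐ[ℂ] PowerSeries ℂ where
  toFun := restrictAxis i
  map_one' := by rw [← map_one (C (σ := Fin 2) (R := ℂ)), restrictAxis_C, map_one]
  map_mul' := restrictAxis_mul i
  map_zero' := by ext; simp [restrictAxis]
  map_add' f g := by ext; simp [restrictAxis]
  commutes' c := restrictAxis_C i c

theorem restrictHom_apply (i : Fin 2) (f : Series) : restrictHom i f = restrictAxis i f := rfl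

theorem constantCoeff_restrictAxis (i : Fin 2) (f : Series) :
    PowerSeries.constantCoeff (restrictAxis i f) = constantCoeff f := by
  rw [← PowerSeries.coeff_zero_eq_constantCoeff_apply, restrictAxis, PowerSeries.coeff_mk,
    Finsupp.single_zero, coeff_zero_eq_constantCoeff_apply]

theorem X_dvd_iff_restrictAxis {i j : Fin 2} (hij : i ≠ j) {f : Series} :
    X j ∣ f ↔ restrictAxis i f = 0 := by
  rw [X_dvd_iff]
  constructor
  · intro h
    ext m
    rw [restrictAxis, PowerSeries.coeff_mk, map_zero]
    exact h _ (by simp [hij])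
  · intro h e he
    rw [eq_single_of_apply_eq_zero hij he]
    have := congrArg (PowerSeries.coeff (e i)) h
    rwa [restrictAxis, PowerSeries.coeff_mk, map_zero] at this

theorem exists_ne (j : Fin 2) : ∃ i, i ≠ j := ⟨j + 1, by omega⟩

theorem X_ne_zero' (j : Fin 2) : (X j : Series) ≠ 0 := by
  obtain ⟨i, hij⟩ := exists_ne j
  intro h
  have h1 := restrictAxis_X_self j
  rw [h, ← restrictHom_apply, map_zero] at h1
  exact PowerSeries.X_ne_zero h1.symm

theorem prime_X (j : Fin 2) : Prime (X j : Series) := by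
  obtain ⟨i, hij⟩ := exists_ne j
  refine ⟨X_ne_zero' j, ?_, ?_⟩
  · intro h
    have := isUnit_iff_constantCoeff.mp h
    simp at this
  · intro f g h
    rw [X_dvd_iff_restrictAxis hij, restrictAxis_mul] at h
    rw [X_dvd_iff_restrictAxis hij, X_dvd_iff_restrictAxis hij]
    exact mul_eq_zero.mp h

/-! ### The local form of the foliation along the principal component -/

/-- The coefficients of a `1`-form. -/
def OneForm.coeffs (ω : OneForm) : Fin 2 → Series := ![ω.a, ω.b]

theorem OneForm.coeffs_zero (ω : OneForm) : ω.coeffs 0 = ω.a := rfl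

theorem OneForm.coeffs_one (ω : OneForm) : ω.coeffs 1 = ω.b := rfl

theorem coeffs_pullback (φ : Fin 2 → Series) (ω : OneForm) (l : Fin 2) :
    (ω.pullback φ).coeffs l =
      subst φ ω.a * pderiv ℂ l (φ 0) + subst φ ω.b * pderiv ℂ l (φ 1) := by
  fin_cases l <;> rfl

theorem coeffs_mul (u : Series) (ω : OneForm) (l : Fin 2) :
    (OneForm.mul u ω).coeffs l = u * ω.coeffs l := by
  fin_cases l <;> rfl

/-- A one-form which is `x_j W(z + x_i) dx_i + (z + x_i) Q(z + x_i) dx_j` up to a factor. -/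
def IsLocalForm (i j : Fin 2) (z : ℂ) (W Q : Polynomial ℂ) (ω : OneForm) : Prop :=
  ∃ g : Series, g ≠ 0 ∧ ω.coeffs i = g * (X j * Polynomial.aeval (C z + X i : Series) W) ∧
    ω.coeffs j = g * ((C z + X i) * Polynomial.aeval (C z + X i : Series) Q)

theorem restrictAxis_aeval (i : Fin 2) (z : ℂ) (W : Polynomial ℂ) :
    restrictAxis i (Polynomial.aeval (C z + X i : Series) W) =
      Polynomial.aeval (PowerSeries.C z + PowerSeries.X : PowerSeries ℂ) W := by
  rw [← restrictHom_apply, ← Polynomial.aeval_algHom_apply, map_add, restrictHom_apply,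
    restrictHom_apply, restrictAxis_C, restrictAxis_X_self]

theorem constantCoeff_aeval (z : ℂ) (W : Polynomial ℂ) :
    PowerSeries.constantCoeff
      (Polynomial.aeval (PowerSeries.C z + PowerSeries.X : PowerSeries ℂ) W) = W.eval z := by
  induction W using Polynomial.induction_on' with
  | add p q hp hq => simp [hp, hq]
  | monomial s c =>
    rw [Polynomial.aeval_monomial, Polynomial.eval_monomial, map_mul, map_pow]
    simp

/-- Restricted to the axis, `W(z + x)` is a power of `x` times a unit, the power being the
multiplicity of `z` as a root. -/
theorem aeval_ne_zero {i : Fin 2} {z : ℂ} {W : Polynomial ℂ} (h : W ≠ 0) :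
    Polynomial.aeval (C z + X i : Series) W ≠ 0 := by
  intro h0
  have h1 := congrArg (restrictAxis i) h0
  rw [restrictAxis_aeval, ← restrictHom_apply, map_zero] at h1
  apply h
  by_contra hne
  obtain ⟨q, hq, hnr⟩ := Polynomial.exists_eq_pow_rootMultiplicity_mul_and_not_dvd W hne z
  rw [hq, map_mul, map_pow, map_sub, Polynomial.aeval_X, Polynomial.aeval_C,
    PowerSeries.algebraMap_apply, Algebra.algebraMap_self_apply, add_sub_cancel_left] at h1
  have h2 := (mul_eq_zero.mp h1).resolve_left (pow_ne_zero _ PowerSeries.X_ne_zero)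
  have h3 := congrArg PowerSeries.constantCoeff h2
  rw [constantCoeff_aeval, map_zero] at h3
  exact hnr (Polynomial.dvd_iff_isRoot.mpr h3)

/-- On the axis `x_j = 0` only the term `∂_j (x_j W) = W` survives, so the index is minus the
residue of `W / (x V)` at a simple pole. -/
theorem camachoSad_eq {i j : Fin 2} (hij : i ≠ j) (W : Series) {B : Series} {V : PowerSeries ℂ}
    (hV : PowerSeries.constantCoeff V ≠ 0) (hB : restrictAxis i B = PowerSeries.X * V) :
    camachoSad i j (X j * W) B = -(constantCoeff W / PowerSeries.constantCoeff V) := by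
  have h1 : restrictAxis i (pderiv ℂ j (X j * W) * B - X j * W * pderiv ℂ j B) =
      restrictAxis i W * (PowerSeries.X * V) := by
    have h0 : restrictHom i (X j : Series) = 0 := restrictAxis_X_ne hij
    have h2 : restrictHom i B = PowerSeries.X * V := hB
    rw [Derivation.leibniz, smul_eq_mul, smul_eq_mul, pderiv_X_self, mul_one,
      ← restrictHom_apply]
    simp only [map_sub, map_mul, map_add, h0, h2]
    rw [← restrictHom_apply i W]
    ring
  set G : PowerSeries ℂ := restrictAxis i W * V⁻¹ with hG
  have hVV := PowerSeries.mul_inv_cancel V hV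
  have h2 : (((restrictAxis i W * (PowerSeries.X * V) : PowerSeries ℂ) : LaurentSeries ℂ)) /
      ((PowerSeries.X * V : PowerSeries ℂ) : LaurentSeries ℂ) ^ 2 =
      HahnSeries.single (-1) 1 * (G : LaurentSeries ℂ) := by
    have hne : ((PowerSeries.X * V : PowerSeries ℂ) : LaurentSeries ℂ) ≠ 0 := by
      intro h
      rw [← PowerSeries.coe_zero] at h
      have := HahnSeries.ofPowerSeries_injective h
      rcases mul_eq_zero.mp this with h | h
      · exact PowerSeries.X_ne_zero h
      · rw [h, map_zero] at hV; exact hV rfl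
    rw [div_eq_iff (pow_ne_zero _ hne)]
    have e1 : restrictAxis i W * (PowerSeries.X * V) = PowerSeries.X * (G * V ^ 2) := by
      rw [hG]; linear_combination (-restrictAxis i W * PowerSeries.X * V) * hVV
    have e2 : (HahnSeries.single (-1 : ℤ) (1 : ℂ)) * ((PowerSeries.X : PowerSeries ℂ) : LaurentSeries ℂ) = 1 := by
      rw [PowerSeries.coe_X, HahnSeries.single_mul_single]; simp
    rw [e1]
    simp only [PowerSeries.coe_mul, pow_two]
    linear_combination (-(PowerSeries.X : PowerSeries ℂ) * G * V * V : LaurentSeries ℂ) * e2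
  rw [camachoSad, h1, hB, h2]
  congr 1
  have h3 := HahnSeries.coeff_single_mul_add (r := (1 : ℂ)) (x := (G : LaurentSeries ℂ)) (a := 0)
    (b := -1)
  rw [zero_add, one_mul] at h3
  rw [h3]
  have h4 := LaurentSeries.coeff_coe_powerSeries G 0
  rw [Nat.cast_zero] at h4
  rw [h4, PowerSeries.coeff_zero_eq_constantCoeff_apply, hG, map_mul,
    constantCoeff_restrictAxis, div_eq_mul_inv, PowerSeries.constantCoeff_inv]

/-- When `W` and `Q₁` do not vanish at `z`, the local form without its factor is already saturated:
its first coefficient is `x_j` times a unit, and `x_j` does not divide the second. It can thus be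
used as the strict transform. -/
theorem IsLocalForm.camachoSad {i j : Fin 2} (hij : i ≠ j) {z : ℂ} {W Q Q₁ : Polynomial ℂ}
    {ω : OneForm} (h : IsLocalForm i j z W Q ω)
    (hQ : Polynomial.X * Q = (Polynomial.X - Polynomial.C z) * Q₁) (hQ₁ : Q₁.eval z ≠ 0)
    (hW : W.eval z ≠ 0) :
    ∃ η : OneForm, IsRelPrime η.a η.b ∧ (∃ g : Series, g ≠ 0 ∧ ω = OneForm.mul g η) ∧ η.Singular ∧
      QHFoliation.camachoSad i j (η.coeffs i) (η.coeffs j) = -(W.eval z / Q₁.eval z) := by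
  obtain ⟨g, hg, hi, hj⟩ := h
  set A : Series := X j * Polynomial.aeval (C z + X i : Series) W with hA
  set B : Series := (C z + X i) * Polynomial.aeval (C z + X i : Series) Q with hB
  have hBe : B = Polynomial.aeval (C z + X i : Series) (Polynomial.X * Q) := by
    rw [map_mul, Polynomial.aeval_X]
  have hBr : restrictAxis i B = PowerSeries.X *
      Polynomial.aeval (PowerSeries.C z + PowerSeries.X : PowerSeries ℂ) Q₁ := by
    rw [hBe, restrictAxis_aeval, hQ, map_mul, map_sub, Polynomial.aeval_X, Polynomial.aeval_C,
      PowerSeries.algebraMap_apply, Algebra.algebraMap_self_apply, add_sub_cancel_left]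
  have hV : PowerSeries.constantCoeff
      (Polynomial.aeval (PowerSeries.C z + PowerSeries.X : PowerSeries ℂ) Q₁) ≠ 0 := by
    rwa [constantCoeff_aeval]
  have hWc : constantCoeff (Polynomial.aeval (C z + X i : Series) W) = W.eval z := by
    rw [← constantCoeff_restrictAxis i, restrictAxis_aeval, constantCoeff_aeval]
  have hrel : IsRelPrime A B := by
    have hu : IsUnit (Polynomial.aeval (C z + X i : Series) W) := by
      rw [isUnit_iff_constantCoeff, hWc]; exact isUnit_iff_ne_zero.mpr hW
    rw [hA, isRelPrime_mul_unit_right_left hu, (prime_X j).irreducible.isRelPrime_iff_not_dvd,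
      X_dvd_iff_restrictAxis hij, hBr]
    intro h0
    rcases mul_eq_zero.mp h0 with h0 | h0
    · exact PowerSeries.X_ne_zero h0
    · rw [h0, map_zero] at hV; exact hV rfl
  have hcA : constantCoeff A = 0 := by rw [hA, map_mul, constantCoeff_X, zero_mul]
  have hcB : constantCoeff B = 0 := by
    rw [← constantCoeff_restrictAxis i, hBr, map_mul, PowerSeries.constantCoeff_X, zero_mul]
  have hcs : QHFoliation.camachoSad i j A B = -(W.eval z / Q₁.eval z) := by
    rw [hA, camachoSad_eq hij _ hV hBr, hWc, constantCoeff_aeval]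
  have hcase : (i = 0 ∧ j = 1) ∨ (i = 1 ∧ j = 0) := by omega
  rcases hcase with ⟨rfl, rfl⟩ | ⟨rfl, rfl⟩
  · exact ⟨⟨A, B⟩, hrel, ⟨g, hg, OneForm.ext hi hj⟩, ⟨hcA, hcB⟩, hcs⟩
  · exact ⟨⟨B, A⟩, hrel.symm, ⟨g, hg, OneForm.ext hj hi⟩, ⟨hcB, hcA⟩, hcs⟩

/-- Two forms proportional to the same nonzero form are proportional to each other. Stated by
cross-multiplication, this avoids comparing the common factors. -/
theorem IsLocalForm.cross {i j : Fin 2} {z : ℂ} {W Q : Polynomial ℂ}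
    {ω η : OneForm} (h : IsLocalForm i j z W Q ω) {g : Series} (hg : g ≠ 0)
    (hη : ω = OneForm.mul g η) :
    η.coeffs i * ((C z + X i) * Polynomial.aeval (C z + X i : Series) Q) =
      η.coeffs j * (X j * Polynomial.aeval (C z + X i : Series) W) := by
  obtain ⟨g', hg', hi, hj⟩ := h
  rw [hη, coeffs_mul] at hi hj
  apply mul_left_cancel₀ (mul_ne_zero hg hg')
  linear_combination g' * ((C z + X i) * Polynomial.aeval (C z + X i : Series) Q) * hi -
    g' * (X j * Polynomial.aeval (C z + X i : Series) W) * hj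

theorem isRelPrime_coeffs {i j : Fin 2} (hij : i ≠ j) {η : OneForm} (h : IsRelPrime η.a η.b) :
    IsRelPrime (η.coeffs i) (η.coeffs j) := by
  have hcase : (i = 0 ∧ j = 1) ∨ (i = 1 ∧ j = 0) := by omega
  rcases hcase with ⟨rfl, rfl⟩ | ⟨rfl, rfl⟩
  · exact h
  · exact h.symm

/-- For `Q = 0` and `W ≠ 0` the saturated form would be a unit times `dx_i`, transverse to `x_j =
0`: the component would be dicritical. -/
theorem IsLocalForm.ne_zero {i j : Fin 2} (hij : i ≠ j) {z : ℂ} {W Q : Polynomial ℂ}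
    {ω η : OneForm} (h : IsLocalForm i j z W Q ω) {g : Series} (hg : g ≠ 0)
    (hη : ω = OneForm.mul g η) (hrel : IsRelPrime η.a η.b) (hd : X j ∣ η.coeffs i) (hW : W ≠ 0) :
    Q ≠ 0 := by
  rintro rfl
  have h1 := h.cross hg hη
  rw [map_zero, mul_zero, mul_zero] at h1
  have h2 : η.coeffs j = 0 := by
    rcases mul_eq_zero.mp h1.symm with h0 | h0
    · exact h0
    · exact absurd h0 (mul_ne_zero (X_ne_zero' j) (aeval_ne_zero hW))
  have h3 := isRelPrime_coeffs hij hrel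
  exact (prime_X j).not_isUnit (h3 hd (h2 ▸ dvd_zero _))

/-- At a corner `x_i = 0` is invariant too. If `W(0) = 0` while `Q(0) ≠ 0`, then `x_i` would divide
both coefficients of a saturated form. -/
theorem IsLocalForm.eval_ne_zero {i j : Fin 2} (hij : i ≠ j) {W Q : Polynomial ℂ}
    {ω η : OneForm} (h : IsLocalForm i j 0 W Q ω) {g : Series} (hg : g ≠ 0)
    (hη : ω = OneForm.mul g η) (hrel : IsRelPrime η.a η.b) (hd : X i ∣ η.coeffs j)
    (hQ : Q.eval 0 ≠ 0) : W.eval 0 ≠ 0 := by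
  intro hW
  have h1 := h.cross hg hη
  rw [← Polynomial.coeff_zero_eq_eval_zero, ← Polynomial.X_dvd_iff] at hW
  obtain ⟨W', rfl⟩ := hW
  obtain ⟨b, hb⟩ := hd
  rw [map_zero, zero_add, map_mul, Polynomial.aeval_X, hb] at h1
  have h2 : η.coeffs i * Polynomial.aeval (X i : Series) Q =
      X i * (b * (X j * Polynomial.aeval (X i : Series) W')) := by
    apply mul_left_cancel₀ (X_ne_zero' i)
    linear_combination h1
  have h3 : ¬ X i ∣ Polynomial.aeval (X i : Series) Q := by
    intro h0
    obtain ⟨c, hc⟩ := h0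
    have h4 := congrArg (fun f => PowerSeries.constantCoeff (restrictAxis i f)) hc
    have h5 := restrictAxis_aeval i 0 Q
    rw [map_zero, zero_add, map_zero, zero_add] at h5
    have h6 := constantCoeff_aeval 0 Q
    rw [map_zero, zero_add] at h6
    simp only [h5, restrictAxis_mul, restrictAxis_X_self, map_mul, PowerSeries.constantCoeff_X,
      zero_mul, h6] at h4
    exact hQ h4
  have h4 : X i ∣ η.coeffs i := ((prime_X i).dvd_or_dvd ⟨_, h2⟩).resolve_right h3
  exact (prime_X i).not_isUnit (isRelPrime_coeffs hij hrel h4 ⟨b, hb⟩)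

end QHFoliation

end

noncomputable section

namespace QHFoliation

open MvPowerSeries
open Polynomial (degreeLT)

/-! ### The charts along the principal component -/

/-- The subtractive Euclidean algorithm on the coordinates `(a, b)` of `(k, ℓ)` in the unimodular
basis `v, w`. Blowing up subtracts the smaller coordinate from the larger one; coprimality stops the
process at `a = b = 1`, where the next component is `(k, ℓ)`. -/
theorem exists_finalChart_of_cone {k ℓ : ℕ} (hc : Nat.Coprime k ℓ) :
    ∀ (N : ℕ) (v w : ℕ × ℕ) (a b : ℕ), a + b ≤ N → 0 < a → 0 < b → Chart k ℓ v w →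
      w.1 * v.2 = v.1 * w.2 + 1 → a * v.1 + b * w.1 = k → a * v.2 + b * w.2 = ℓ →
      ∃ v w, FinalChart k ℓ (k, ℓ) w ∧ FinalChart k ℓ v (k, ℓ) ∧
        w.1 * ℓ = w.2 * k + 1 ∧ v.2 * k = v.1 * ℓ + 1 := by
  intro N
  induction N with
  | zero => intro v w a b h ha; omega
  | succ N ih =>
    intro v w a b h ha hb hch hdet hk hℓ
    have hdet' : (w.1 : ℤ) * v.2 = v.1 * w.2 + 1 := by exact_mod_cast hdet
    have e1 : (k : ℤ) * v.2 = v.1 * ℓ + b := by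
      rw [← hk, ← hℓ]; push_cast; linear_combination (b : ℤ) * hdet'
    have e2 : (w.1 : ℤ) * ℓ = k * w.2 + a := by
      rw [← hk, ← hℓ]; push_cast; linear_combination (a : ℤ) * hdet'
    have hin : InsideCone k ℓ v w := by
      constructor
      · zify; omega
      · zify; omega
    rcases lt_trichotomy a b with hab | hab | hab
    · obtain ⟨c, rfl⟩ := Nat.exists_eq_add_of_lt hab
      refine ih (v + w) w a (c + 1) (by omega) ha (by omega) (Chart.second hch hin) ?_ ?_ ?_
      · simp only [Prod.fst_add, Prod.snd_add]; linarith
      · rw [← hk]; simp only [Prod.fst_add]; ring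
      · rw [← hℓ]; simp only [Prod.snd_add]; ring
    · subst hab
      have ha1 : a = 1 := by
        have h1 : a ∣ k := ⟨v.1 + w.1, by rw [← hk]; ring⟩
        have h2 : a ∣ ℓ := ⟨v.2 + w.2, by rw [← hℓ]; ring⟩
        have := Nat.dvd_gcd h1 h2
        rw [hc] at this
        exact Nat.dvd_one.mp this
      subst ha1
      have hvw : v + w = (k, ℓ) := by
        ext
        · simpa using hk
        · simpa using hℓ
      have c1 := Chart.second hch hin
      have c2 := Chart.first hch hin
      rw [hvw] at c1 c2
      refine ⟨v, w, ⟨c1, fun h => lt_irrefl _ h.1⟩, ⟨c2, fun h => lt_irrefl _ h.2⟩, ?_, ?_⟩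
      · zify; rw [e2]; push_cast; ring
      · zify; rw [mul_comm, e1]; push_cast; ring
    · obtain ⟨c, rfl⟩ := Nat.exists_eq_add_of_lt hab
      refine ih v (v + w) (c + 1) b (by omega) (by omega) hb (Chart.first hch hin) ?_ ?_ ?_
      · simp only [Prod.fst_add, Prod.snd_add]; linarith
      · rw [← hk]; simp only [Prod.fst_add]; ring
      · rw [← hℓ]; simp only [Prod.snd_add]; ring

theorem exists_finalChart {k ℓ : ℕ} (hk : 0 < k) (hℓ : 0 < ℓ) (hc : Nat.Coprime k ℓ) :
    ∃ v w, FinalChart k ℓ (k, ℓ) w ∧ FinalChart k ℓ v (k, ℓ) ∧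
        w.1 * ℓ = w.2 * k + 1 ∧ v.2 * k = v.1 * ℓ + 1 :=
  exists_finalChart_of_cone hc (ℓ + k) (0, 1) (1, 0) ℓ k le_rfl hℓ hk Chart.start (by simp)
    (by simp) (by simp)

theorem mul_pderiv_pow_mul_pow {i j : Fin 2} (hij : i ≠ j) (z : ℂ) (u k : ℕ) :
    (C z + X i) * pderiv ℂ i ((C z + X i) ^ u * X j ^ k : Series) =
      (u : Series) * ((C z + X i) ^ u * X j ^ k) ∧
    X j * pderiv ℂ j ((C z + X i) ^ u * X j ^ k : Series) =
      (k : Series) * ((C z + X i) ^ u * X j ^ k) := by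
  have hC : ∀ l, pderiv ℂ l (C z : Series) = 0 := fun l =>
    Derivation.map_algebraMap (pderiv ℂ l) z
  have hi : pderiv ℂ i (C z + X i : Series) = 1 := by
    rw [map_add, hC, pderiv_X_self, zero_add]
  have hj : pderiv ℂ j (C z + X i : Series) = 0 := by
    rw [map_add, hC, pderiv_X_of_ne hij, add_zero]
  constructor
  · rw [Derivation.leibniz, Derivation.leibniz_pow, Derivation.leibniz_pow, hi,
      pderiv_X_of_ne hij.symm]
    simp only [smul_eq_mul, smul_zero, mul_zero, zero_add, nsmul_eq_mul, mul_one]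
    rcases u with _ | u
    · simp
    · rw [Nat.add_sub_cancel, pow_succ]; ring
  · rw [Derivation.leibniz, Derivation.leibniz_pow, Derivation.leibniz_pow, hj, pderiv_X_self]
    simp only [smul_eq_mul, smul_zero, mul_zero, add_zero, nsmul_eq_mul, mul_one]
    rcases k with _ | k
    · simp
    · rw [Nat.add_sub_cancel, pow_succ]; ring

theorem C_add_X_ne_zero (i : Fin 2) (z : ℂ) : (C z + X i : Series) ≠ 0 := by
  have := aeval_ne_zero (i := i) (z := z) Polynomial.X_ne_zero
  rwa [Polynomial.aeval_X] at this

/-- Write `ω = xy (a₀ dx/x + a₁ dy/y)`. In a monomial chart `dx/x` and `dy/y` are combinations of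
the logarithmic differentials with the exponents as coefficients, which gives the two combinations
of `P` and `R`. -/
theorem isLocalForm_pullback {i j : Fin 2} (hij : i ≠ j) {z : ℂ} {k ℓ N c : ℕ} {u : Fin 2 → ℕ}
    (hk : 0 < k) (hℓ : 0 < ℓ) (hu : 0 < u 0 + u 1) {φ : Fin 2 → Series}
    (h0 : φ 0 = (C z + X i) ^ u 0 * X j ^ k) (h1 : φ 1 = (C z + X i) ^ u 1 * X j ^ ℓ)
    {ω : OneForm} {a₀ a₁ : Series} (ha : ω.a = X 1 * a₀) (hb : ω.b = X 0 * a₁)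
    {P R : Polynomial ℂ}
    (hP : subst φ a₀ = X j ^ N * (C z + X i) ^ c * Polynomial.aeval (C z + X i : Series) P)
    (hR : subst φ a₁ = X j ^ N * (C z + X i) ^ c * Polynomial.aeval (C z + X i : Series) R) :
    IsLocalForm i j z ((u 0 : Polynomial ℂ) * P + (u 1 : Polynomial ℂ) * R)
      ((k : Polynomial ℂ) * P + (ℓ : Polynomial ℂ) * R) (ω.pullback φ) := by
  have hφ : HasSubst φ := by
    refine hasSubst_of_constantCoeff_zero fun s => ?_
    fin_cases s
    · change constantCoeff (φ 0) = 0
      rw [h0, map_mul, map_pow _ (X j), constantCoeff_X, zero_pow hk.ne', mul_zero]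
    · change constantCoeff (φ 1) = 0
      rw [h1, map_mul, map_pow _ (X j), constantCoeff_X, zero_pow hℓ.ne', mul_zero]
  set S : Series := C z + X i with hS
  have hS0 : S ≠ 0 := C_add_X_ne_zero i z
  obtain ⟨t, ht⟩ : ∃ t, u 0 + u 1 = t + 1 := ⟨u 0 + u 1 - 1, by omega⟩
  obtain ⟨t', ht'⟩ : ∃ t', k + ℓ = t' + 1 := ⟨k + ℓ - 1, by omega⟩
  obtain ⟨d0, d0'⟩ := mul_pderiv_pow_mul_pow hij z (u 0) k
  obtain ⟨d1, d1'⟩ := mul_pderiv_pow_mul_pow hij z (u 1) ℓ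
  rw [← hS] at d0 d0' d1 d1'
  have es : S ^ u 0 * S ^ u 1 = S ^ t * S := by rw [← pow_add, ht, pow_succ]
  have ex : (X j : Series) ^ k * X j ^ ℓ = X j ^ t' * X j := by rw [← pow_add, ht', pow_succ]
  refine ⟨S ^ t * S ^ c * (X j ^ t' * X j ^ N),
    mul_ne_zero (mul_ne_zero (pow_ne_zero _ hS0) (pow_ne_zero _ hS0))
      (mul_ne_zero (pow_ne_zero _ (X_ne_zero' j)) (pow_ne_zero _ (X_ne_zero' j))), ?_, ?_⟩
  · rw [coeffs_pullback, ha, hb, subst_mul hφ, subst_mul hφ, subst_X hφ, subst_X hφ, hP, hR,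
      map_add, map_mul, map_mul, map_natCast, map_natCast]
    apply mul_left_cancel₀ hS0
    rw [h0, h1]
    set P' := Polynomial.aeval S P
    set R' := Polynomial.aeval S R
    linear_combination (S ^ u 1 * X j ^ ℓ * (X j ^ N * S ^ c * P')) * d0 +
      (S ^ u 0 * X j ^ k * (X j ^ N * S ^ c * R')) * d1 +
      X j ^ N * S ^ c * ((u 0 : Series) * P' + (u 1 : Series) * R') * X j ^ k * X j ^ ℓ * es +
      X j ^ N * S ^ c * ((u 0 : Series) * P' + (u 1 : Series) * R') * S ^ t * S * ex
  · rw [coeffs_pullback, ha, hb, subst_mul hφ, subst_mul hφ, subst_X hφ, subst_X hφ, hP, hR,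
      map_add, map_mul, map_mul, map_natCast, map_natCast]
    apply mul_left_cancel₀ (X_ne_zero' j)
    rw [h0, h1]
    set P' := Polynomial.aeval S P
    set R' := Polynomial.aeval S R
    linear_combination (S ^ u 1 * X j ^ ℓ * (X j ^ N * S ^ c * P')) * d0' +
      (S ^ u 0 * X j ^ k * (X j ^ N * S ^ c * R')) * d1' +
      X j ^ N * S ^ c * ((k : Series) * P' + (ℓ : Series) * R') * X j ^ k * X j ^ ℓ * es +
      X j ^ N * S ^ c * ((k : Series) * P' + (ℓ : Series) * R') * S ^ t * S * ex

/-- The polynomial `∑ P_s T ^ (ε s)`. -/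
def shape (n : ℕ) (ε : ℕ → ℕ) (P : Polynomial ℂ) : Polynomial ℂ :=
  ∑ s ∈ Finset.range (n + 1), Polynomial.C (P.coeff s) * Polynomial.X ^ ε s

theorem shape_id {n : ℕ} {P : Polynomial ℂ} (hP : P ∈ degreeLT ℂ (n + 1)) :
    shape n id P = P := by
  ext t
  rw [shape, Polynomial.finsetSum_coeff]
  simp only [Polynomial.coeff_C_mul, Polynomial.coeff_X_pow, id, mul_ite, mul_one, mul_zero,
    Finset.sum_ite_eq, Finset.mem_range]
  split_ifs with h
  · rfl
  · rw [mem_degreeLT_iff.mp hP t (by omega)]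

theorem eval_zero_shape_sub (n : ℕ) (P : Polynomial ℂ) :
    (shape n (fun s => n - s) P).eval 0 = P.coeff n := by
  rw [shape, Polynomial.eval_finsetSum, Finset.sum_eq_single n]
  · simp
  · intro s hs hne
    have := Finset.mem_range.mp hs
    rw [Polynomial.eval_mul, Polynomial.eval_pow, Polynomial.eval_X, zero_pow (by omega), mul_zero]
  · simp

/-- All monomials have weight `k ℓ n`, which becomes the exponent of `X j`; only the power of the
other coordinate depends on `s`, and `ε` records it. -/
theorem subst_hom {i j : Fin 2} {z : ℂ} {k ℓ n c : ℕ} {u : Fin 2 → ℕ} (hk : 0 < k) (hℓ : 0 < ℓ)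
    {φ : Fin 2 → Series}
    (h0 : φ 0 = (C z + X i) ^ u 0 * X j ^ k) (h1 : φ 1 = (C z + X i) ^ u 1 * X j ^ ℓ)
    {ε : ℕ → ℕ} (hε : ∀ s ≤ n, u 0 * (ℓ * n - ℓ * s) + u 1 * (k * s) = c + ε s)
    (P : Polynomial ℂ) :
    subst φ (hom k ℓ (ℓ * n) 0 P) = X j ^ (k * ℓ * n) * (C z + X i) ^ c *
      Polynomial.aeval (C z + X i : Series) (shape n ε P) := by
  have hφ : HasSubst φ := by
    refine hasSubst_of_constantCoeff_zero fun s => ?_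
    fin_cases s
    · change constantCoeff (φ 0) = 0
      rw [h0, map_mul, map_pow _ (X j), constantCoeff_X, zero_pow hk.ne', mul_zero]
    · change constantCoeff (φ 1) = 0
      rw [h1, map_mul, map_pow _ (X j), constantCoeff_X, zero_pow hℓ.ne', mul_zero]
  rw [hom, ← coe_substAlgHom hφ, map_sum, coe_substAlgHom hφ, shape, map_sum, Finset.mul_sum,
    Nat.mul_div_cancel_left n hℓ]
  refine Finset.sum_congr rfl fun s hs => ?_
  have hs' : s ≤ n := by have := Finset.mem_range.mp hs; omega
  rw [subst_mul hφ, subst_mul hφ, subst_pow hφ, subst_pow hφ, subst_X hφ, subst_X hφ, subst_C,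
    map_mul, map_pow, Polynomial.aeval_X, Polynomial.aeval_C, ← MvPowerSeries.c_eq_algebraMap,
    h0, h1, mul_pow, mul_pow, zero_add, ← pow_mul, ← pow_mul, ← pow_mul, ← pow_mul]
  have e1 : (C z + X i : Series) ^ (u 0 * (ℓ * n - ℓ * s)) * (C z + X i) ^ (u 1 * (k * s)) =
      (C z + X i) ^ c * (C z + X i) ^ ε s := by
    rw [← pow_add, ← pow_add, hε s hs']
  have e2 : (X j : Series) ^ (k * (ℓ * n - ℓ * s)) * X j ^ (ℓ * (k * s)) = X j ^ (k * ℓ * n) := by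
    rw [← pow_add]
    congr 1
    have := Nat.mul_le_mul_left ℓ hs'
    zify [this]; ring
  linear_combination C (P.coeff s) * (X j ^ (k * (ℓ * n - ℓ * s)) * X j ^ (ℓ * (k * s))) * e1 +
    C (P.coeff s) * ((C z + X i) ^ c * (C z + X i) ^ ε s) * e2

/-! ### The initial form -/

theorem eq_hom_dehom {k ℓ I : ℕ} (hk : 0 < k) (hℓ : 0 < ℓ) (hc : Nat.Coprime k ℓ) {f : Series}
    (h : ∀ e, coeff e f ≠ 0 → k * e 0 + ℓ * e 1 = k * I) :
    f = hom k ℓ I 0 (dehom k ℓ I 0 f) := by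
  have hf : f ∈ wtIdeal (wts k ℓ) (k * I + ℓ * 0) := by
    intro e he
    by_contra hne
    have := h e hne
    simp only [wt, wts_zero, wts_one] at he
    omega
  ext e
  by_cases he : wt (wts k ℓ) e < k * I + ℓ * 0 + 1
  · have := sub_hom_dehom_mem hk hℓ hc hk hf e he
    rwa [map_sub, sub_eq_zero] at this
  · simp only [wt, wts_zero, wts_one] at he
    have h1 : coeff e f = 0 := by
      by_contra hne
      have := h e hne
      omega
    have h2 : coeff e (hom k ℓ I 0 (dehom k ℓ I 0 f)) = 0 := by
      by_contra hne
      obtain ⟨s, hs, rfl, -⟩ := coeff_hom_ne_zero hne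
      have := mul_le_of_lt_div hs
      rw [expo_apply_zero, expo_apply_one] at he
      apply he
      obtain ⟨t, rfl⟩ := Nat.exists_eq_add_of_le this
      rw [Nat.add_sub_cancel_left]
      nlinarith
    rw [h1, h2]

/-- An integral relation between `p` and `r`, not proportional to the one with coefficients `(k,
ℓ)`, makes the ratio of `p` and `r` rational, hence also the Camacho-Sad index at the corner. If `k
p + ℓ r` vanishes as well, two independent relations give `p = r = 0`. -/
theorem corner_ne_zero {k ℓ u₀ u₁ : ℕ} {p r : ℂ} (hpr : ¬(p = 0 ∧ r = 0))
    (hW : (k : ℂ) * p + ℓ * r ≠ 0 → (u₀ : ℂ) * p + u₁ * r ≠ 0)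
    (hirr : (k : ℂ) * p + ℓ * r ≠ 0 → (u₀ : ℂ) * p + u₁ * r ≠ 0 →
      ∀ x : ℚ, -(((u₀ : ℂ) * p + u₁ * r) / (k * p + ℓ * r)) ≠ x)
    {α β : ℤ} (hαβ : α * ℓ ≠ β * k) : (α : ℂ) * p + β * r ≠ 0 := by
  intro h
  have hD : (α : ℂ) * ℓ - β * k ≠ 0 := by
    rw [sub_ne_zero]; exact_mod_cast hαβ
  by_cases hQ : (k : ℂ) * p + ℓ * r = 0
  · apply hpr
    constructor
    · apply (mul_eq_zero.mp (?_ : ((α : ℂ) * ℓ - β * k) * p = 0)).resolve_left hD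
      linear_combination (ℓ : ℂ) * h - β * hQ
    · apply (mul_eq_zero.mp (?_ : ((α : ℂ) * ℓ - β * k) * r = 0)).resolve_left hD
      linear_combination (α : ℂ) * hQ - k * h
  · refine hirr hQ (hW hQ) ((u₀ * β - u₁ * α) / (α * ℓ - β * k)) ?_
    push_cast
    rw [← neg_div, div_eq_div_iff hQ hD]
    linear_combination (k * u₁ - u₀ * ℓ : ℂ) * h

/-- The properties of the initial form used in the proof: `p` and `r` are the polynomials which
represent its coefficients. -/
structure IsAdmissible (k ℓ n : ℕ) (p r : Polynomial ℂ) : Prop where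
  p_mem : p ∈ degreeLT ℂ (n + 1)
  r_mem : r ∈ degreeLT ℂ (n + 1)
  top : ∀ α β : ℤ, α * ℓ ≠ β * k → (α : ℂ) * p.coeff n + β * r.coeff n ≠ 0
  bot : ∀ α β : ℤ, α * ℓ ≠ β * k → (α : ℂ) * p.coeff 0 + β * r.coeff 0 ≠ 0
  no_root : ∀ z, z ≠ 0 → ¬(p.eval z = 0 ∧ r.eval z = 0)
  q_ne_zero : (k : Polynomial ℂ) * p + (ℓ : Polynomial ℂ) * r ≠ 0
  exists_chart : ∃ v : ℕ × ℕ, v.2 * k = v.1 * ℓ + 1 ∧ ∀ z, z ≠ 0 →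
    ((k : Polynomial ℂ) * p + (ℓ : Polynomial ℂ) * r).eval z = 0 →
    ((v.1 : Polynomial ℂ) * p + (v.2 : Polynomial ℂ) * r).eval z ≠ 0 →
    (Polynomial.derivative ((k : Polynomial ℂ) * p + (ℓ : Polynomial ℂ) * r)).eval z ≠ 0 →
    ∀ x : ℚ, -(((v.1 : Polynomial ℂ) * p + (v.2 : Polynomial ℂ) * r).eval z /
      (z * (Polynomial.derivative
        ((k : Polynomial ℂ) * p + (ℓ : Polynomial ℂ) * r)).eval z)) ≠ x

theorem coeff_X_mul_expo (f : Series) (l : Fin 2) (e : Fin 2 →₀ ℕ) :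
    coeff (e + Finsupp.single l 1) (X l * f) = coeff e f := by
  rw [X, add_comm, coeff_add_monomial_mul, one_mul]

theorem dvd_of_axes {ω : OneForm} (h : Invariant ω (X 0) ∧ Invariant ω (X 1)) :
    (X 0 : Series) ∣ ω.b ∧ (X 1 : Series) ∣ ω.a := by
  have hdX : ∀ l l' : Fin 2, pderiv ℂ l (X l' : Series) = if l = l' then 1 else 0 := fun l l' => by
    split_ifs with h
    · subst h; exact pderiv_X_self ..
    · exact pderiv_X_of_ne (Ne.symm h) ..
  obtain ⟨h0, h1⟩ := h
  rw [Invariant, dX, dY, hdX, hdX] at h0 h1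
  exact ⟨by simpa using h0, by simpa using h1⟩

/-- The initial form is given by an admissible pair of polynomials. -/
theorem exists_isAdmissible {k ℓ n : ℕ} (hk : 0 < k) (hℓ : 0 < ℓ) (hkℓ : Nat.Coprime k ℓ)
    (hn : 0 < n) {c : Fin n → ℂ} {ω : OneForm} (hω : ClassQInitial k ℓ c ω)
    (hirr : IrrationalIndices k ℓ ω) :
    ∃ p r, ω.a = X 1 * hom k ℓ (ℓ * n) 0 p ∧ ω.b = X 0 * hom k ℓ (ℓ * n) 0 r ∧
      IsAdmissible k ℓ n p r := by
  obtain ⟨hb, ha⟩ := dvd_of_axes hω.mem.axes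
  obtain ⟨a₀, ha⟩ := ha
  obtain ⟨a₁, hb⟩ := hb
  have h0 : a₀ = hom k ℓ (ℓ * n) 0 (dehom k ℓ (ℓ * n) 0 a₀) := by
    refine eq_hom_dehom hk hℓ hkℓ fun e he => ?_
    rw [← coeff_X_mul_expo a₀ 1, ← ha, ← expo_eta (e + Finsupp.single 1 1)] at he
    have := hω.hom_a _ _ he
    simp only [Finsupp.add_apply, Finsupp.single_apply, deg] at this
    norm_num at this
    nlinarith
  have h1 : a₁ = hom k ℓ (ℓ * n) 0 (dehom k ℓ (ℓ * n) 0 a₁) := by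
    refine eq_hom_dehom hk hℓ hkℓ fun e he => ?_
    rw [← coeff_X_mul_expo a₁ 0, ← hb, ← expo_eta (e + Finsupp.single 0 1)] at he
    have := hω.hom_b _ _ he
    simp only [Finsupp.add_apply, Finsupp.single_apply, deg] at this
    norm_num at this
    nlinarith
  have hpm := dehom_mem k ℓ (ℓ * n) 0 a₀
  have hrm := dehom_mem k ℓ (ℓ * n) 0 a₁
  rw [Nat.mul_div_cancel_left n hℓ] at hpm hrm
  set p := dehom k ℓ (ℓ * n) 0 a₀
  set r := dehom k ℓ (ℓ * n) 0 a₁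
  refine ⟨p, r, by rw [ha, ← h0], by rw [hb, ← h1], ?_⟩
  have hcop : ∀ {f : Series}, ¬ IsUnit f → f ∣ a₀ → f ∣ a₁ → False := fun hf h h' =>
    hf (hω.mem.isolated (ha ▸ h.mul_left _) (hb ▸ h'.mul_left _))
  -- A common root `z` yields the common factor `y ^ k - z x ^ ℓ`, against the isolated singularity.
  have hroot : ∀ z, z ≠ 0 → ¬(p.eval z = 0 ∧ r.eval z = 0) := by
    rintro z - ⟨hp, hr⟩
    have hdvd : ∀ {P : Polynomial ℂ}, P ∈ degreeLT ℂ (n + 1) → P.eval z = 0 →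
        hom k ℓ ℓ 0 (Polynomial.X - Polynomial.C z) ∣ hom k ℓ (ℓ * n) 0 P := by
      intro P hP hz
      obtain ⟨P', rfl⟩ := Polynomial.dvd_iff_isRoot.mpr hz
      obtain ⟨n, rfl⟩ : ∃ t, n = t + 1 := ⟨n - 1, by omega⟩
      have hP' : P' ∈ degreeLT ℂ (n + 1) := by
        by_cases h : P' = 0
        · rw [h]; exact Submodule.zero_mem _
        rw [Polynomial.mem_degreeLT, Polynomial.degree_mul, Polynomial.degree_X_sub_C,
          Polynomial.degree_eq_natDegree h] at hP
        rw [Polynomial.mem_degreeLT, Polynomial.degree_eq_natDegree h]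
        have h2 : 1 + P'.natDegree < n + 1 + 1 := by exact_mod_cast hP
        exact_mod_cast (by omega : P'.natDegree < n + 1)
      refine ⟨hom k ℓ (ℓ * n) 0 P', ?_⟩
      rw [hom_mul, show ℓ + ℓ * n = ℓ * (n + 1) by ring]
      · rw [Nat.div_self hℓ, Polynomial.mem_degreeLT, Polynomial.degree_X_sub_C]
        norm_num
      · rwa [Nat.mul_div_cancel_left n hℓ]
    refine hcop (f := hom k ℓ ℓ 0 (Polynomial.X - Polynomial.C z)) ?_ (h0 ▸ hdvd hpm hp)
      (h1 ▸ hdvd hrm hr)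
    intro hu
    have h2 := isUnit_iff_constantCoeff.mp hu
    have h3 := hom_mem_wtIdeal k ℓ ℓ 0 (Polynomial.X - Polynomial.C z) 0
      (by rw [wt]; simp; exact ⟨hk, hℓ⟩)
    rw [coeff_zero_eq_constantCoeff_apply] at h3
    rw [h3] at h2
    exact not_isUnit_zero h2
  have hterm : ∀ {P : Polynomial ℂ} {f : Series}, (∀ s ≤ n, P.coeff s ≠ 0 →
      f ∣ X 0 ^ (ℓ * n - ℓ * s) * X 1 ^ (0 + k * s)) → f ∣ hom k ℓ (ℓ * n) 0 P := by
    intro P f h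
    refine Finset.dvd_sum fun s hs => ?_
    rw [Nat.mul_div_cancel_left n hℓ] at hs
    by_cases h2 : P.coeff s = 0
    · rw [h2, map_zero, zero_mul]; exact dvd_zero _
    · exact (h s (by have := Finset.mem_range.mp hs; omega) h2).mul_left _
  -- Without the pure power of `x` in the coefficient of `dy`, the function `y` would divide both
  -- coefficients. The top coefficient of `p` is treated symmetrically, with `x` in place of `y`.
  have hr0 : r.coeff 0 ≠ 0 := by
    intro h
    have h2 : (X 1 : Series) ∣ a₁ := by
      rw [h1]
      refine hterm fun s hs hne => (dvd_pow_self _ ?_).mul_left _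
      have : s ≠ 0 := by rintro rfl; exact hne h
      rw [zero_add]; positivity
    exact (prime_X 1).not_isUnit
      (hω.mem.isolated (ha ▸ dvd_mul_right _ _) (hb ▸ h2.mul_left _))
  have hpn : p.coeff n ≠ 0 := by
    intro h
    have h2 : (X 0 : Series) ∣ a₀ := by
      rw [h0]
      refine hterm fun s hs hne => (dvd_pow_self _ ?_).mul_right _
      have h3 : s ≠ n := by rintro rfl; exact hne h
      have : ℓ * s < ℓ * n := Nat.mul_lt_mul_of_pos_left (by omega) hℓ
      omega
    exact (prime_X 0).not_isUnit
      (hω.mem.isolated (ha ▸ h2.mul_left _) (hb ▸ dvd_mul_right _ _))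
  obtain ⟨v, w, hw, hv, hdw, hdv⟩ := exists_finalChart hk hℓ hkℓ
  -- This chart sees every point of the principal component except one corner; unimodularity of `v`
  -- and `(k, ℓ)` makes the variable of `p` and `r` the coordinate on the component.
  have L1 : ∀ z, IsLocalForm 1 0 z ((v.1 : Polynomial ℂ) * p + (v.2 : Polynomial ℂ) * r)
      ((k : Polynomial ℂ) * p + (ℓ : Polynomial ℂ) * r) (ω.pullback (chartMap v (k, ℓ) 0 z)) := by
    intro z
    have e0 : chartMap v (k, ℓ) 0 z 0 = (C z + X 1) ^ (![v.1, v.2] 0) * X 0 ^ k := by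
      simp [chartMap, mul_comm]
    have e1 : chartMap v (k, ℓ) 0 z 1 = (C z + X 1) ^ (![v.1, v.2] 1) * X 0 ^ ℓ := by
      simp [chartMap, mul_comm]
    have hε : ∀ s ≤ n, ![v.1, v.2] 0 * (ℓ * n - ℓ * s) + ![v.1, v.2] 1 * (k * s) =
        v.1 * (ℓ * n) + id s := by
      intro s hs
      simp only [Matrix.cons_val_zero, Matrix.cons_val_one, id]
      have := Nat.mul_le_mul_left ℓ hs
      zify [this] at hdv ⊢
      linear_combination (s : ℤ) * hdv
    refine isLocalForm_pullback (u := ![v.1, v.2]) (by decide) hk hℓ ?_ e0 e1 ha hb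
      (N := k * ℓ * n) (c := v.1 * (ℓ * n)) ?_ ?_
    · simp only [Matrix.cons_val_zero, Matrix.cons_val_one]
      rcases Nat.eq_zero_or_pos v.2 with h | h
      · rw [h] at hdv; omega
      · omega
    · rw [h0, subst_hom hk hℓ e0 e1 hε, shape_id hpm]
    · rw [h1, subst_hom hk hℓ e0 e1 hε, shape_id hrm]
  -- The missing corner is the origin of the other chart, where the polynomials appear with reversed
  -- coefficients.
  have L0 : IsLocalForm 0 1 0 ((w.1 : Polynomial ℂ) * shape n (fun s => n - s) p +
        (w.2 : Polynomial ℂ) * shape n (fun s => n - s) r)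
      ((k : Polynomial ℂ) * shape n (fun s => n - s) p +
        (ℓ : Polynomial ℂ) * shape n (fun s => n - s) r)
      (ω.pullback (chartMap (k, ℓ) w 0 0)) := by
    have e0 : chartMap (k, ℓ) w 0 0 0 = (C 0 + X 0) ^ (![w.1, w.2] 0) * X 1 ^ k := by
      simp [chartMap]
    have e1 : chartMap (k, ℓ) w 0 0 1 = (C 0 + X 0) ^ (![w.1, w.2] 1) * X 1 ^ ℓ := by
      simp [chartMap]
    have hε : ∀ s ≤ n, ![w.1, w.2] 0 * (ℓ * n - ℓ * s) + ![w.1, w.2] 1 * (k * s) =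
        w.2 * (k * n) + (n - s) := by
      intro s hs
      simp only [Matrix.cons_val_zero, Matrix.cons_val_one]
      have := Nat.mul_le_mul_left ℓ hs
      zify [this, hs] at hdw ⊢
      linear_combination ((n : ℤ) - s) * hdw
    refine isLocalForm_pullback (u := ![w.1, w.2]) (by decide) hk hℓ ?_ e0 e1 ha hb
      (N := k * ℓ * n) (c := w.2 * (k * n)) ?_ ?_
    · simp only [Matrix.cons_val_zero, Matrix.cons_val_one]
      rcases Nat.eq_zero_or_pos w.1 with h | h
      · rw [h] at hdw; omega
      · omega
    · rw [h0, subst_hom hk hℓ e0 e1 hε]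
    · rw [h1, subst_hom hk hℓ e0 e1 hε]
  have hdes := hω.mem.desingularizes.2
  -- Otherwise the principal component would be dicritical.
  have hq0 : (k : Polynomial ℂ) * p + (ℓ : Polynomial ℂ) * r ≠ 0 := by
    intro hq
    obtain ⟨η, ⟨hrel, g, hg, hη⟩, hx, -⟩ := hdes v (k, ℓ) hv 0 0
      ⟨by simp [hk.ne'], by simp [hℓ.ne']⟩
    refine (L1 0).ne_zero (by decide) hg hη hrel (hx rfl fun h => ?_) ?_ hq
    · have := congrArg Prod.snd h
      simp only at this; omega
    · intro hW
      have e1 : (k : Polynomial ℂ) * r * v.2 = r + ℓ * v.1 * r := by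
        have : ((v.2 * k : ℕ) : Polynomial ℂ) = ((v.1 * ℓ + 1 : ℕ) : Polynomial ℂ) := by rw [hdv]
        push_cast at this
        linear_combination r * this
      have : r = 0 := by linear_combination (k : Polynomial ℂ) * hW - (v.1 : Polynomial ℂ) * hq - e1
      rw [this] at hr0
      exact hr0 (Polynomial.coeff_zero _)
  have hcast : ∀ (a b : ℕ) (P R : Polynomial ℂ) (z : ℂ),
      ((a : Polynomial ℂ) * P + (b : Polynomial ℂ) * R).eval z = a * P.eval z + b * R.eval z := by
    intro a b P R z; simp
  refine ⟨hpm, hrm, ?_, ?_, hroot, hq0, v, hdv, ?_⟩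
  · intro α β hαβ
    have ep := eval_zero_shape_sub n p
    have er := eval_zero_shape_sub n r
    refine corner_ne_zero (u₀ := w.1) (u₁ := w.2) (fun h => hpn h.1) ?_ ?_ hαβ
    · intro hQ
      obtain ⟨η, ⟨hrel, g, hg, hη⟩, hx, -⟩ := hdes (k, ℓ) w hw 0 0
        ⟨by simp [hk.ne'], by simp [hℓ.ne']⟩
      -- Here the second branch through the corner is the strict transform of `x = 0`, not an
      -- exceptional component. Then `W(0)` is just the top coefficient of `p`.
      by_cases hw1 : w = (1, 0)
      · rw [hw1]; simpa using hpn
      · have := L0.eval_ne_zero (by decide) hg hη hrel (hx rfl hw1)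
          (by rwa [hcast, ep, er])
        rwa [hcast, ep, er] at this
    · intro hQ hW x hx
      obtain ⟨η, hrel, hg, hsing, hcs⟩ := L0.camachoSad (by decide)
        (Q₁ := (k : Polynomial ℂ) * shape n (fun s => n - s) p +
        (ℓ : Polynomial ℂ) * shape n (fun s => n - s) r) (by rw [map_zero, sub_zero])
        (by rwa [hcast, ep, er]) (by rwa [hcast, ep, er])
      rw [hcast, hcast, ep, er] at hcs
      exact hirr.1 w hw 0 η ⟨hrel, hg⟩ hsing x (hcs.trans hx)
  · intro α β hαβ
    have ep := Polynomial.coeff_zero_eq_eval_zero p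
    have er := Polynomial.coeff_zero_eq_eval_zero r
    refine corner_ne_zero (u₀ := v.1) (u₁ := v.2) (fun h => hr0 h.2) ?_ ?_ hαβ
    · intro hQ
      obtain ⟨η, ⟨hrel, g, hg, hη⟩, -, hx, -⟩ := hdes v (k, ℓ) hv 0 0
        ⟨by simp [hk.ne'], by simp [hℓ.ne']⟩
      by_cases hv1 : v = (0, 1)
      · rw [hv1]; simpa using hr0
      · have := (L1 0).eval_ne_zero (by decide) hg hη hrel (hx rfl hv1)
          (by rwa [hcast, ← ep, ← er])
        rwa [hcast, ← ep, ← er] at this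
    · intro hQ hW x hx
      obtain ⟨η, hrel, hg, hsing, hcs⟩ := (L1 0).camachoSad (by decide)
        (Q₁ := (k : Polynomial ℂ) * p + (ℓ : Polynomial ℂ) * r) (by rw [map_zero, sub_zero])
        (by rwa [hcast, ← ep, ← er]) (by rwa [hcast, ← ep, ← er])
      rw [hcast, hcast, ← ep, ← er] at hcs
      exact hirr.2 v hv 0 η ⟨hrel, hg⟩ hsing x (hcs.trans hx)
  · intro z hz hQ hW hQ' x hx
    -- Away from the corners only simple roots of `q` are considered; the cofactor of `X - z` takes
    -- the value `q'(z)` at `z`.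
    obtain ⟨Q₁, hQ₁⟩ := Polynomial.dvd_iff_isRoot.mpr hQ
    have hev : (Polynomial.X * Q₁).eval z = z * (Polynomial.derivative
        ((k : Polynomial ℂ) * p + (ℓ : Polynomial ℂ) * r)).eval z := by
      rw [hQ₁]; simp
    obtain ⟨η, hrel, hg, hsing, hcs⟩ := (L1 z).camachoSad (by decide)
      (Q₁ := Polynomial.X * Q₁) (by rw [hQ₁]; ring) (by rw [hev]; exact mul_ne_zero hz hQ') hW
    rw [hev] at hcs
    exact hirr.2 v hv z η ⟨hrel, hg⟩ hsing x (hcs.trans hx)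

end QHFoliation

end

noncomputable section

namespace QHFoliation

open MvPowerSeries
open Polynomial (degreeLT)

/-! ### Verification of the hypotheses of the homological equation -/

/-- `J` is determined by `N` modulo `k`, and `k ℓ ≤ N` leaves room for a nonnegative `I`. -/
theorem exists_lowest {k ℓ N : ℕ} (hk : 0 < k) (hc : Nat.Coprime k ℓ) (hN : k * ℓ ≤ N) :
    ∃ I J, J < k ∧ k * I + ℓ * J = N := by
  obtain ⟨J, hJ, hmod⟩ := Nat.exists_mul_mod_eq_of_coprime N hc.symm hk.ne'
  have hle : ℓ * J ≤ N := by
    have : ℓ * J ≤ ℓ * k := Nat.mul_le_mul_left _ hJ.le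
    rw [mul_comm ℓ k] at this
    omega
  obtain ⟨I, hI⟩ := (Nat.modEq_iff_dvd' hle).mp hmod
  exact ⟨I, J, hJ, by omega⟩

/-- Multiplication by `x ^ (ℓ n)` embeds the monomials of weight `m` among the `I / ℓ + 1` monomials
of weight `k ℓ n + m`; exactly the last `n`, whose exponent of `x` is less than `ℓ n`, are missed.
-/
theorem numMonomials_add {k ℓ n m I J : ℕ} (hk : 0 < k) (hℓ : 0 < ℓ) (hc : Nat.Coprime k ℓ)
    (hJ : J < k) (hm : 0 < m) (h : k * I + ℓ * J = k * ℓ * n + m) :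
    numMonomials k ℓ m + n = I / ℓ + 1 := by
  classical
  have hI : ℓ * n ≤ I + ℓ := by
    by_contra hlt
    push Not at hlt
    have h1 : k * (I + ℓ) ≤ k * (ℓ * n) := Nat.mul_le_mul_left _ hlt.le
    have h2 : ℓ * J ≤ ℓ * k := Nat.mul_le_mul_left _ hJ.le
    nlinarith
  have hdiv : n ≤ I / ℓ + 1 := by
    have h1 : n ≤ (I + ℓ) / ℓ := by
      rw [Nat.le_div_iff_mul_le hℓ]; linarith
    rwa [Nat.add_div_right _ hℓ] at h1
  have hcard : numMonomials k ℓ m = I / ℓ + 1 - n := by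
    rw [numMonomials, ← Finset.card_range (I / ℓ + 1 - n),
      ← Finset.card_image_of_injOn (f := fun s => (I - ℓ * n - ℓ * s, J + k * s))
        (s := Finset.range (I / ℓ + 1 - n))]
    · congr 1
      ext ⟨i, j⟩
      simp only [Finset.mem_filter, Finset.mem_product, Finset.mem_range, Finset.mem_image,
        Prod.mk.injEq]
      constructor
      · rintro ⟨-, hij⟩
        obtain ⟨s, hs, h1, h2⟩ := exists_of_weight_eq (I := I) (i := i + ℓ * n) (j := j) hk hc hJ
          (by rw [h, ← hij]; ring)
        refine ⟨s, ?_, by omega, h2.symm⟩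
        have h3 : s + n ≤ I / ℓ := by
          rw [Nat.le_div_iff_mul_le hℓ]
          have : (s + n) * ℓ = ℓ * s + ℓ * n := by ring
          omega
        omega
      · rintro ⟨s, hs, rfl, rfl⟩
        have h3 : (s + n) * ℓ ≤ I := (Nat.le_div_iff_mul_le hℓ).mp (by omega)
        have h4 : (s + n) * ℓ = ℓ * s + ℓ * n := by ring
        obtain ⟨t, ht⟩ := Nat.exists_eq_add_of_le (by omega : ℓ * s + ℓ * n ≤ I)
        have h5 : I - ℓ * n - ℓ * s = t := by omega
        have h6 : k * t + ℓ * (J + k * s) = m := by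
          rw [ht] at h; nlinarith
        rw [h5]
        refine ⟨⟨?_, ?_⟩, h6⟩
        · have : 1 * t ≤ k * t := Nat.mul_le_mul_right _ hk
          omega
        · have : 1 * (J + k * s) ≤ ℓ * (J + k * s) := Nat.mul_le_mul_right _ hℓ
          omega
    · intro s _ t _ hst
      simp only [Prod.mk.injEq] at hst
      have := hst.2
      exact Nat.eq_of_mul_eq_mul_left hk (by omega)
  omega

variable {k ℓ n : ℕ} {p r : Polynomial ℂ}

/-- The polynomial data of the homological equation in the weight `m`. -/
def polyData (h : IsAdmissible k ℓ n p r) (hk : 0 < k) (hℓ : 0 < ℓ) {m I J : ℕ} (hm : 0 < m)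
    (hIJ : k * I + ℓ * J = k * ℓ * n + m) : PolyData where
  k := k
  ℓ := ℓ
  n := n
  p := p
  r := r
  m := m
  i := I - ℓ * n
  j := J
  e := numMonomials k ℓ m
  k_pos := hk
  ℓ_pos := hℓ
  m_pos := hm
  weight := by
    have : ((k * I + ℓ * J : ℕ) : ℂ) = ((k * ℓ * n + m : ℕ) : ℂ) := by rw [hIJ]
    push_cast at this
    linear_combination this
  p_mem := h.p_mem
  r_mem := h.r_mem

theorem IsAdmissible.coeff_p_ne (h : IsAdmissible k ℓ n p r) (hℓ : 0 < ℓ) :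
    p.coeff n ≠ 0 ∧ p.coeff 0 ≠ 0 := by
  have h1 : (1 : ℤ) * ℓ ≠ 0 * k := by
    rw [one_mul, zero_mul]; exact_mod_cast hℓ.ne'
  have h2 := h.top 1 0 h1
  have h3 := h.bot 1 0 h1
  simp only [Int.cast_one, one_mul, Int.cast_zero, zero_mul, add_zero] at h2 h3
  exact ⟨h2, h3⟩

/-- The diagonal entry at `s` is the combination of the top coefficients of `p` and `r` with the
integers `-(J + k s)` and `I - ℓ n - ℓ s`. The determinant of this pair with `(k, ℓ)` is `-m ≠ 0`,
so the corner condition applies. -/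
theorem radial_polyData (h : IsAdmissible k ℓ n p r) (hk : 0 < k) (hℓ : 0 < ℓ) {m I J : ℕ}
    (hm : 0 < m) (hIJ : k * I + ℓ * J = k * ℓ * n + m) : (polyData h hk hℓ hm hIJ).Radial := by
  intro s _
  have := h.top (-(J + k * s)) (I - ℓ * n - ℓ * s) (by
    intro h0
    have : ((k * I + ℓ * J : ℕ) : ℤ) = ((k * ℓ * n + m : ℕ) : ℤ) := by rw [hIJ]
    push_cast at this
    have hm' : (m : ℤ) = 0 := by linear_combination -h0 - this
    omega)
  intro h0
  apply this
  push_cast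
  simp only [polyData] at h0
  linear_combination h0

/-- If both top coefficients vanish, so does that of `q` by `contraction_AB`, and then `m p_n = 0`,
whereas `p_n ≠ 0`. -/
theorem coeff_A_B_ne (h : IsAdmissible k ℓ n p r) (hk : 0 < k) (hℓ : 0 < ℓ) {m I J : ℕ}
    (hm : 0 < m) (hIJ : k * I + ℓ * J = k * ℓ * n + m) :
    (polyData h hk hℓ hm hIJ).A.coeff n ≠ 0 ∨ (polyData h hk hℓ hm hIJ).B.coeff n ≠ 0 := by
  by_contra hcon
  push Not at hcon
  have h1 := congrArg (fun P => P.coeff n) (polyData h hk hℓ hm hIJ).contraction_AB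
  simp only [Polynomial.coeff_add, Polynomial.coeff_natCast_mul, hcon.1, hcon.2,
    Polynomial.coeff_C_mul, mul_zero, add_zero] at h1
  have hq := (mul_eq_zero.mp h1.symm).resolve_left (polyData h hk hℓ hm hIJ).total_ne_zero
  have h2 := hcon.1
  rw [PolyData.A, Polynomial.coeff_add, Polynomial.coeff_add, coeff_polyE0, hq, mul_zero, add_zero,
    add_zero, Polynomial.coeff_natCast_mul] at h2
  exact (h.coeff_p_ne hℓ).1 ((mul_eq_zero.mp h2).resolve_left (Nat.cast_ne_zero.mpr hm.ne'))

/-- At a common root `z` one finds `q(z) = 0`, `m p(z) = ℓ z q'(z)` and `m r(z) = -k z q'(z)`. Both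
`z` and `q'(z)` are nonzero, since `p(0) ≠ 0` and since `p` and `r` have no common root off `0`. By
unimodularity the index at this point is `1 / m`, which is rational. -/
theorem isCoprime_A_B (h : IsAdmissible k ℓ n p r) (hk : 0 < k) (hℓ : 0 < ℓ) {m I J : ℕ}
    (hm : 0 < m) (hIJ : k * I + ℓ * J = k * ℓ * n + m) :
    IsCoprime (polyData h hk hℓ hm hIJ).A (polyData h hk hℓ hm hIJ).B := by
  refine (Polynomial.isCoprime_iff_aeval_ne_zero_of_isAlgClosed ℂ ℂ _ _).mpr fun z => ?_
  by_contra hcon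
  push Not at hcon
  obtain ⟨hA, hB⟩ := hcon
  rw [Polynomial.coe_aeval_eq_eval] at hA hB
  have h1 := congrArg (Polynomial.eval z) (polyData h hk hℓ hm hIJ).contraction_AB
  simp only [Polynomial.eval_add, Polynomial.eval_mul, hA, hB, Polynomial.eval_C, mul_zero,
    add_zero] at h1
  have hq := (mul_eq_zero.mp h1.symm).resolve_left (polyData h hk hℓ hm hIJ).total_ne_zero
  have hm' : (m : ℂ) ≠ 0 := Nat.cast_ne_zero.mpr hm.ne'
  have eA : (m : ℂ) * p.eval z = ℓ * (z * (Polynomial.derivative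
      ((k : Polynomial ℂ) * p + (ℓ : Polynomial ℂ) * r)).eval z) := by
    rw [PolyData.A, polyE0] at hA
    simp only [Polynomial.eval_add, Polynomial.eval_sub, Polynomial.eval_mul, hq,
      Polynomial.eval_natCast, Polynomial.eval_X, mul_zero, add_zero, zero_sub] at hA
    simp only [polyData, PolyData.q] at hA
    linear_combination hA
  have eB : (m : ℂ) * r.eval z = -k * (z * (Polynomial.derivative
      ((k : Polynomial ℂ) * p + (ℓ : Polynomial ℂ) * r)).eval z) := by
    rw [PolyData.B, polyE1] at hB
    simp only [Polynomial.eval_add, Polynomial.eval_mul, hq,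
      Polynomial.eval_natCast, Polynomial.eval_X, mul_zero, add_zero, zero_add] at hB
    simp only [polyData, PolyData.q] at hB
    linear_combination hB
  set q' := (Polynomial.derivative ((k : Polynomial ℂ) * p + (ℓ : Polynomial ℂ) * r)).eval z
    with hq'
  have hz : z ≠ 0 := by
    rintro rfl
    rw [zero_mul, mul_zero, ← Polynomial.coeff_zero_eq_eval_zero] at eA
    exact (h.coeff_p_ne hℓ).2 ((mul_eq_zero.mp eA).resolve_left hm')
  have hq0 : q' ≠ 0 := by
    intro h0
    rw [h0, mul_zero, mul_zero] at eA eB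
    exact h.no_root z hz ⟨(mul_eq_zero.mp eA).resolve_left hm',
      (mul_eq_zero.mp eB).resolve_left hm'⟩
  obtain ⟨v, hdet, hirr⟩ := h.exists_chart
  have hdet' : (v.2 : ℂ) * k = v.1 * ℓ + 1 := by exact_mod_cast hdet
  have eW : (m : ℂ) * ((v.1 : Polynomial ℂ) * p + (v.2 : Polynomial ℂ) * r).eval z =
      -(z * q') := by
    simp only [Polynomial.eval_add, Polynomial.eval_mul, Polynomial.eval_natCast]
    linear_combination (v.1 : ℂ) * eA + v.2 * eB - z * q' * hdet'
  have hzq : z * q' ≠ 0 := mul_ne_zero hz hq0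
  refine hirr z hz hq ?_ hq0 (1 / m) ?_
  · intro h0
    rw [h0, mul_zero] at eW
    exact hzq (neg_eq_zero.mp eW.symm)
  · rw [← hq']
    push_cast
    rw [← neg_div, div_eq_div_iff hzq hm']
    linear_combination -eW

variable {ω : OneForm}

/-! ### Identification of the matrix `M_m` and the levels in all weights. -/

theorem radialPart_eq (ha : ω.a = X 1 * hom k ℓ (ℓ * n) 0 p) (hb : ω.b = X 0 * hom k ℓ (ℓ * n) 0 r) :
    radialPart k ℓ ω =
      X 0 * X 1 * hom k ℓ (ℓ * n) 0 ((k : Polynomial ℂ) * p + (ℓ : Polynomial ℂ) * r) := by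
  rw [radialPart, ha, hb, hom_add, hom_natCast_mul, hom_natCast_mul]
  ring

theorem seriesA_eq (ha : ω.a = X 1 * hom k ℓ (ℓ * n) 0 p) (hb : ω.b = X 0 * hom k ℓ (ℓ * n) 0 r)
    (m : ℕ) : seriesA k ℓ m ω = X 1 * hom k ℓ (ℓ * n) 0 ((m : Polynomial ℂ) * p +
      ((k : Polynomial ℂ) * p + (ℓ : Polynomial ℂ) * r) +
      polyE0 ℓ (ℓ * n) ((k : Polynomial ℂ) * p + (ℓ : Polynomial ℂ) * r)) := by
  have h := eu_zero_hom k ℓ (ℓ * n) 0 ((k : Polynomial ℂ) * p + (ℓ : Polynomial ℂ) * r)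
  rw [Nat.cast_mul, eu_apply] at h
  rw [seriesA, radialPart_eq ha hb, dX]
  generalize (k : Polynomial ℂ) * p + (ℓ : Polynomial ℂ) * r = q at h ⊢
  rw [ Derivation.leibniz, Derivation.leibniz, pderiv_X_self,
    pderiv_X_of_ne (by decide : (1 : Fin 2) ≠ 0), ha, hom_add, hom_add, hom_natCast_mul, ← h]
  simp only [smul_eq_mul]
  ring

theorem seriesB_eq (ha : ω.a = X 1 * hom k ℓ (ℓ * n) 0 p) (hb : ω.b = X 0 * hom k ℓ (ℓ * n) 0 r)
    (m : ℕ) : seriesB k ℓ m ω = X 0 * hom k ℓ (ℓ * n) 0 ((m : Polynomial ℂ) * r +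
      ((k : Polynomial ℂ) * p + (ℓ : Polynomial ℂ) * r) +
      polyE1 k 0 ((k : Polynomial ℂ) * p + (ℓ : Polynomial ℂ) * r)) := by
  have h := eu_one_hom k ℓ (ℓ * n) 0 ((k : Polynomial ℂ) * p + (ℓ : Polynomial ℂ) * r)
  rw [Nat.cast_zero, eu_apply] at h
  rw [seriesB, radialPart_eq ha hb, dY]
  generalize (k : Polynomial ℂ) * p + (ℓ : Polynomial ℂ) * r = q at h ⊢
  rw [ Derivation.leibniz, Derivation.leibniz, pderiv_X_self,
    pderiv_X_of_ne (by decide : (0 : Fin 2) ≠ 1), hb, hom_add, hom_add, hom_natCast_mul, ← h]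
  simp only [smul_eq_mul]
  ring

theorem coeffA_eq (h : IsAdmissible k ℓ n p r) (hk : 0 < k) (hℓ : 0 < ℓ) {m I J : ℕ}
    (hm : 0 < m) (hIJ : k * I + ℓ * J = k * ℓ * n + m)
    (ha : ω.a = X 1 * hom k ℓ (ℓ * n) 0 p) (hb : ω.b = X 0 * hom k ℓ (ℓ * n) 0 r) (t : ℤ) :
    coeffA k ℓ n m ω t = PolyData.icoeff (polyData h hk hℓ hm hIJ).A t := by
  rw [coeffA, PolyData.icoeff]
  by_cases h0 : 0 ≤ t
  · obtain ⟨s, rfl⟩ := Int.eq_ofNat_of_zero_le h0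
    rw [if_pos h0, Int.toNat_natCast]
    by_cases hs : s ≤ n
    · have e : expo (ℓ * (n - s)) (k * s + 1) =
          expo (ℓ * n - ℓ * s) (0 + k * s) + Finsupp.single 1 1 := by
        simp only [expo, Finsupp.single_add, zero_add, Nat.mul_sub, add_assoc]
      rw [if_pos ⟨h0, by exact_mod_cast hs⟩, seriesA_eq ha hb, e, coeff_X_mul_expo, coeff_hom hk]
      · rfl
      · rw [Nat.mul_div_cancel_left n hℓ]; omega
    · rw [if_neg fun hc => hs (by exact_mod_cast hc.2)]
      exact (mem_degreeLT_iff.mp (polyData h hk hℓ hm hIJ).A_mem s (by change n + 1 ≤ s; omega)).symm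
  · rw [if_neg h0, if_neg fun hc => h0 hc.1]

/-- The index is reversed because `B_i` is numbered by powers of `x ^ ℓ`, whereas the polynomial `B`
is numbered by powers of `y ^ k`. -/
theorem coeffB_eq (h : IsAdmissible k ℓ n p r) (hk : 0 < k) (hℓ : 0 < ℓ) {m I J : ℕ}
    (hm : 0 < m) (hIJ : k * I + ℓ * J = k * ℓ * n + m)
    (ha : ω.a = X 1 * hom k ℓ (ℓ * n) 0 p) (hb : ω.b = X 0 * hom k ℓ (ℓ * n) 0 r) (t : ℤ) :
    coeffB k ℓ n m ω t = PolyData.icoeff (polyData h hk hℓ hm hIJ).B (n - t) := by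
  rw [coeffB, PolyData.icoeff]
  by_cases h0 : 0 ≤ (n : ℤ) - t
  · obtain ⟨s, hs⟩ := Int.eq_ofNat_of_zero_le h0
    rw [if_pos h0, hs, Int.toNat_natCast]
    by_cases hsn : s ≤ n
    · have ht : t = ((n - s : ℕ) : ℤ) := by omega
      have e : expo (ℓ * (n - s) + 1) (k * (n - (n - s))) =
          expo (ℓ * n - ℓ * s) (0 + k * s) + Finsupp.single 0 1 := by
        rw [Nat.sub_sub_self hsn]
        simp only [expo, Finsupp.single_add, zero_add, Nat.mul_sub]
        abel
      rw [if_pos ⟨by omega, by omega⟩, ht, Int.toNat_natCast, seriesB_eq ha hb, e,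
        coeff_X_mul_expo, coeff_hom hk]
      · rfl
      · rw [Nat.mul_div_cancel_left n hℓ]; omega
    · rw [if_neg fun hc => hsn (by omega)]
      exact (mem_degreeLT_iff.mp (polyData h hk hℓ hm hIJ).B_mem s (by change n + 1 ≤ s; omega)).symm
  · rw [if_neg h0, if_neg fun hc => h0 (by omega)]

/-- Below weight `k ℓ n` the determinant condition is used. From `k ℓ n` on there are at least `n`
monomials of weight `m`, and coprimality of `A` and `B` is enough. -/
theorem hamiltonian_polyData (h : IsAdmissible k ℓ n p r) (hk : 0 < k) (hℓ : 0 < ℓ)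
    (hc : Nat.Coprime k ℓ) {m I J : ℕ} (hJ : J < k)
    (hm : 0 < m) (hIJ : k * I + ℓ * J = k * ℓ * n + m)
    (ha : ω.a = X 1 * hom k ℓ (ℓ * n) 0 p) (hb : ω.b = X 0 * hom k ℓ (ℓ * n) 0 r)
    (hdet : m ≤ k * ℓ * n - 1 → (matrixM k ℓ n m ω).det ≠ 0) :
    (polyData h hk hℓ hm hIJ).Hamiltonian := by
  by_cases hmn : m ≤ k * ℓ * n - 1
  · apply PolyData.hamiltonian_of_det
    have := hdet hmn
    have hM : matrixM k ℓ n m ω = Matrix.fromBlocks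
        (Matrix.of fun r s : Fin (numMonomials k ℓ m) =>
          PolyData.icoeff (polyData h hk hℓ hm hIJ).A ((r : ℕ) - (s : ℕ)))
        (Matrix.of fun r s : Fin (numMonomials k ℓ m) =>
          PolyData.icoeff (polyData h hk hℓ hm hIJ).B ((r : ℕ) - (s : ℕ)))
        (Matrix.of fun r s : Fin (numMonomials k ℓ m) =>
          PolyData.icoeff (polyData h hk hℓ hm hIJ).A ((n : ℤ) + (r : ℕ) - (s : ℕ)))
        (Matrix.of fun r s : Fin (numMonomials k ℓ m) =>
          PolyData.icoeff (polyData h hk hℓ hm hIJ).B ((n : ℤ) + (r : ℕ) - (s : ℕ))) := by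
      rw [matrixM]
      congr 1
      · ext a b; exact coeffA_eq h hk hℓ hm hIJ ha hb _
      · ext a b
        simp only [Matrix.of_apply]
        rw [coeffB_eq h hk hℓ hm hIJ ha hb]
        congr 1; ring
      · ext a b; exact coeffA_eq h hk hℓ hm hIJ ha hb _
      · ext a b
        simp only [Matrix.of_apply]
        rw [coeffB_eq h hk hℓ hm hIJ ha hb]
        congr 1; ring
    rw [hM] at this
    exact this
  · refine PolyData.hamiltonian_of_coprime _ ?_ (isCoprime_A_B h hk hℓ hm hIJ)
      (coeff_A_B_ne h hk hℓ hm hIJ)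
    have h1 := numMonomials_add hk hℓ hc hJ hm hIJ
    change n ≤ numMonomials k ℓ m
    have h2 : 2 * n ≤ I / ℓ + 1 := by
      have h3 : 2 * n ≤ (I + ℓ) / ℓ := by
        rw [Nat.le_div_iff_mul_le hℓ]
        by_contra hlt
        push Not at hlt
        have h4 : k * (I + ℓ) ≤ k * (2 * n * ℓ) := Nat.mul_le_mul_left _ hlt.le
        have h4' : k * (I + ℓ + 1) ≤ k * (2 * n * ℓ) := Nat.mul_le_mul_left _ hlt
        have h5 : ℓ * (J + 1) ≤ ℓ * k := Nat.mul_le_mul_left _ hJ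
        have h6 : k * ℓ * n ≤ m := by omega
        nlinarith
      rwa [Nat.add_div_right _ hℓ] at h3
    omega

/-- The level of the homological equation in the weight `m`. -/
def level (h : IsAdmissible k ℓ n p r) (hk : 0 < k) (hℓ : 0 < ℓ)
    (hc : Nat.Coprime k ℓ) {m I J : ℕ} (hJ : J < k)
    (hm : 0 < m) (hIJ : k * I + ℓ * J = k * ℓ * n + m) : Level (polyData h hk hℓ hm hIJ) where
  I := I
  J := J
  J_lt := hJ
  weight := hIJ
  hi := rfl
  hj := rfl
  he := numMonomials_add hk hℓ hc hJ hm hIJ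
  coprime := hc

theorem exists_level (h : IsAdmissible k ℓ n p r) (hk : 0 < k) (hℓ : 0 < ℓ) (hn : 0 < n)
    (hc : Nat.Coprime k ℓ)
    (ha : ω.a = X 1 * hom k ℓ (ℓ * n) 0 p) (hb : ω.b = X 0 * hom k ℓ (ℓ * n) 0 r)
    (hgen : Generic k ℓ n ω) {m : ℕ} (hm : 0 < m) :
    ∃ (D : PolyData) (_ : Level D), D.k = k ∧ D.ℓ = ℓ ∧ D.n = n ∧ D.p = p ∧ D.r = r ∧ D.m = m ∧
      D.Hamiltonian ∧ D.Radial := by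
  obtain ⟨I, J, hJ, hIJ⟩ := exists_lowest (N := k * ℓ * n + m) hk hc
    ((Nat.le_mul_of_pos_right _ hn).trans (Nat.le_add_right _ _))
  exact ⟨polyData h hk hℓ hm hIJ, level h hk hℓ hc hJ hm hIJ, rfl, rfl, rfl, rfl, rfl, rfl,
    hamiltonian_polyData h hk hℓ hc hJ hm hIJ ha hb fun hmn => hgen.2 m hm hmn,
    radial_polyData h hk hℓ hm hIJ⟩

end QHFoliation

end

noncomputable section

namespace QHFoliation

open MvPowerSeries

/-! ### Weighted order and limits -/

theorem weight_eq_wt (w : Fin 2 → ℕ) (e : Fin 2 →₀ ℕ) : Finsupp.weight w e = wt w e := by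
  rw [Finsupp.weight_apply, Finsupp.sum_fintype _ _ (by simp), Fin.sum_univ_two, wt, smul_eq_mul,
    smul_eq_mul, mul_comm, mul_comm (e 1)]

theorem mem_wtIdeal_iff_le {w : Fin 2 → ℕ} {N : ℕ} {f : Series} :
    f ∈ wtIdeal w N ↔ (N : ℕ∞) ≤ f.weightedOrder w := by
  constructor
  · intro h
    refine nat_le_weightedOrder w fun e he => h e ?_
    rwa [weight_eq_wt] at he
  · intro h e he
    refine coeff_eq_zero_of_lt_weightedOrder w (lt_of_lt_of_le ?_ h)
    rw [weight_eq_wt]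
    exact_mod_cast he

/-- The weighted order is additive on products, so a factor of order at most `N` can be cancelled.
-/
theorem of_mul_mem_wtIdeal {w : Fin 2 → ℕ} {N m : ℕ} {f g : Series} (hg : g ∉ wtIdeal w (N + 1))
    (h : f * g ∈ wtIdeal w (N + m)) : f ∈ wtIdeal w m := by
  rw [mem_wtIdeal_iff_le] at *
  push Not at hg
  rw [weightedOrder_mul] at h
  obtain ⟨b, hb⟩ := ENat.ne_top_iff_exists.mp (ne_top_of_lt hg)
  rw [← hb] at h hg
  induction hf : f.weightedOrder w with
  | top => exact le_top
  | coe a =>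
    rw [hf] at h
    norm_cast at *
    omega

/-- Completeness for the filtration: the coefficient at `e` is stationary from the index `wt w e +
1` on. -/
theorem exists_limit {w : Fin 2 → ℕ} {c : ℕ} {f : ℕ → Series}
    (h : ∀ m, f (m + 1) - f m ∈ wtIdeal w (c + m)) : ∃ g, ∀ m, g - f m ∈ wtIdeal w (c + m) := by
  have hle : ∀ m t, f (m + t) - f m ∈ wtIdeal w (c + m) := by
    intro m t
    induction t with
    | zero => rw [add_zero, sub_self]; exact Ideal.zero_mem _
    | succ t ih =>
      have := Ideal.add_mem _ (wtIdeal_mono (by omega : c + m ≤ c + (m + t)) (h (m + t))) ih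
      rwa [sub_add_sub_cancel, add_assoc] at this
  obtain ⟨g, hg⟩ : ∃ g : Series, ∀ e, coeff e g = coeff e (f (wt w e + 1)) :=
    ⟨fun e => coeff e (f (wt w e + 1)), fun _ => rfl⟩
  refine ⟨g, fun m e he => ?_⟩
  rw [map_sub, sub_eq_zero, hg]
  rcases le_total m (wt w e + 1) with hm | hm
  · obtain ⟨t, ht⟩ := Nat.exists_eq_add_of_le hm
    rw [ht, ← sub_eq_zero, ← map_sub]
    exact hle m t e he
  · obtain ⟨t, ht⟩ := Nat.exists_eq_add_of_le hm
    rw [ht, ← sub_eq_zero (b := coeff e (f (wt w e + 1 + t))), ← neg_sub, ← map_sub,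
      hle (wt w e + 1) t e (by omega), neg_zero]

/-! ### Conjugacies which preserve the axes -/

/-- The map `(x f₀, y f₁)`. -/
def scale (f : Fin 2 → Series) : Fin 2 → Series := fun i => X i * f i

/-- The form `B₀ y dx + B₁ x dy`. -/
def crossForm (B : Fin 2 → Series) : Fin 2 → Series := ![X 1 * B 0, X 0 * B 1]

theorem crossForm_zero (B : Fin 2 → Series) : crossForm B 0 = X 1 * B 0 := rfl

theorem crossForm_one (B : Fin 2 → Series) : crossForm B 1 = X 0 * B 1 := rfl

theorem X_mul_crossForm (B : Fin 2 → Series) (i : Fin 2) :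
    X i * crossForm B i = X 0 * X 1 * B i := by
  fin_cases i
  · change X 0 * (X 1 * B 0) = X 0 * X 1 * B 0
    ring
  · change X 1 * (X 0 * B 1) = X 0 * X 1 * B 1
    ring

/-- The Lie derivative of the initial form along `(x f₀, y f₁)`, plus a multiple of the initial
form. -/
def lieForm (B f : Fin 2 → Series) (v : Series) : Fin 2 → Series :=
  ![Level.lie0 (B 0) (B 1) (f 0) (f 1) v, Level.lie1 (B 0) (B 1) (f 0) (f 1) v]

/-- The normal form `d(xyh) + s (ℓ y dx - k x dy)`. -/
def normalPart (k ℓ : ℕ) (h s : Series) : Fin 2 → Series := ![Level.nf0 ℓ h s, Level.nf1 k h s]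

theorem normalPart_mem {w : Fin 2 → ℕ} {N : ℕ} (k ℓ : ℕ) {h s : Series} (hh : h ∈ wtIdeal w N)
    (hs : s ∈ wtIdeal w N) (i : Fin 2) : normalPart k ℓ h s i ∈ wtIdeal w N := by
  fin_cases i
  · exact Level.nf0_mem hh hs
  · exact Level.nf1_mem hh hs

theorem normalPart_sub (k ℓ : ℕ) (h s h' s' : Series) :
    normalPart k ℓ (h - h') (s - s') = normalPart k ℓ h s - normalPart k ℓ h' s' := by
  ext1 i
  fin_cases i
  · exact Level.nf0_sub ℓ h s h' s'
  · exact Level.nf1_sub k h s h' s'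

theorem lieForm_mem {w : Fin 2 → ℕ} {N m : ℕ} {B f : Fin 2 → Series} {v : Series}
    (hB : ∀ i, B i ∈ wtIdeal w N) (hf : ∀ i, f i ∈ wtIdeal w m) (hv : v ∈ wtIdeal w m)
    (i : Fin 2) : lieForm B f v i ∈ wtIdeal w (N + m) := by
  fin_cases i
  · exact Level.lie0_mem (hB 0) (hB 1) (hf 0) (hf 1) hv
  · exact Level.lie1_mem (hB 0) (hB 1) (hf 0) (hf 1) hv

theorem field_scale (f : Fin 2 → Series) (g : Series) :
    field (scale f) g = f 0 * eu 0 g + f 1 * eu 1 g := by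
  rw [field_apply, eu_apply, eu_apply, scale, scale]; ring

theorem eu_X_mul_self (i : Fin 2) (f : Series) : eu i (X i * f) = X i * (f + eu i f) := by
  rw [Derivation.leibniz, eu_X_self, smul_eq_mul, smul_eq_mul]; ring

theorem eu_X_mul_ne {i j : Fin 2} (h : i ≠ j) (f : Series) :
    eu i (X j * f) = X j * eu i f := by
  rw [Derivation.leibniz, eu_X_ne h, smul_eq_mul, smul_eq_mul]; ring

/-- For fields tangent to the axes and forms leaving the axes invariant, everything in logarithmic
coordinates is divisible by `xy`; the quotient is the operator of the homological equation. -/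
theorem logLie_scale (B f : Fin 2 → Series) (v : Series) (i : Fin 2) :
    logLie (scale f) (crossForm B) i + v * (X i * crossForm B i) =
      X 0 * X 1 * lieForm B f v i := by
  have h01 : (0 : Fin 2) ≠ 1 := by decide
  fin_cases i
  · change logLie (scale f) (crossForm B) 0 + v * (X 0 * crossForm B 0) =
      X 0 * X 1 * Level.lie0 (B 0) (B 1) (f 0) (f 1) v
    rw [logLie, field_scale, crossForm_zero, crossForm_one, scale, scale, eu_X_mul_ne h01,
      eu_X_mul_self, eu_X_mul_self, eu_X_mul_ne h01, Level.lie0]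
    ring
  · change logLie (scale f) (crossForm B) 1 + v * (X 1 * crossForm B 1) =
      X 0 * X 1 * Level.lie1 (B 0) (B 1) (f 0) (f 1) v
    rw [logLie, field_scale, crossForm_zero, crossForm_one, scale, scale, eu_X_mul_ne h01.symm,
      eu_X_mul_self, eu_X_mul_self, eu_X_mul_ne h01.symm, Level.lie1]
    ring

theorem dvd_logPullback_scale {f a : Fin 2 → Series} (hf : HasSubst (scale f)) (i : Fin 2) :
    X 0 * X 1 ∣ logPullback (scale f) (crossForm a) i := by
  have h0 : ∀ j, X j ∣ eu i (X j * f j) := fun j => by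
    by_cases h : i = j
    · subst h; rw [eu_X_mul_self]; exact dvd_mul_right _ _
    · rw [eu_X_mul_ne h]; exact dvd_mul_right _ _
  rw [logPullback, crossForm_zero, crossForm_one, subst_mul hf, subst_mul hf, subst_X hf,
    subst_X hf, scale, scale]
  refine dvd_add ?_ ?_
  · rw [mul_comm (X 0 : Series)]
    exact mul_dvd_mul ((dvd_mul_right _ _).mul_right _) (h0 0)
  · exact mul_dvd_mul ((dvd_mul_right _ _).mul_right _) (h0 1)

theorem X_mul_mem_wtIdeal {w : Fin 2 → ℕ} {N : ℕ} {g : Series} (i : Fin 2)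
    (h : g ∈ wtIdeal w N) : X i * g ∈ wtIdeal w (w i + N) :=
  mul_mem_wtIdeal (X_mem_wtIdeal w i) h

theorem X_mul_X_mul_mem_iff {w : Fin 2 → ℕ} {N : ℕ} {g : Series} :
    X 0 * X 1 * g ∈ wtIdeal w (N + w 0 + w 1) ↔ g ∈ wtIdeal w N := by
  constructor
  · intro h
    refine of_X_mul_mem_wtIdeal (i := 0) (of_X_mul_mem_wtIdeal (i := 1) ?_)
    convert h using 1
    ring
  · intro h
    have := X_mul_mem_wtIdeal 0 (X_mul_mem_wtIdeal 1 h)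
    rw [← mul_assoc] at this
    exact wtIdeal_mono (by omega) this

/-! ### Construction of the conjugacy, weight by weight. -/

/-- The data of an orbital equivalence with a normal form, up to some order. -/
structure Datum where
  /-- the change of coordinates is `(x f₀, y f₁)` -/
  f : Fin 2 → Series
  /-- the unit -/
  u : Series
  /-- the hamiltonian part of the normal form -/
  h : Series
  /-- the radial part of the normal form -/
  s : Series

/-- The standing assumptions: `B` is the initial part of `a`, and the homological equation can be
solved. -/
structure Setting (k ℓ n : ℕ) (B a : Fin 2 → Series) : Prop where
  k_pos : 0 < k
  ℓ_pos : 0 < ℓ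
  n_pos : 0 < n
  B_mem : ∀ i, B i ∈ wtIdeal (wts k ℓ) (k * ℓ * n)
  B_not_mem : B 0 ∉ wtIdeal (wts k ℓ) (k * ℓ * n + 1)
  a_sub : ∀ i, a i - B i ∈ wtIdeal (wts k ℓ) (k * ℓ * n + 1)
  exists_step : ∀ m, 0 < m → ∀ T : Fin 2 → Series,
    (∀ i, T i ∈ wtIdeal (wts k ℓ) (k * ℓ * n + m)) →
    ∃ (f : Fin 2 → Series) (v h s : Series), (∀ i, f i ∈ wtIdeal (wts k ℓ) m) ∧
      v ∈ wtIdeal (wts k ℓ) m ∧ h ∈ wtIdeal (wts k ℓ) (k * ℓ * n + m) ∧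
      s ∈ wtIdeal (wts k ℓ) (k * ℓ * n + m) ∧
      (∀ e, coeff e h ≠ 0 → e 0 < ℓ * n ∧ e 1 < k * n) ∧ (∀ e, coeff e s ≠ 0 → e 1 < k * n) ∧
      ∀ i, lieForm B f v i + T i - normalPart k ℓ h s i ∈ wtIdeal (wts k ℓ) (k * ℓ * n + m + 1)
  unique_step : ∀ m, 0 < m → ∀ (f : Fin 2 → Series) (v h s : Series),
    (∀ i, f i ∈ wtIdeal (wts k ℓ) m) → v ∈ wtIdeal (wts k ℓ) m →
    h ∈ wtIdeal (wts k ℓ) (k * ℓ * n + m) → s ∈ wtIdeal (wts k ℓ) (k * ℓ * n + m) →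
    (∀ e, coeff e h ≠ 0 → e 0 < ℓ * n ∧ e 1 < k * n) → (∀ e, coeff e s ≠ 0 → e 1 < k * n) →
    (∀ i, lieForm B f v i - normalPart k ℓ h s i ∈ wtIdeal (wts k ℓ) (k * ℓ * n + m + 1)) →
    h ∈ wtIdeal (wts k ℓ) (k * ℓ * n + m + 1) ∧ s ∈ wtIdeal (wts k ℓ) (k * ℓ * n + m + 1) ∧
    ∃ g : Series, (g = 0 ∨ ∃ M, M + k * ℓ * n = m ∧ g ∈ wtIdeal (wts k ℓ) M) ∧
      f 0 - g * B 1 ∈ wtIdeal (wts k ℓ) (m + 1) ∧ f 1 + g * B 0 ∈ wtIdeal (wts k ℓ) (m + 1)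

/-- The datum is an equivalence up to the weight `N` relative to the initial form. -/
structure Datum.IsConj (k ℓ n : ℕ) (B a : Fin 2 → Series) (N : ℕ) (x : Datum) : Prop where
  f_sub : ∀ i, x.f i - 1 ∈ wtIdeal (wts k ℓ) 1
  u_sub : x.u - 1 ∈ wtIdeal (wts k ℓ) 1
  h_mem : x.h ∈ wtIdeal (wts k ℓ) (k * ℓ * n + 1)
  s_mem : x.s ∈ wtIdeal (wts k ℓ) (k * ℓ * n + 1)
  h_supp : ∀ e, coeff e x.h ≠ 0 → e 0 < ℓ * n ∧ e 1 < k * n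
  s_supp : ∀ e, coeff e x.s ≠ 0 → e 1 < k * n
  conj : ∀ i, x.u * logPullback (scale x.f) (crossForm a) i -
    X 0 * X 1 * (B i + normalPart k ℓ x.h x.s i) ∈ wtIdeal (wts k ℓ) (k * ℓ * n + N + k + ℓ)

/-- Two data which agree up to the weight `m`. -/
structure Datum.Close (k ℓ n m : ℕ) (x y : Datum) : Prop where
  f : ∀ i, x.f i - y.f i ∈ wtIdeal (wts k ℓ) m
  u : x.u - y.u ∈ wtIdeal (wts k ℓ) m
  h : x.h - y.h ∈ wtIdeal (wts k ℓ) (k * ℓ * n + m)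
  s : x.s - y.s ∈ wtIdeal (wts k ℓ) (k * ℓ * n + m)

variable {k ℓ n : ℕ} {B a : Fin 2 → Series}

theorem scale_sub_X_mem {f : Fin 2 → Series} {w : Fin 2 → ℕ} {m : ℕ}
    (h : ∀ i, f i - 1 ∈ wtIdeal w m) (i : Fin 2) : scale f i - X i ∈ wtIdeal w (w i + m) := by
  have := X_mul_mem_wtIdeal i (h i)
  rwa [mul_sub, mul_one] at this

theorem scale_sub (f g : Fin 2 → Series) : scale f - scale g = scale (f - g) := by
  ext1 i
  simp only [scale, Pi.sub_apply, mul_sub]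

theorem hasSubst_scale (hS : Setting k ℓ n B a) {f : Fin 2 → Series}
    (h : ∀ i, f i - 1 ∈ wtIdeal (wts k ℓ) 1) : HasSubst (scale f) :=
  hasSubst_of_mem (wts_pos hS.k_pos hS.ℓ_pos) (mem_of_sub_X (scale_sub_X_mem h))

/-- The variation of the pull-back between two changes of coordinates. -/
theorem Setting.variation (hS : Setting k ℓ n B a) {f g : Fin 2 → Series} {u v : Series} {m : ℕ}
    (hm : 0 < m) (hf : ∀ i, f i - 1 ∈ wtIdeal (wts k ℓ) 1) (hu : u - 1 ∈ wtIdeal (wts k ℓ) 1)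
    (hfg : ∀ i, g i - f i ∈ wtIdeal (wts k ℓ) m) (huv : v - u ∈ wtIdeal (wts k ℓ) m) (i : Fin 2) :
    v * logPullback (scale g) (crossForm a) i - u * logPullback (scale f) (crossForm a) i -
      X 0 * X 1 * lieForm B (g - f) (v - u) i ∈
        wtIdeal (wts k ℓ) (k * ℓ * n + m + 1 + k + ℓ) := by
  have hω : ∀ i, crossForm a i - crossForm B i ∈
      wtIdeal (wts k ℓ) (![k * ℓ * n + ℓ, k * ℓ * n + k] i + 1) := by
    intro i
    fin_cases i
    · have := X_mul_mem_wtIdeal 1 (hS.a_sub 0)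
      rw [mul_sub] at this
      exact wtIdeal_mono (by simp [wts_one]; omega) this
    · have := X_mul_mem_wtIdeal 0 (hS.a_sub 1)
      rw [mul_sub] at this
      exact wtIdeal_mono (by simp [wts_zero]; omega) this
  have hB : ∀ i, crossForm B i ∈ wtIdeal (wts k ℓ) (![k * ℓ * n + ℓ, k * ℓ * n + k] i) := by
    intro i
    fin_cases i
    · exact wtIdeal_mono (by simp [wts_one]; omega) (X_mul_mem_wtIdeal 1 (hS.B_mem 0))
    · exact wtIdeal_mono (by simp [wts_zero]; omega) (X_mul_mem_wtIdeal 0 (hS.B_mem 1))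
  have hN : ∀ i, ![k * ℓ * n + ℓ, k * ℓ * n + k] i + wts k ℓ i = k * ℓ * n + k + ℓ := by
    intro i
    fin_cases i
    · simp [wts]; omega
    · simp [wts]
  have := mul_logPullback_sub (wts_pos hS.k_pos hS.ℓ_pos) (m := m) (φ := scale f) (ψ := scale g) hm
    (scale_sub_X_mem hf) (fun i => by
      have := X_mul_mem_wtIdeal i (hfg i)
      rwa [mul_sub] at this) hu huv (ω := crossForm a) (ω₀ := crossForm B) hN
    (fun i => by
      have := Ideal.add_mem _ (wtIdeal_mono (Nat.le_succ _) (hω i)) (hB i)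
      rwa [sub_add_cancel] at this) hω i
  rw [scale_sub, logLie_scale] at this
  exact wtIdeal_mono (by omega) this

/-- The error left in weight `m` is `xy T`. The solution of the homological equation for `T` is
added to all four parts of the datum. -/
theorem Setting.exists_next (hS : Setting k ℓ n B a) {m : ℕ} (hm : 0 < m) {x : Datum}
    (hx : x.IsConj k ℓ n B a m) :
    ∃ y : Datum, y.IsConj k ℓ n B a (m + 1) ∧ y.Close k ℓ n m x := by
  have hdvd : ∀ i, ∃ T, x.u * logPullback (scale x.f) (crossForm a) i -
      X 0 * X 1 * (B i + normalPart k ℓ x.h x.s i) = X 0 * X 1 * T := fun i =>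
    dvd_sub ((dvd_logPullback_scale (hasSubst_scale hS hx.f_sub) i).mul_left _) (dvd_mul_right _ _)
  choose T hT using hdvd
  have hTm : ∀ i, T i ∈ wtIdeal (wts k ℓ) (k * ℓ * n + m) := by
    intro i
    have := hx.conj i
    rw [hT] at this
    exact X_mul_X_mul_mem_iff.mp this
  obtain ⟨g, v, h, s, hg, hv, hh, hs, hh', hs', heq⟩ := hS.exists_step m hm T hTm
  refine ⟨⟨x.f + g, x.u + v, x.h + h, x.s + s⟩, ⟨fun i => ?_, ?_, ?_, ?_, ?_, ?_, fun i => ?_⟩,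
    ⟨fun i => ?_, ?_, ?_, ?_⟩⟩
  · have := Ideal.add_mem _ (hx.f_sub i) (wtIdeal_mono hm (hg i))
    rwa [sub_add_eq_add_sub] at this
  · have := Ideal.add_mem _ hx.u_sub (wtIdeal_mono hm hv)
    rwa [sub_add_eq_add_sub] at this
  · exact Ideal.add_mem _ hx.h_mem (wtIdeal_mono (by omega) hh)
  · exact Ideal.add_mem _ hx.s_mem (wtIdeal_mono (by omega) hs)
  · intro e he
    by_cases h0 : coeff e x.h = 0
    · rw [map_add, h0, zero_add] at he; exact hh' e he
    · exact hx.h_supp e h0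
  · intro e he
    by_cases h0 : coeff e x.s = 0
    · rw [map_add, h0, zero_add] at he; exact hs' e he
    · exact hx.s_supp e h0
  · have h1 := hS.variation hm hx.f_sub hx.u_sub (g := x.f + g) (v := x.u + v)
      (fun i => by rw [Pi.add_apply, add_sub_cancel_left]; exact hg i)
      (by rwa [add_sub_cancel_left]) i
    rw [add_sub_cancel_left, add_sub_cancel_left] at h1
    have h2 := X_mul_X_mul_mem_iff.mpr (heq i)
    have h3 := normalPart_sub k ℓ (x.h + h) (x.s + s) x.h x.s
    rw [add_sub_cancel_left, add_sub_cancel_left] at h3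
    have h4 := congrFun h3 i
    rw [Pi.sub_apply] at h4
    rw [h4] at h2
    have := Ideal.add_mem _ h1 h2
    rw [← add_assoc (k * ℓ * n) m 1]
    convert this using 1
    linear_combination hT i
  · change (x.f + g) i - x.f i ∈ _
    rw [Pi.add_apply, add_sub_cancel_left]; exact hg i
  · rwa [add_sub_cancel_left]
  · rwa [add_sub_cancel_left]
  · rwa [add_sub_cancel_left]

theorem logPullback_X (ω : Fin 2 → Series) (i : Fin 2) :
    logPullback (X : Fin 2 → Series) ω i = X i * ω i := by
  rw [logPullback, subst_X_eq, subst_X_eq]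
  fin_cases i
  · change ω 0 * eu 0 (X 0) + ω 1 * eu 0 (X 1) = X 0 * ω 0
    rw [eu_X_self, eu_X_ne (by decide)]; ring
  · change ω 0 * eu 1 (X 0) + ω 1 * eu 1 (X 1) = X 1 * ω 1
    rw [eu_X_self, eu_X_ne (by decide)]; ring

theorem Setting.isConj_initial (hS : Setting k ℓ n B a) :
    (⟨1, 1, 0, 0⟩ : Datum).IsConj k ℓ n B a 1 where
  f_sub i := by simp
  u_sub := by simp
  h_mem := Ideal.zero_mem _
  s_mem := Ideal.zero_mem _
  h_supp e he := by simp at he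
  s_supp e he := by simp at he
  conj i := by
    have h1 : scale 1 = (X : Fin 2 → Series) := by
      ext1 i; simp [scale]
    have h2 : normalPart k ℓ 0 0 i = 0 := by
      have := normalPart_sub k ℓ 0 0 0 0
      rw [sub_self, sub_self] at this
      simpa using congrFun this i
    simp only [h1, logPullback_X, X_mul_crossForm, h2, add_zero, one_mul]
    rw [← mul_sub]
    exact X_mul_X_mul_mem_iff.mpr (hS.a_sub i)

/-- Existence of the normal form. -/
theorem Setting.exists_conj (hS : Setting k ℓ n B a) : ∃ x : Datum, ∀ N, x.IsConj k ℓ n B a N := by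
  have hw := wts_pos hS.k_pos hS.ℓ_pos
  have next := fun (m : ℕ) (x : {x : Datum // x.IsConj k ℓ n B a (m + 1)}) =>
    hS.exists_next (Nat.succ_pos m) x.2
  choose F hF hC using next
  -- Starting from the identity, the `m`-th datum is correct up to relative weight `m + 1`, and the
  -- next one differs from it only from that weight on.
  let seq : (m : ℕ) → {x : Datum // x.IsConj k ℓ n B a (m + 1)} := fun m =>
    Nat.rec ⟨⟨1, 1, 0, 0⟩, hS.isConj_initial⟩ (fun m x => ⟨F m x, hF m x⟩) m
  have hseq : ∀ m, (seq (m + 1)).1.Close k ℓ n (m + 1) (seq m).1 := fun m => hC m (seq m)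
  have hf : ∀ i, ∃ g, ∀ m, g - (seq m).1.f i ∈ wtIdeal (wts k ℓ) (1 + m) := fun i =>
    exists_limit fun m => by rw [add_comm]; exact (hseq m).f i
  choose f hf using hf
  obtain ⟨u, hu⟩ := exists_limit (f := fun m => (seq m).1.u) (c := 1) (w := wts k ℓ)
    fun m => by rw [add_comm]; exact (hseq m).u
  obtain ⟨h, hh⟩ := exists_limit (f := fun m => (seq m).1.h) (c := k * ℓ * n + 1) (w := wts k ℓ)
    fun m => by rw [add_assoc, add_comm 1]; exact (hseq m).h
  obtain ⟨s, hs⟩ := exists_limit (f := fun m => (seq m).1.s) (c := k * ℓ * n + 1) (w := wts k ℓ)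
    fun m => by rw [add_assoc, add_comm 1]; exact (hseq m).s
  have hcoef : ∀ {c : ℕ} {g : Series} {t : ℕ → Series},
      (∀ m, g - t m ∈ wtIdeal (wts k ℓ) (c + m)) → ∀ e, ∃ m, coeff e g = coeff e (t m) := by
    intro c g t hg e
    refine ⟨wt (wts k ℓ) e + 1, ?_⟩
    rw [← sub_eq_zero, ← map_sub]
    exact hg _ e (by omega)
  refine ⟨⟨f, u, h, s⟩, fun N => ⟨fun i => ?_, ?_, ?_, ?_, fun e he => ?_, fun e he => ?_,
    fun i => ?_⟩⟩
  · have := Ideal.add_mem _ (hf i 0) ((seq 0).2.f_sub i)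
    rwa [sub_add_sub_cancel] at this
  · have := Ideal.add_mem _ (hu 0) (seq 0).2.u_sub
    rwa [sub_add_sub_cancel] at this
  · have := Ideal.add_mem _ (hh 0) (seq 0).2.h_mem
    rwa [sub_add_cancel] at this
  · have := Ideal.add_mem _ (hs 0) (seq 0).2.s_mem
    rwa [sub_add_cancel] at this
  · obtain ⟨m, hm⟩ := hcoef hh e
    exact (seq m).2.h_supp e (hm ▸ he)
  · obtain ⟨m, hm⟩ := hcoef hs e
    exact (seq m).2.s_supp e (hm ▸ he)
  -- The limit and the `N`-th datum differ by terms which alter the equation only beyond relative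
  -- weight `N`.
  · set y := (seq N).1 with hy
    have hfN : ∀ i, (f - y.f) i ∈ wtIdeal (wts k ℓ) (N + 1) := fun i => by
      rw [add_comm]; exact hf i N
    have huN : u - y.u ∈ wtIdeal (wts k ℓ) (N + 1) := by rw [add_comm]; exact hu N
    have h1 := hS.variation (Nat.succ_pos N) (seq N).2.f_sub (seq N).2.u_sub hfN huN i
    have h2 := X_mul_X_mul_mem_iff.mpr (lieForm_mem hS.B_mem hfN huN i)
    have h3 := X_mul_X_mul_mem_iff.mpr (normalPart_mem k ℓ (hh N) (hs N) i)
    have h4 := (seq N).2.conj i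
    have e := congrFun (normalPart_sub k ℓ h s y.h y.s) i
    simp only [← hy] at h3 h4
    rw [e, Pi.sub_apply] at h3
    have := Ideal.sub_mem _ (Ideal.add_mem _ (Ideal.add_mem _
      (wtIdeal_mono (by omega : k * ℓ * n + N + k + ℓ ≤ _) h1)
      (wtIdeal_mono (by simp only [wts_zero, wts_one]; omega) h2))
      (wtIdeal_mono (by omega) h4))
      (wtIdeal_mono (by simp only [wts_zero, wts_one]; omega) h3)
    convert this using 1
    ring

end QHFoliation

end

noncomputable section

namespace QHFoliation

open MvPowerSeries

/-! ### Uniqueness of the normal form. -/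

variable {k ℓ n : ℕ} {B a : Fin 2 → Series}

theorem Datum.IsConj.mono {x : Datum} {N M : ℕ} (h : x.IsConj k ℓ n B a M) (hN : N ≤ M) :
    x.IsConj k ℓ n B a N :=
  { h with conj := fun i => wtIdeal_mono (by omega) (h.conj i) }

/-- Subtracting the two conjugacy equations and using `Setting.variation` leaves the linear
homological equation for the differences. -/
theorem Setting.difference (hS : Setting k ℓ n B a) {x y : Datum} {m : ℕ} (hm : 0 < m)
    (hx : x.IsConj k ℓ n B a (m + 1)) (hy : y.IsConj k ℓ n B a (m + 1))
    (hf : ∀ i, (x.f - y.f) i ∈ wtIdeal (wts k ℓ) m) (hu : x.u - y.u ∈ wtIdeal (wts k ℓ) m)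
    (i : Fin 2) :
    lieForm B (x.f - y.f) (x.u - y.u) i - normalPart k ℓ (x.h - y.h) (x.s - y.s) i ∈
      wtIdeal (wts k ℓ) (k * ℓ * n + m + 1) := by
  have h1 := hS.variation hm hy.f_sub hy.u_sub hf hu i
  have h2 := Ideal.sub_mem _ (hx.conj i) (hy.conj i)
  rw [← add_assoc (k * ℓ * n) m 1] at h2
  have h3 := Ideal.sub_mem _ h2 h1
  refine X_mul_X_mul_mem_iff.mp ?_
  rw [congrFun (normalPart_sub k ℓ x.h x.s y.h y.s) i, Pi.sub_apply, wts_zero, wts_one]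
  convert h3 using 1
  ring

theorem coeff_sub_ne_zero {f g : Series} {e : Fin 2 →₀ ℕ} (h : coeff e (f - g) ≠ 0) :
    coeff e f ≠ 0 ∨ coeff e g ≠ 0 := by
  by_contra hcon
  push Not at hcon
  rw [map_sub, hcon.1, hcon.2, sub_zero] at h
  exact h rfl

theorem eu_X_mul_X_mul (i : Fin 2) (f : Series) :
    eu i (X 0 * X 1 * f) = X 0 * X 1 * (f + eu i f) := by
  have h01 : (0 : Fin 2) ≠ 1 := by decide
  fin_cases i
  · change eu 0 (X 0 * X 1 * f) = X 0 * X 1 * (f + eu 0 f)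
    rw [mul_assoc, eu_X_mul_self, eu_X_mul_ne h01]; ring
  · change eu 1 (X 0 * X 1 * f) = X 0 * X 1 * (f + eu 1 f)
    rw [mul_assoc, eu_X_mul_ne h01.symm, eu_X_mul_self]; ring

/-- The fields which are tangent to a form preserve it up to a factor. -/
theorem lieEnd_tangent (g : Series) (A : Fin 2 → Series) :
    lieEnd ![-(g * A 1), g * A 0] (fun i => X 0 * X 1 * A i) =
      (g * (A 0 - A 1 + eu 1 (A 0) - eu 0 (A 1))) • fun i => X 0 * X 1 * A i := by
  ext1 i
  rw [lieEnd_apply, logField_apply, eu_X_mul_X_mul, eu_X_mul_X_mul, Pi.smul_apply, smul_eq_mul]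
  simp only [Matrix.cons_val_zero, Matrix.cons_val_one, map_neg, Derivation.leibniz, smul_eq_mul]
  fin_cases i
  · simp only [Fin.zero_eta]; ring
  · simp only [Fin.mk_one]; ring

/-- Modification of a datum by the flow of a field which is tangent to the normal form. -/
theorem Setting.exists_flow (hS : Setting k ℓ n B a) {x : Datum} {m M N : ℕ} (hm : 0 < m)
    (hx : x.IsConj k ℓ n B a N) {g : Series} (hM : M + k * ℓ * n = m)
    (hg : g ∈ wtIdeal (wts k ℓ) M) :
    ∃ x' : Datum, x'.IsConj k ℓ n B a N ∧ x'.h = x.h ∧ x'.s = x.s ∧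
      x'.u - x.u ∈ wtIdeal (wts k ℓ) m ∧
      x'.f 0 - x.f 0 + g * B 1 ∈ wtIdeal (wts k ℓ) (m + 1) ∧
      x'.f 1 - x.f 1 - g * B 0 ∈ wtIdeal (wts k ℓ) (m + 1) := by
  have hw := wts_pos hS.k_pos hS.ℓ_pos
  set A : Fin 2 → Series := fun i => B i + normalPart k ℓ x.h x.s i with hA
  have hnp := fun i => normalPart_mem k ℓ hx.h_mem hx.s_mem i
  have hAm : ∀ i, A i ∈ wtIdeal (wts k ℓ) (k * ℓ * n) := fun i =>
    Ideal.add_mem _ (hS.B_mem i) (wtIdeal_mono (Nat.le_succ _) (hnp i))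
  have hgA : ∀ i, g * A i ∈ wtIdeal (wts k ℓ) m := fun i => hM ▸ mul_mem_wtIdeal hg (hAm i)
  set ζ : Fin 2 → Series := ![-(g * A 1), g * A 0] with hζ
  have hζm : ∀ i, ζ i ∈ wtIdeal (wts k ℓ) m := by
    intro i
    fin_cases i
    · exact neg_mem (hgA 1)
    · exact hgA 0
  have hφ := mem_of_sub_X (scale_sub_X_mem hx.f_sub)
  obtain ⟨ψ, v, hdvd, hψ, hv, hconj⟩ := QHFoliation.exists_flow hw hm hζm hφ
    (W := g * (A 0 - A 1 + eu 1 (A 0) - eu 0 (A 1)))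
    (hM ▸ mul_mem_wtIdeal hg (Ideal.sub_mem _ (Ideal.add_mem _ (Ideal.sub_mem _ (hAm 0) (hAm 1))
      (eu_mem_wtIdeal (hAm 0) 1)) (eu_mem_wtIdeal (hAm 1) 0)))
    (lieEnd_tangent g A) hx.conj
  choose f hf using fun i => hdvd i (dvd_mul_right _ _)
  have hψf : ψ = scale f := funext hf
  have hff : ∀ i, f i - x.f i - ζ i ∈ wtIdeal (wts k ℓ) (m + 1) := by
    intro i
    have h1 := hψ i
    have h2 : logField ζ (scale x.f i) - X i * ζ i ∈ wtIdeal (wts k ℓ) (wts k ℓ i + m + 1) := by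
      have h3 : scale x.f i = X i * (x.f i - 1) + X i := by rw [scale]; ring
      have h4 : logField ζ (X i : Series) = X i * ζ i := by
        rw [logField_apply]
        fin_cases i
        · change ζ 0 * eu 0 (X 0) + ζ 1 * eu 1 (X 0) = X 0 * ζ 0
          rw [eu_X_self, eu_X_ne (by decide)]; ring
        · change ζ 0 * eu 0 (X 1) + ζ 1 * eu 1 (X 1) = X 1 * ζ 1
          rw [eu_X_self, eu_X_ne (by decide)]; ring
      have h5 := X_mul_mem_wtIdeal i (hx.f_sub i)
      rw [h3, map_add, h4, add_sub_cancel_right, logField_apply]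
      refine Ideal.add_mem _ ?_ ?_
      · exact wtIdeal_mono (by omega) (mul_mem_wtIdeal (hζm 0) (eu_mem_wtIdeal h5 0))
      · exact wtIdeal_mono (by omega) (mul_mem_wtIdeal (hζm 1) (eu_mem_wtIdeal h5 1))
    have h3 := Ideal.add_mem _ h1 h2
    refine of_X_mul_mem_wtIdeal (i := i) (wtIdeal_mono (by omega : _ ≤ wts k ℓ i + m + 1) ?_)
    rw [hψf] at h3
    convert h3 using 1
    simp only [scale]; ring
  have hfm : ∀ i, f i - x.f i ∈ wtIdeal (wts k ℓ) m := fun i => by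
    have := Ideal.add_mem _ (wtIdeal_mono (Nat.le_succ m) (hff i)) (hζm i)
    rwa [sub_add_cancel] at this
  -- The field is tangent to the whole normal form, but this differs from `B` only in higher weight,
  -- so the leading term of the correction is `g (-B 1, B 0)`.
  have hgn : ∀ i, g * normalPart k ℓ x.h x.s i ∈ wtIdeal (wts k ℓ) (m + 1) := fun i =>
    wtIdeal_mono (by omega) (mul_mem_wtIdeal hg (hnp i))
  refine ⟨⟨f, v, x.h, x.s⟩, ⟨fun i => ?_, ?_, hx.h_mem, hx.s_mem, hx.h_supp, hx.s_supp, ?_⟩,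
    rfl, rfl, hv, ?_, ?_⟩
  · have := Ideal.add_mem _ (wtIdeal_mono hm (hfm i)) (hx.f_sub i)
    rwa [sub_add_sub_cancel] at this
  · have := Ideal.add_mem _ (wtIdeal_mono hm hv) hx.u_sub
    rwa [sub_add_sub_cancel] at this
  · rw [hψf] at hconj
    exact hconj
  · have h1 := Ideal.sub_mem _ (hff 0) (hgn 1)
    convert h1 using 1
    simp only [hζ, hA, Matrix.cons_val_zero]; ring
  · have h1 := Ideal.add_mem _ (hff 1) (hgn 0)
    convert h1 using 1
    have hζ1 : ζ 1 = g * A 0 := rfl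
    rw [hζ1, hA]; ring

/-- By linear uniqueness the normal forms agree in weight `m`, and the changes of coordinates differ
there by a field tangent to the initial form. A flow along the foliation of the normal form of `x`
removes that difference and leaves `h` and `s` untouched. -/
theorem Setting.exists_closer (hS : Setting k ℓ n B a) {x y : Datum} {m N : ℕ} (hm : 0 < m)
    (hN : m + 1 ≤ N) (hx : x.IsConj k ℓ n B a N) (hy : y.IsConj k ℓ n B a N)
    (hxy : x.Close k ℓ n m y) :
    ∃ x' : Datum, x'.IsConj k ℓ n B a N ∧ x'.h = x.h ∧ x'.s = x.s ∧ x'.Close k ℓ n (m + 1) y := by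
  obtain ⟨hh, hs, g, hg, h0, h1⟩ := hS.unique_step m hm (x.f - y.f) (x.u - y.u) (x.h - y.h)
    (x.s - y.s) hxy.f hxy.u hxy.h hxy.s
    (fun e he => (coeff_sub_ne_zero he).elim (hx.h_supp e) (hy.h_supp e))
    (fun e he => (coeff_sub_ne_zero he).elim (hx.s_supp e) (hy.s_supp e))
    (hS.difference hm (hx.mono hN) (hy.mono hN) hxy.f hxy.u)
  rw [Pi.sub_apply] at h0 h1
  obtain ⟨x', hx', eh, es, hf', hu'⟩ : ∃ x' : Datum, x'.IsConj k ℓ n B a N ∧ x'.h = x.h ∧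
      x'.s = x.s ∧ (∀ i, (x'.f - y.f) i ∈ wtIdeal (wts k ℓ) (m + 1)) ∧
      x'.u - y.u ∈ wtIdeal (wts k ℓ) m := by
    rcases hg with rfl | ⟨M, hM, hg⟩
    · refine ⟨x, hx, rfl, rfl, ?_, hxy.u⟩
      rw [zero_mul, sub_zero] at h0
      rw [zero_mul, add_zero] at h1
      intro i
      fin_cases i
      · exact h0
      · exact h1
    · obtain ⟨x', hx', eh, es, hu, hf0, hf1⟩ := hS.exists_flow hm hx hM hg
      refine ⟨x', hx', eh, es, fun i => ?_, ?_⟩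
      · fin_cases i
        · have := Ideal.add_mem _ hf0 h0
          convert this using 1
          change x'.f 0 - y.f 0 = _
          ring
        · have := Ideal.add_mem _ hf1 h1
          convert this using 1
          change x'.f 1 - y.f 1 = _
          ring
      · have := Ideal.add_mem _ hu hxy.u
        rwa [sub_add_sub_cancel] at this
  refine ⟨x', hx', eh, es, hf', ?_, by rw [eh]; exact hh, by rw [es]; exact hs⟩
  have hd := hS.difference hm (hx'.mono hN) (hy.mono hN)
    (fun i => wtIdeal_mono (Nat.le_succ m) (hf' i)) hu' 0
  rw [eh, es] at hd
  have h2 := lieForm_mem (v := 0) hS.B_mem hf' (Ideal.zero_mem _) 0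
  have h3 := normalPart_mem k ℓ hh hs 0
  -- With the changes of coordinates now agreeing to order `m + 1`, the linear equation reduces to
  -- the difference of the units times `B 0`. As `B 0` has order exactly `k ℓ n`, the units agree to
  -- order `m + 1` too.
  refine of_mul_mem_wtIdeal hS.B_not_mem ?_
  have := Ideal.sub_mem _ (Ideal.add_mem _ hd h3) h2
  refine wtIdeal_mono (M := k * ℓ * n + m + 1) (by omega) ?_
  convert this using 1
  simp only [lieForm, Matrix.cons_val_zero, Level.lie0]
  ring

/-- Uniqueness of the normal form. -/
theorem Setting.unique_conj (hS : Setting k ℓ n B a) {x y : Datum}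
    (hx : ∀ N, x.IsConj k ℓ n B a N) (hy : ∀ N, y.IsConj k ℓ n B a N) : x.h = y.h ∧ x.s = y.s := by
  -- The flow keeps the conjugacy only up to a weight `N` fixed in advance. This is harmless: `h`
  -- and `s` never change along the induction, and `N` is arbitrary.
  have key : ∀ N m, m + 1 ≤ N → ∃ x' : Datum, x'.IsConj k ℓ n B a N ∧ x'.h = x.h ∧ x'.s = x.s ∧
      x'.Close k ℓ n (m + 1) y := by
    intro N m hm
    induction m with
    | zero =>
      refine ⟨x, hx N, rfl, rfl, ⟨fun i => ?_, ?_, ?_, ?_⟩⟩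
      · have := Ideal.sub_mem _ ((hx 0).f_sub i) ((hy 0).f_sub i)
        rwa [sub_sub_sub_cancel_right] at this
      · have := Ideal.sub_mem _ (hx 0).u_sub (hy 0).u_sub
        rwa [sub_sub_sub_cancel_right] at this
      · exact Ideal.sub_mem _ (hx 0).h_mem (hy 0).h_mem
      · exact Ideal.sub_mem _ (hx 0).s_mem (hy 0).s_mem
    | succ m ih =>
      obtain ⟨x', hx', eh, es, hc⟩ := ih (by omega)
      obtain ⟨x'', hx'', eh', es', hc'⟩ := hS.exists_closer (Nat.succ_pos m) hm hx' (hy N) hc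
      exact ⟨x'', hx'', eh'.trans eh, es'.trans es, hc'⟩
  constructor
  · rw [← sub_eq_zero]
    refine eq_zero_of_mem_wtIdeal (w := wts k ℓ) fun N => ?_
    obtain ⟨x', -, eh, -, hc⟩ := key (N + 1) N le_rfl
    rw [← eh]
    exact wtIdeal_mono (by omega) hc.h
  · rw [← sub_eq_zero]
    refine eq_zero_of_mem_wtIdeal (w := wts k ℓ) fun N => ?_
    obtain ⟨x', -, -, es, hc⟩ := key (N + 1) N le_rfl
    rw [← es]
    exact wtIdeal_mono (by omega) hc.s

end QHFoliation

end

noncomputable section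

namespace QHFoliation

open MvPowerSeries
open Polynomial (degreeLT)

/-! ### The coefficients of the normal form -/

/-- The exponent equals `⌈(k ℓ n + 1 - ℓ j) / k⌉`, the least power of `x` which brings the weight to
`k ℓ n + 1`; hence the `s` of the statement are exactly the series of this order with `y`-degree
less than `k n`. -/
theorem radialExponent_le_iff {k ℓ n : ℕ} (hk : 0 < k) (i j : ℕ) :
    radialExponent k ℓ n j ≤ i ↔ k * ℓ * n + 1 ≤ k * i + ℓ * j := by
  have hk' : (0 : ℚ) < k := by exact_mod_cast hk
  have h1 : (ℓ * n + 1 : ℤ) + strictIntPart ((1 - (ℓ : ℚ) * (j : ℚ)) / (k : ℚ)) =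
      ⌈(k * ℓ * n + 1 - ℓ * j : ℚ) / k⌉ := by
    have h2 : (k * ℓ * n + 1 - ℓ * j : ℚ) / k =
        (1 - (ℓ : ℚ) * (j : ℚ)) / (k : ℚ) + ((ℓ * n : ℕ) : ℤ) := by
      field_simp
      push_cast
      ring
    rw [h2, Int.ceil_add_intCast, strictIntPart]
    push_cast
    ring
  rw [radialExponent, h1, Int.toNat_le, Int.ceil_le, div_le_iff₀ hk']
  constructor
  · intro h
    have : ((k * ℓ * n + 1 : ℕ) : ℚ) ≤ ((k * i + ℓ * j : ℕ) : ℚ) := by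
      push_cast at h ⊢
      linarith
    exact_mod_cast this
  · intro h
    have : ((k * ℓ * n + 1 : ℕ) : ℚ) ≤ ((k * i + ℓ * j : ℕ) : ℚ) := by exact_mod_cast h
    push_cast at this ⊢
    linarith

theorem coeff_seriesInX_mul (p : PowerSeries ℂ) (r j : ℕ) (e : Fin 2 →₀ ℕ) :
    coeff e (seriesInX p * X 0 ^ r * X 1 ^ j) =
      if r ≤ e 0 ∧ j = e 1 then PowerSeries.coeff (e 0 - r) p else 0 := by
  classical
  have h0 : (X 0 ^ r * X 1 ^ j : Series) = monomial (expo r j) 1 := by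
    rw [← monomial_expo, map_one, one_mul]
  have hc : ∀ e, coeff e (seriesInX p) = if e 1 = 0 then PowerSeries.coeff (e 0) p else 0 :=
    fun _ => rfl
  rw [mul_assoc, h0, coeff_mul_monomial, mul_one]
  have hle : expo r j ≤ e ↔ r ≤ e 0 ∧ j ≤ e 1 := by
    rw [Finsupp.le_def, Fin.forall_fin_two, expo_apply_zero, expo_apply_one]
  by_cases h : r ≤ e 0 ∧ j ≤ e 1
  · rw [if_pos (hle.mpr h), hc, Finsupp.tsub_apply, Finsupp.tsub_apply, expo_apply_zero,
      expo_apply_one]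
    refine if_congr ?_ rfl rfl
    omega
  · rw [if_neg fun hc => h (hle.mp hc), if_neg]
    omega

theorem coeff_radialCoeff {k ℓ n : ℕ} (s : Fin (k * n) → PowerSeries ℂ) (e : Fin 2 →₀ ℕ) :
    coeff e (radialCoeff k ℓ n s) = if h : e 1 < k * n then
      if radialExponent k ℓ n (e 1) ≤ e 0 then
        PowerSeries.coeff (e 0 - radialExponent k ℓ n (e 1)) (s ⟨e 1, h⟩) else 0 else 0 := by
  rw [radialCoeff, map_sum]
  simp only [coeff_seriesInX_mul]
  split_ifs with h h1
  · rw [Finset.sum_eq_single ⟨e 1, h⟩]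
    · rw [if_pos ⟨h1, rfl⟩]
    · intro j _ hj
      rw [if_neg]
      rintro ⟨-, hc⟩
      exact hj (Fin.ext hc)
    · intro hc; exact absurd (Finset.mem_univ _) hc
  · refine Finset.sum_eq_zero fun j _ => if_neg ?_
    rintro ⟨hc, hj⟩
    rw [← hj] at h1
    exact h1 hc
  · refine Finset.sum_eq_zero fun j _ => if_neg ?_
    rintro ⟨-, hj⟩
    exact h (hj ▸ j.2)

theorem coeff_radialCoeff_ne_zero {k ℓ n : ℕ} (hk : 0 < k) {s : Fin (k * n) → PowerSeries ℂ}
    {e : Fin 2 →₀ ℕ} (he : coeff e (radialCoeff k ℓ n s) ≠ 0) :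
    e 1 < k * n ∧ k * ℓ * n + 1 ≤ wt (wts k ℓ) e := by
  rw [coeff_radialCoeff] at he
  split_ifs at he with h h1
  · exact ⟨h, (radialExponent_le_iff hk _ _).mp h1⟩
  · exact absurd rfl he
  · exact absurd rfl he

theorem radialCoeff_injective (k ℓ n : ℕ) : Function.Injective (radialCoeff k ℓ n) := by
  intro s t h
  ext j r
  have := congrArg (coeff (expo (r + radialExponent k ℓ n j) j)) h
  rw [coeff_radialCoeff, coeff_radialCoeff, expo_apply_one, expo_apply_zero, dif_pos j.2,
    dif_pos j.2, if_pos (by omega), if_pos (by omega), Nat.add_sub_cancel] at this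
  exact this

theorem exists_radialCoeff {k ℓ n : ℕ} (hk : 0 < k) {s : Series}
    (hs : s ∈ wtIdeal (wts k ℓ) (k * ℓ * n + 1)) (hs' : ∀ e, coeff e s ≠ 0 → e 1 < k * n) :
    ∃ t, radialCoeff k ℓ n t = s := by
  refine ⟨fun j => PowerSeries.mk fun r =>
    coeff (expo (r + radialExponent k ℓ n j) j) s, ?_⟩
  ext e
  rw [coeff_radialCoeff]
  split_ifs with h h1
  · rw [PowerSeries.coeff_mk, Nat.sub_add_cancel h1, expo_eta]
  · rw [radialExponent_le_iff hk] at h1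
    refine (hs e ?_).symm
    rw [wt, wts_zero, wts_one]
    omega
  · by_contra hne
    exact h (hs' e (Ne.symm hne))

theorem exists_hamiltonianPart {k ℓ n : ℕ} {h : Series}
    (hh : h ∈ wtIdeal (wts k ℓ) (k * ℓ * n + 1))
    (hh' : ∀ e, coeff e h ≠ 0 → e 0 < ℓ * n ∧ e 1 < k * n) :
    ∃ H : MvPolynomial (Fin 2) ℂ, IsHamiltonianPart k ℓ n H ∧ (H : Series) = h := by
  classical
  have hfin : (Function.support fun e : Fin 2 →₀ ℕ => coeff e h).Finite := by
    refine ((Finset.range (ℓ * n) ×ˢ Finset.range (k * n)).image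
      fun x : ℕ × ℕ => expo x.1 x.2).finite_toSet.subset fun e he => ?_
    have := hh' e he
    simp only [Finset.coe_image, Set.mem_image, Finset.mem_coe, Finset.mem_product,
      Finset.mem_range]
    exact ⟨(e 0, e 1), this, expo_eta e⟩
  obtain ⟨H, hH⟩ : ∃ H : MvPolynomial (Fin 2) ℂ, ∀ e, MvPolynomial.coeff e H = coeff e h := by
    refine ⟨∑ e ∈ hfin.toFinset, MvPolynomial.monomial e (coeff e h), fun e => ?_⟩
    rw [MvPolynomial.coeff_sum]
    simp only [MvPolynomial.coeff_monomial, Finset.sum_ite_eq', Set.Finite.mem_toFinset,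
      Function.mem_support]
    split_ifs with h0
    · rfl
    · push Not at h0; exact h0.symm
  refine ⟨H, fun e he => ?_, ?_⟩
  · rw [MvPolynomial.mem_support_iff, hH] at he
    have h1 := hh' e he
    refine ⟨?_, by omega, by omega⟩
    by_contra hlt
    exact he (hh e (by rw [wt, wts_zero, wts_one]; omega))
  · ext e
    rw [MvPolynomial.coeff_coe, hH]

theorem IsHamiltonianPart.mem {k ℓ n : ℕ} {H : MvPolynomial (Fin 2) ℂ}
    (hH : IsHamiltonianPart k ℓ n H) : (H : Series) ∈ wtIdeal (wts k ℓ) (k * ℓ * n + 1) := by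
  intro e he
  rw [MvPolynomial.coeff_coe]
  by_contra hne
  have := (hH e (MvPolynomial.mem_support_iff.mpr hne)).1
  rw [wt, wts_zero, wts_one] at he
  omega

theorem IsHamiltonianPart.supp {k ℓ n : ℕ} (hk : 0 < k) (hℓ : 0 < ℓ) (hn : 0 < n)
    {H : MvPolynomial (Fin 2) ℂ} (hH : IsHamiltonianPart k ℓ n H) (e : Fin 2 →₀ ℕ)
    (he : coeff e (H : Series) ≠ 0) : e 0 < ℓ * n ∧ e 1 < k * n := by
  rw [MvPolynomial.coeff_coe] at he
  have h1 := hH e (MvPolynomial.mem_support_iff.mpr he)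
  have h2 := Nat.mul_pos hℓ hn
  have h3 := Nat.mul_pos hk hn
  omega

/-! ### Formal equivalences in terms of the coefficients -/

theorem X_mul_coeffs_pullback (φ : Fin 2 → Series) (ω : OneForm) (i : Fin 2) :
    X i * (ω.pullback φ).coeffs i = logPullback φ ω.coeffs i := by
  rw [coeffs_pullback, logPullback, eu_apply, eu_apply, OneForm.coeffs_zero, OneForm.coeffs_one]
  ring

theorem mul_pullback_eq_iff {φ : Fin 2 → Series} {u : Series} {ω η : OneForm} :
    OneForm.mul u (ω.pullback φ) = η ↔
      ∀ i, u * logPullback φ ω.coeffs i = X i * η.coeffs i := by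
  have hx : ∀ i, u * logPullback φ ω.coeffs i = X i * (OneForm.mul u (ω.pullback φ)).coeffs i :=
    fun i => by rw [coeffs_mul, ← X_mul_coeffs_pullback]; ring
  constructor
  · rintro rfl i
    exact hx i
  · intro h
    have : ∀ i, (OneForm.mul u (ω.pullback φ)).coeffs i = η.coeffs i := fun i =>
      mul_left_cancel₀ (X_ne_zero' i) ((hx i).symm.trans (h i))
    exact OneForm.ext (this 0) (this 1)

theorem coeffs_normalForm {k ℓ n : ℕ} {ωd : OneForm} {B : Fin 2 → Series}
    (h : ωd.coeffs = crossForm B) (H : MvPolynomial (Fin 2) ℂ)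
    (s : Fin (k * n) → PowerSeries ℂ) :
    (normalForm k ℓ n ωd H s).coeffs =
      crossForm fun i => B i + normalPart k ℓ H (radialCoeff k ℓ n s) i := by
  have h0 : ωd.a = X 1 * B 0 := congrFun h 0
  have h1 : ωd.b = X 0 * B 1 := congrFun h 1
  ext1 i
  fin_cases i
  · change ωd.a + pderiv ℂ 0 (X 0 * X 1 * (H : Series)) +
      radialCoeff k ℓ n s * (C (ℓ : ℂ) * X 1) =
      X 1 * (B 0 + ((H : Series) + eu 0 (H : Series) + C (ℓ : ℂ) * radialCoeff k ℓ n s))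
    rw [h0, eu_apply, Derivation.leibniz, Derivation.leibniz, pderiv_X_self,
      pderiv_X_of_ne (by decide : (1 : Fin 2) ≠ 0)]
    simp only [smul_eq_mul]
    ring
  · change ωd.b + pderiv ℂ 1 (X 0 * X 1 * (H : Series)) +
      radialCoeff k ℓ n s * -(C (k : ℂ) * X 0) =
      X 0 * (B 1 + ((H : Series) + eu 1 (H : Series) - C (k : ℂ) * radialCoeff k ℓ n s))
    rw [h1, eu_apply, Derivation.leibniz, Derivation.leibniz, pderiv_X_self,
      pderiv_X_of_ne (by decide : (0 : Fin 2) ≠ 1)]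
    simp only [smul_eq_mul]
    ring

theorem sub_one_mem_wtIdeal_iff {w : Fin 2 → ℕ} (hw : ∀ i, 0 < w i) {f : Series} :
    f - 1 ∈ wtIdeal w 1 ↔ constantCoeff f = 1 := by
  constructor
  · intro h
    have := h 0 (by simp [wt])
    rwa [map_sub, coeff_zero_eq_constantCoeff_apply, coeff_zero_eq_constantCoeff_apply, map_one,
      sub_eq_zero] at this
  · intro h e he
    have h0 : ∀ i, e i = 0 := by
      intro i
      by_contra hne
      have h1 : 0 < w i * e i := Nat.mul_pos (hw i) (Nat.pos_of_ne_zero hne)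
      rw [wt] at he
      fin_cases i
      · change 0 < w 0 * e 0 at h1; omega
      · change 0 < w 1 * e 1 at h1; omega
    have : e = 0 := Finsupp.ext h0
    rw [this, map_sub, coeff_zero_eq_constantCoeff_apply, coeff_zero_eq_constantCoeff_apply, h,
      map_one, sub_self]

theorem coeff_single_X_mul (i j : Fin 2) (f : Series) :
    coeff (Finsupp.single j 1) (X i * f) = if i = j then constantCoeff f else 0 := by
  split_ifs with h
  · subst h
    have := coeff_X_mul_expo f i 0
    rwa [zero_add, coeff_zero_eq_constantCoeff_apply] at this
  · exact coeff_single_eq_zero_of_dvd (fun h' => h h'.symm) (dvd_mul_right _ _) 1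

theorem isStrictDiffeo_scale {f : Fin 2 → Series} (hf : ∀ i, constantCoeff (f i) = 1) :
    IsStrictDiffeo (scale f) := by
  intro i
  refine ⟨by rw [scale, map_mul, constantCoeff_X, zero_mul], fun j => ?_⟩
  rw [scale, coeff_single_X_mul, hf]

/-! ### The initial form along monomial curves -/

variable {k ℓ n : ℕ} {p r : Polynomial ℂ}

/-- The coefficients of the initial form. -/
def initialCoeffs (k ℓ n : ℕ) (p r : Polynomial ℂ) : Fin 2 → Series :=
  fun l => hom k ℓ (ℓ * n) 0 (![p, r] l)

theorem initialCoeffs_mem (k ℓ n : ℕ) (p r : Polynomial ℂ) (i : Fin 2) :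
    initialCoeffs k ℓ n p r i ∈ wtIdeal (wts k ℓ) (k * ℓ * n) := by
  have := hom_mem_wtIdeal k ℓ (ℓ * n) 0 (![p, r] i)
  rwa [mul_zero, add_zero, ← mul_assoc] at this

theorem crossForm_apply {i j : Fin 2} (hij : i ≠ j) (B : Fin 2 → Series) :
    crossForm B i = X j * B i := by
  fin_cases i <;> fin_cases j <;> first | rfl | exact absurd rfl hij

theorem coeff_single_zero {a : Fin 2 → Series} (hk : 0 < k)
    (ha : ∀ i, a i - initialCoeffs k ℓ n p r i ∈ wtIdeal (wts k ℓ) (k * ℓ * n + 1)) (l : Fin 2) :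
    coeff (Finsupp.single 0 (ℓ * n)) (a l) = (![p, r] l).coeff 0 := by
  have h1 := ha l (Finsupp.single 0 (ℓ * n)) (by rw [wt_single, wts_zero, ← mul_assoc]; omega)
  rw [map_sub, sub_eq_zero] at h1
  have h2 := coeff_hom (ℓ := ℓ) (I := ℓ * n) (J := 0) hk (![p, r] l) (s := 0) (Nat.succ_pos _)
  rw [h1, initialCoeffs, ← h2]
  simp [expo]

theorem coeff_single_one {a : Fin 2 → Series} (hk : 0 < k) (hℓ : 0 < ℓ)
    (ha : ∀ i, a i - initialCoeffs k ℓ n p r i ∈ wtIdeal (wts k ℓ) (k * ℓ * n + 1)) (l : Fin 2) :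
    coeff (Finsupp.single 1 (k * n)) (a l) = (![p, r] l).coeff n := by
  have h1 := ha l (Finsupp.single 1 (k * n)) (by
    rw [wt_single, wts_one, ← mul_assoc, mul_comm ℓ k]; omega)
  rw [map_sub, sub_eq_zero] at h1
  have h2 := coeff_hom (ℓ := ℓ) (I := ℓ * n) (J := 0) hk (![p, r] l) (s := n)
    (by rw [Nat.mul_div_cancel_left n hℓ]; omega)
  rw [h1, initialCoeffs, ← h2]
  simp [expo]

/-- For `k = 1` every monomial of weight `ℓ n` restricts to a multiple of `x ^ (ℓ n)`, so the
initial form along the curve is the value of its polynomial at `τ`. -/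
theorem subst_monCurve_zero (hℓ : 0 < ℓ) {P : Polynomial ℂ} (hP : P ∈ degreeLT ℂ (n + 1)) (τ : ℂ) :
    subst (monCurve 0 ℓ τ) (hom 1 ℓ (ℓ * n) 0 P) = C (P.eval τ) * X 0 ^ (ℓ * n) := by
  have hγ : HasSubst (monCurve 0 ℓ τ) := hasSubst_of_mem (w := wts 1 ℓ) (wts_pos one_pos hℓ)
    (monCurve_mem (by decide : (0 : Fin 2) ≠ 1) rfl rfl τ)
  rw [hom, ← coe_substAlgHom hγ, map_sum, coe_substAlgHom hγ, Nat.mul_div_cancel_left n hℓ]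
  conv_rhs => rw [← shape_id hP, shape, Polynomial.eval_finsetSum, map_sum, Finset.sum_mul]
  refine Finset.sum_congr rfl fun s hs => ?_
  have hs' : ℓ * s ≤ ℓ * n := Nat.mul_le_mul_left _ (by have := Finset.mem_range.mp hs; omega)
  rw [subst_mul hγ, subst_mul hγ, subst_pow hγ, subst_pow hγ, subst_X hγ, subst_X hγ, subst_C,
    monCurve_self, monCurve_ne (by decide : (0 : Fin 2) ≠ 1), Polynomial.eval_mul,
    Polynomial.eval_C, Polynomial.eval_pow, Polynomial.eval_X, map_mul, map_pow, mul_pow,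
    ← pow_mul, zero_add, one_mul, id]
  have : (X 0 : Series) ^ (ℓ * n - ℓ * s) * X 0 ^ (ℓ * s) = X 0 ^ (ℓ * n) := by
    rw [← pow_add, Nat.sub_add_cancel hs']
  linear_combination C (P.coeff s) * C τ ^ s * this

theorem subst_monCurve_one (hk : 0 < k) (P : Polynomial ℂ) (τ : ℂ) :
    subst (monCurve 1 k τ) (hom k 1 (1 * n) 0 P) =
      C ((shape n (fun s => n - s) P).eval τ) * X 1 ^ (k * n) := by
  have hγ : HasSubst (monCurve 1 k τ) := hasSubst_of_mem (w := wts k 1) (wts_pos hk one_pos)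
    (monCurve_mem (by decide : (1 : Fin 2) ≠ 0) rfl rfl τ)
  rw [hom, ← coe_substAlgHom hγ, map_sum, coe_substAlgHom hγ, Nat.mul_div_cancel_left n one_pos]
  conv_rhs => rw [shape, Polynomial.eval_finsetSum, map_sum, Finset.sum_mul]
  refine Finset.sum_congr rfl fun s hs => ?_
  have hs' : s ≤ n := by have := Finset.mem_range.mp hs; omega
  rw [subst_mul hγ, subst_mul hγ, subst_pow hγ, subst_pow hγ, subst_X hγ, subst_X hγ, subst_C,
    monCurve_self, monCurve_ne (by decide : (1 : Fin 2) ≠ 0), Polynomial.eval_mul,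
    Polynomial.eval_C, Polynomial.eval_pow, Polynomial.eval_X, map_mul, map_pow, mul_pow,
    ← pow_mul, zero_add, one_mul, one_mul]
  have : (X 1 : Series) ^ (k * (n - s)) * X 1 ^ (k * s) = X 1 ^ (k * n) := by
    rw [← pow_add, ← mul_add, Nat.sub_add_cancel hs']
  linear_combination C (P.coeff s) * C τ ^ (n - s) * this

theorem shape_sub_ne_zero {P : Polynomial ℂ} (hP : P ∈ degreeLT ℂ (n + 1)) (h : P ≠ 0) :
    shape n (fun s => n - s) P ≠ 0 := by
  intro h0
  apply h
  ext s
  by_cases hs : s ≤ n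
  · have := congrArg (fun Q => Q.coeff (n - s)) h0
    simp only [shape, Polynomial.finsetSum_coeff, Polynomial.coeff_C_mul, Polynomial.coeff_X_pow,
      Polynomial.coeff_zero] at this
    rw [Finset.sum_eq_single s] at this
    · simpa using this
    · intro t ht hts
      have := Finset.mem_range.mp ht
      rw [if_neg (by omega), mul_zero]
    · intro hc
      exact absurd (Finset.mem_range.mpr (by omega)) hc
  · rw [mem_degreeLT_iff.mp hP s (by omega), Polynomial.coeff_zero]

theorem shape_add_natCast_mul (ε : ℕ → ℕ) (c : ℕ) (P Q : Polynomial ℂ) :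
    shape n ε P + (c : Polynomial ℂ) * shape n ε Q = shape n ε (P + (c : Polynomial ℂ) * Q) := by
  simp only [shape, Polynomial.coeff_add, Polynomial.coeff_natCast_mul, map_add, map_mul,
    map_natCast, add_mul, Finset.sum_add_distrib, Finset.mul_sum, mul_assoc]

/-- A formal equivalence preserves the axes. -/
theorem X_dvd_of_isAdmissible (h : IsAdmissible k ℓ n p r) (hk : 0 < k) (hℓ : 0 < ℓ)
    (hc : Nat.Coprime k ℓ) {a a' : Fin 2 → Series}
    (ha : ∀ i, a i - initialCoeffs k ℓ n p r i ∈ wtIdeal (wts k ℓ) (k * ℓ * n + 1))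
    (ha' : ∀ i, a' i - initialCoeffs k ℓ n p r i ∈ wtIdeal (wts k ℓ) (k * ℓ * n + 1))
    {φ : Fin 2 → Series} {u : Series} (hφ : IsStrictDiffeo φ) (hu : constantCoeff u = 1)
    (heq : ∀ l, u * logPullback φ (crossForm a) l = X l * crossForm a' l) (i : Fin 2) :
    X i ∣ φ i := by
  have h01 : (0 : Fin 2) ≠ 1 := by decide
  have hw := wts_pos hk hℓ
  have hmem : ∀ i, a i ∈ wtIdeal (wts k ℓ) (k * ℓ * n) := fun i => by
    have := Ideal.add_mem _ (wtIdeal_mono (Nat.le_succ _) (ha i)) (initialCoeffs_mem k ℓ n p r i)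
    rwa [sub_add_cancel] at this
  have hs : ∀ {b : Fin 2 → Series} {γ : Fin 2 → Series} {M : ℕ} (l : Fin 2) {c : Series},
      (∀ i, b i - initialCoeffs k ℓ n p r i ∈ wtIdeal (wts k ℓ) (k * ℓ * n + 1)) →
      (∀ i, γ i ∈ wtIdeal (wts k ℓ) (wts k ℓ i)) → subst γ (initialCoeffs k ℓ n p r l) = c →
      M = k * ℓ * n → subst γ (b l) - c ∈ wtIdeal (wts k ℓ) (M + 1) := by
    rintro b γ M l c hb hγ rfl rfl
    rw [← subst_sub (hasSubst_of_mem hw hγ)]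
    exact subst_mem_wtIdeal hw hγ (hb l)
  have e0 := coeff_single_zero hk ha
  have e1 := coeff_single_one hk hℓ ha
  have hpr : ∀ l, ![p, r] l ∈ degreeLT ℂ (n + 1) := by
    intro l
    fin_cases l
    · exact h.p_mem
    · exact h.r_mem
  fin_cases i
  -- For the axis `x = 0` the curves are `x = τ y ^ P`, so the polynomials enter with reversed
  -- coefficients and `P` multiplies the coefficient of `dx`.
  · refine X_dvd_of_conjugacy h01.symm hw hc.symm (n := n) (a := a) (a' := a')
      (fun l => by rw [wts_zero, wts_one, mul_comm ℓ k]; exact hmem l)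
      (crossForm_apply h01.symm a) (crossForm_apply h01 a) (crossForm_apply h01.symm a')
      (crossForm_apply h01 a') ?_ ?_ (fun l => shape n (fun s => n - s) (![p, r] l)) ?_ ?_ ?_
      hφ hu heq
    · intro P hP
      rw [wts_zero, wts_one] at hP
      rw [wts_zero, e1, e1]
      have := h.top P 1 (by rw [one_mul, mul_comm]; exact_mod_cast hP.ne')
      simp only [Int.cast_natCast, Int.cast_one, one_mul] at this
      rwa [add_comm] at this
    · intro P hP
      rw [wts_zero, wts_one] at hP
      rw [wts_one, e0, e0]
      have := h.bot P 1 (by rw [one_mul, mul_comm]; exact_mod_cast hP.ne)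
      simp only [Int.cast_natCast, Int.cast_one, one_mul] at this
      rwa [add_comm] at this
    · change shape n (fun s => n - s) r + (k : Polynomial ℂ) * shape n (fun s => n - s) p ≠ 0
      rw [shape_add_natCast_mul]
      have hmem' : r + (k : Polynomial ℂ) * p ∈ degreeLT ℂ (n + 1) := by
        rw [← Polynomial.C_eq_natCast]
        exact Submodule.add_mem _ h.r_mem (C_mul_mem_degreeLT _ h.p_mem)
      refine shape_sub_ne_zero hmem' fun h0 => ?_
      -- For `ℓ = 1` the polynomial is `q`; otherwise `(k, 1)` is not proportional to `(k, ℓ)` and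
      -- the corner condition excludes the vanishing of the top coefficient.
      by_cases hℓ1 : ℓ = 1
      · apply h.q_ne_zero
        rw [hℓ1, Nat.cast_one, one_mul, add_comm]
        exact h0
      · refine h.top k 1 ?_ ?_
        · intro hcon
          rw [one_mul] at hcon
          have : k * ℓ = k * 1 := by rw [mul_one]; exact_mod_cast hcon
          exact hℓ1 (Nat.eq_of_mul_eq_mul_left hk this)
        · have := congrArg (fun Q => Q.coeff n) h0
          simp only [Polynomial.coeff_add, Polynomial.coeff_natCast_mul,
            Polynomial.coeff_zero] at this
          push_cast
          linear_combination this
    · intro hℓ1 l τ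
      rw [wts_one] at hℓ1
      subst hℓ1
      exact hs l ha (monCurve_mem h01.symm rfl rfl τ) (subst_monCurve_one hk _ τ)
        (by rw [wts_zero]; ring)
    · intro hℓ1 l τ
      rw [wts_one] at hℓ1
      subst hℓ1
      exact hs l ha' (monCurve_mem h01.symm rfl rfl τ) (subst_monCurve_one hk _ τ)
        (by rw [wts_zero]; ring)
  · refine X_dvd_of_conjugacy h01 hw hc (n := n) (a := a) (a' := a')
      (fun l => by rw [wts_zero, wts_one]; exact hmem l)
      (crossForm_apply h01 a) (crossForm_apply h01.symm a) (crossForm_apply h01 a')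
      (crossForm_apply h01.symm a') ?_ ?_ ![p, r] ?_ ?_ ?_ hφ hu heq
    · intro P hP
      rw [wts_zero, wts_one] at hP
      rw [wts_one, e0, e0]
      have := h.bot 1 P (by rw [one_mul, mul_comm]; exact_mod_cast hP.ne)
      simpa using this
    · intro P hP
      rw [wts_zero, wts_one] at hP
      rw [wts_zero, e1, e1]
      have := h.top 1 P (by rw [one_mul, mul_comm]; exact_mod_cast hP.ne')
      simpa using this
    · change p + (ℓ : Polynomial ℂ) * r ≠ 0
      intro h0
      by_cases hk1 : k = 1
      · apply h.q_ne_zero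
        rw [hk1, Nat.cast_one, one_mul]
        exact h0
      · refine h.top 1 ℓ ?_ ?_
        · intro hcon
          rw [one_mul] at hcon
          have : ℓ * 1 = ℓ * k := by rw [mul_one]; exact_mod_cast hcon
          exact hk1 (Nat.eq_of_mul_eq_mul_left hℓ this).symm
        · have := congrArg (fun Q => Q.coeff n) h0
          simp only [Polynomial.coeff_add, Polynomial.coeff_natCast_mul,
            Polynomial.coeff_zero] at this
          push_cast
          linear_combination this
    · intro hk1 l τ
      rw [wts_zero] at hk1
      subst hk1
      exact hs l ha (monCurve_mem h01 rfl rfl τ) (subst_monCurve_zero hℓ (hpr l) τ)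
        (by rw [wts_one]; ring)
    · intro hk1 l τ
      rw [wts_zero] at hk1
      subst hk1
      exact hs l ha' (monCurve_mem h01 rfl rfl τ) (subst_monCurve_zero hℓ (hpr l) τ)
        (by rw [wts_one]; ring)

end QHFoliation

end

noncomputable section

namespace QHFoliation

open MvPowerSeries

/-! ### The normal form theorem -/

variable {k ℓ n : ℕ} {p r : Polynomial ℂ}

theorem exists_step_initialCoeffs {ωd : OneForm} (h : IsAdmissible k ℓ n p r) (hk : 0 < k)
    (hℓ : 0 < ℓ) (hn : 0 < n) (hc : Nat.Coprime k ℓ)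
    (ha : ωd.a = X 1 * hom k ℓ (ℓ * n) 0 p) (hb : ωd.b = X 0 * hom k ℓ (ℓ * n) 0 r)
    (hgen : Generic k ℓ n ωd) {m : ℕ} (hm : 0 < m) {T : Fin 2 → Series}
    (hT : ∀ i, T i ∈ wtIdeal (wts k ℓ) (k * ℓ * n + m)) :
    ∃ (f : Fin 2 → Series) (v h s : Series), (∀ i, f i ∈ wtIdeal (wts k ℓ) m) ∧
      v ∈ wtIdeal (wts k ℓ) m ∧ h ∈ wtIdeal (wts k ℓ) (k * ℓ * n + m) ∧
      s ∈ wtIdeal (wts k ℓ) (k * ℓ * n + m) ∧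
      (∀ e, coeff e h ≠ 0 → e 0 < ℓ * n ∧ e 1 < k * n) ∧ (∀ e, coeff e s ≠ 0 → e 1 < k * n) ∧
      ∀ i, lieForm (initialCoeffs k ℓ n p r) f v i + T i - normalPart k ℓ h s i ∈
        wtIdeal (wts k ℓ) (k * ℓ * n + m + 1) := by
  obtain ⟨D, L, rfl, rfl, rfl, rfl, rfl, rfl, hH, hR⟩ := exists_level h hk hℓ hn hc ha hb hgen hm
  obtain ⟨f₀, h0, f₁, h1, v, hv, h, hh, s, hs, hh', hs', e0, e1⟩ :=
    L.exists_step hH hR (hT 0) (hT 1)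
  refine ⟨![f₀, f₁], v, h, s, fun i => ?_, hv, hh, hs, hh', hs', fun i => ?_⟩
  · fin_cases i
    · exact h0
    · exact h1
  · fin_cases i
    · exact e0
    · exact e1

theorem unique_step_initialCoeffs {ωd : OneForm} (hadm : IsAdmissible k ℓ n p r) (hk : 0 < k)
    (hℓ : 0 < ℓ) (hn : 0 < n) (hc : Nat.Coprime k ℓ)
    (ha : ωd.a = X 1 * hom k ℓ (ℓ * n) 0 p) (hb : ωd.b = X 0 * hom k ℓ (ℓ * n) 0 r)
    (hgen : Generic k ℓ n ωd) {m : ℕ} (hm : 0 < m) {f : Fin 2 → Series} {v h s : Series}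
    (hf : ∀ i, f i ∈ wtIdeal (wts k ℓ) m) (hv : v ∈ wtIdeal (wts k ℓ) m)
    (hh : h ∈ wtIdeal (wts k ℓ) (k * ℓ * n + m)) (hs : s ∈ wtIdeal (wts k ℓ) (k * ℓ * n + m))
    (hh' : ∀ e, coeff e h ≠ 0 → e 0 < ℓ * n ∧ e 1 < k * n)
    (hs' : ∀ e, coeff e s ≠ 0 → e 1 < k * n)
    (he : ∀ i, lieForm (initialCoeffs k ℓ n p r) f v i - normalPart k ℓ h s i ∈
      wtIdeal (wts k ℓ) (k * ℓ * n + m + 1)) :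
    h ∈ wtIdeal (wts k ℓ) (k * ℓ * n + m + 1) ∧ s ∈ wtIdeal (wts k ℓ) (k * ℓ * n + m + 1) ∧
    ∃ g : Series, (g = 0 ∨ ∃ M, M + k * ℓ * n = m ∧ g ∈ wtIdeal (wts k ℓ) M) ∧
      f 0 - g * initialCoeffs k ℓ n p r 1 ∈ wtIdeal (wts k ℓ) (m + 1) ∧
      f 1 + g * initialCoeffs k ℓ n p r 0 ∈ wtIdeal (wts k ℓ) (m + 1) := by
  obtain ⟨D, L, rfl, rfl, rfl, rfl, rfl, rfl, hH, hR⟩ := exists_level hadm hk hℓ hn hc ha hb hgen hm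
  exact L.unique_step hH hR (hf 0) (hf 1) hv hh hs hh' hs' (he 0) (he 1)

theorem exists_setting {c : Fin n → ℂ} {ωd ω : OneForm} (h : IsAdmissible k ℓ n p r) (hk : 0 < k)
    (hℓ : 0 < ℓ) (hn : 0 < n) (hc : Nat.Coprime k ℓ)
    (ha : ωd.a = X 1 * hom k ℓ (ℓ * n) 0 p) (hb : ωd.b = X 0 * hom k ℓ (ℓ * n) 0 r)
    (hgen : Generic k ℓ n ωd) (hω : ClassQWithInitial k ℓ c ωd ω) :
    ∃ a, ω.coeffs = crossForm a ∧ Setting k ℓ n (initialCoeffs k ℓ n p r) a := by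
  obtain ⟨⟨a₁, hb'⟩, ⟨a₀, ha'⟩⟩ := dvd_of_axes hω.mem.axes
  refine ⟨![a₀, a₁], ?_, hk, hℓ, hn, initialCoeffs_mem k ℓ n p r, ?_, ?_,
    fun m hm T hT => exists_step_initialCoeffs h hk hℓ hn hc ha hb hgen hm hT,
    fun m hm f v h' s hf hv hh hs hh' hs' he =>
      unique_step_initialCoeffs h hk hℓ hn hc ha hb hgen hm hf hv hh hs hh' hs' he⟩
  · ext1 i
    fin_cases i
    · exact ha'
    · exact hb'
  -- The initial coefficient of `dx` has order exactly `k ℓ n` because `p ≠ 0`; this is what later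
  -- determines the unit.
  · intro hmem
    have := eq_zero_of_hom_mem (k := k) (ℓ := ℓ) (I := ℓ * n) (J := 0) (P := p) hk
      (by rw [Nat.mul_div_cancel_left n hℓ]; exact h.p_mem)
      (by rwa [mul_zero, add_zero, ← mul_assoc])
    apply (h.coeff_p_ne hℓ).1
    rw [this, Polynomial.coeff_zero]
  · intro i e he
    rw [map_sub, sub_eq_zero]
    rw [wt, wts_zero, wts_one] at he
    fin_cases i
    · have h1 := hω.init_a (e 0) (e 1 + 1) (by rw [deg, Nat.mul_add]; omega)
      have h2 : expo (e 0) (e 1 + 1) = e + Finsupp.single 1 1 := by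
        conv_rhs => rw [← expo_eta e]
        simp only [expo, Finsupp.single_add, add_assoc]
      rw [h2, ha, ha', coeff_X_mul_expo, coeff_X_mul_expo] at h1
      exact h1
    · have h1 := hω.init_b (e 0 + 1) (e 1) (by rw [deg, Nat.mul_add]; omega)
      have h2 : expo (e 0 + 1) (e 1) = e + Finsupp.single 0 1 := by
        conv_rhs => rw [← expo_eta e]
        simp only [expo, Finsupp.single_add]
        abel
      rw [h2, hb, hb', coeff_X_mul_expo, coeff_X_mul_expo] at h1
      exact h1

/-- A normal form which is equivalent to `ω` gives a datum. -/
theorem exists_datum {a : Fin 2 → Series} {ωd ω : OneForm} (h : IsAdmissible k ℓ n p r)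
    (hc : Nat.Coprime k ℓ)
    (hd : ωd.coeffs = crossForm (initialCoeffs k ℓ n p r)) (hω : ω.coeffs = crossForm a)
    (hS : Setting k ℓ n (initialCoeffs k ℓ n p r) a) {H : MvPolynomial (Fin 2) ℂ}
    (hH : IsHamiltonianPart k ℓ n H) {s : Fin (k * n) → PowerSeries ℂ}
    (heq : StrictlyFormallyEquivalent ω (normalForm k ℓ n ωd H s)) :
    ∃ x : Datum, x.h = H ∧ x.s = radialCoeff k ℓ n s ∧
      ∀ N, x.IsConj k ℓ n (initialCoeffs k ℓ n p r) a N := by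
  obtain ⟨φ, u, hφ, hu, he⟩ := heq
  have hw := wts_pos hS.k_pos hS.ℓ_pos
  rw [mul_pullback_eq_iff, coeffs_normalForm hd, hω] at he
  have hsm : radialCoeff k ℓ n s ∈ wtIdeal (wts k ℓ) (k * ℓ * n + 1) := by
    intro e he
    by_contra hne
    have := (coeff_radialCoeff_ne_zero hS.k_pos hne).2
    omega
  have hdvd := X_dvd_of_isAdmissible h hS.k_pos hS.ℓ_pos hc hS.a_sub
    (fun i => by rw [add_sub_cancel_left]; exact normalPart_mem k ℓ hH.mem hsm i) hφ hu he
  choose f hf using hdvd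
  have hφf : φ = scale f := funext hf
  subst hφf
  refine ⟨⟨f, u, H, radialCoeff k ℓ n s⟩, rfl, rfl, fun N => ⟨fun i => ?_,
    (sub_one_mem_wtIdeal_iff hw).mpr hu, hH.mem, hsm, hH.supp hS.k_pos hS.ℓ_pos hS.n_pos,
    fun e he => (coeff_radialCoeff_ne_zero hS.k_pos he).1, fun i => ?_⟩⟩
  · rw [sub_one_mem_wtIdeal_iff hw]
    have := (hφ i).2 i
    rwa [scale, coeff_single_X_mul, if_pos rfl, if_pos rfl] at this
  · rw [he, X_mul_crossForm, sub_self]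
    exact Ideal.zero_mem _

end QHFoliation

end

theorem theoremA (k ℓ n : ℕ) (hk : 0 < k) (hℓ : 0 < ℓ) (hkℓ : Nat.Coprime k ℓ) (hn : 0 < n)
    (c : Fin n → ℂ) (hc : ∀ i, c i ≠ 0) (hc_inj : Function.Injective c)
    (ωd : QHFoliation.OneForm) (hωd : QHFoliation.ClassQInitial k ℓ c ωd)
    (hgen : QHFoliation.Generic k ℓ n ωd)
    (ω : QHFoliation.OneForm) (hω : QHFoliation.ClassQWithInitial k ℓ c ωd ω) :
    ∃! p : MvPolynomial (Fin 2) ℂ × (Fin (k * n) → PowerSeries ℂ),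
      QHFoliation.IsHamiltonianPart k ℓ n p.1 ∧
        QHFoliation.StrictlyFormallyEquivalent ω (QHFoliation.normalForm k ℓ n ωd p.1 p.2) := by
  obtain ⟨p, r, ha, hb, hadm⟩ := QHFoliation.exists_isAdmissible hk hℓ hkℓ hn hωd hgen.1
  have hd : ωd.coeffs = QHFoliation.crossForm (QHFoliation.initialCoeffs k ℓ n p r) := by
    ext1 i
    fin_cases i
    · exact ha
    · exact hb
  obtain ⟨a, hωa, hS⟩ := QHFoliation.exists_setting hadm hk hℓ hn hkℓ ha hb hgen hω
  have hw := QHFoliation.wts_pos hk hℓ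
  obtain ⟨x, hx⟩ := hS.exists_conj
  obtain ⟨H, hH, hxH⟩ := QHFoliation.exists_hamiltonianPart (hx 0).h_mem (hx 0).h_supp
  obtain ⟨s, hxs⟩ := QHFoliation.exists_radialCoeff hk (hx 0).s_mem (hx 0).s_supp
  refine ⟨(H, s), ⟨hH, QHFoliation.scale x.f, x.u, ?_, ?_, ?_⟩, ?_⟩
  · exact QHFoliation.isStrictDiffeo_scale fun i =>
      (QHFoliation.sub_one_mem_wtIdeal_iff hw).mp ((hx 0).f_sub i)
  · exact (QHFoliation.sub_one_mem_wtIdeal_iff hw).mp (hx 0).u_sub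
  · rw [QHFoliation.mul_pullback_eq_iff, QHFoliation.coeffs_normalForm hd, hωa]
    intro i
    rw [QHFoliation.X_mul_crossForm, hxH, hxs, ← sub_eq_zero]
    exact QHFoliation.eq_zero_of_mem_wtIdeal (w := QHFoliation.wts k ℓ) fun N =>
      QHFoliation.wtIdeal_mono (by omega) ((hx N).conj i)
  · rintro ⟨H', s'⟩ ⟨hH', heq⟩
    -- Any other equivalence preserves the axes, hence has the form `(x f₀, y f₁)` and can be
    -- compared with the constructed one.
    obtain ⟨y, hyH, hys, hy⟩ := QHFoliation.exists_datum hadm hkℓ hd hωa hS hH' heq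
    obtain ⟨e1, e2⟩ := hS.unique_conj hy hx
    rw [hyH, ← hxH] at e1
    rw [hys, ← hxs] at e2
    exact Prod.ext (MvPolynomial.coe_injective _ _ e1) (QHFoliation.radialCoeff_injective k ℓ n e2)
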